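/- Let $k$ be a field. A dialgebra over $k$ is a $k$-space with two bilinear associative multiplications $\vdash,\dashv$ such that $a\dashv(b\vdash c)=a\dashv b\dashv c$, $(a\dashv b)\vdash c=a\vdash b\vdash c$ and $a\vdash(b\dashv c)=(a\vdash b)\dashv c$. For a set $Z$, the free dialgebra $D(Z)$ has as $k$-basis the normal diwords $z_{-m}\cdots z_{-1}\dot z_0z_1\cdots z_n$ ($m,n\ge 0$, $z_i\in Z$), that is, nonempty words with a marked letter, the center $z_0$; $[u]\vdash[v]$ (respectively $[u]\dashv[v]$) is the concatenation $uv$ with the center of $[v]$ (respectively of $[u]$). For $T\subseteq D(Z)$ let $\mathrm{Id}(T)$ be the two-sided ideal generated by $T$ and $D(Z\mid T)=D(Z)/\mathrm{Id}(T)$. If $Z$ is well ordered, normal diwords are ordered by comparing the weights $(n+m+1,\,m,\,z_{-m},\dots,z_n)$ lexicographically; $\overline f$ is the leading term of $f\ne 0$, $\deg f=|\overline f|$ its length, and $f$ is monic if $\overline f$ has coefficient $1$. Call $f$ left (right) normed if in every diword of $f$ the center is the last (first) letter. Let $T\subseteq D(Z)$ and $s\in T$. An $s$-diword $[asb]$ is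 an expression $z_{-m}\vdash\cdots\vdash z_0\dashv\cdots\dashv z_n$ with one $z_p$ replaced by $s$. It is normal if $p=0$, or $p<0$ and $s$ is left normed, or $p>0$ and $s$ is right normed. It is a left (right) normed $s$-diword if moreover both $s$ and $[asb]$ are left (right) normed. Write $[a[\overline s]b]$ for the diword obtained by putting $\overline s$ in place of $s$. A monic set $T$ is a Gröbner–Shirshov basis if for all $f,g\in T$ and $z\in Z$: (a) if $f$ is not right normed, $z\dashv f$ is a linear combination of right normed $s$-diwords $[asb]$, $s\in T$, with $|[a[\overline s]b]|\le\deg(z\dashv f)$; if $f$ is not left normed, $f\vdash z$ is a linear combination of left normed $s$-diwords $[asb]$, $s\in T$, with $|[a[\overline s]b]|\le\deg(f\vdash z)$ (the zero element counts as such a combination, the empty one); (b) whenever $[w]=\overline f=[a[\overline g]b]$ with $[agb]$ normal, $f-[agb]$ is a linear combination of normal $s$-diwords $[a's b']$, $s\in T$, with $[a'[\overline s]b']<[w]$, which are all right (left) normed $s$-diwords if $f$ and $[agb]$ both are right (left) normed diwords in this sense; (c) whenever $[w]=[\overline f\,b]=[a\,\overline g]$ with $|\overline f|+|\overline g|>|w|$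 and $[fb]$, $[ag]$ normal, the same holds for $[fb]-[ag]$, with $[fb]$, $[ag]$ in place of $f$, $[agb]$. Let $\mathrm{Irr}(T)$ be the set of normal diwords not of the form $[a[\overline s]b]$ with $s\in T$ and $[asb]$ normal. **Theorem.** Let $D_1,D_2$ be dialgebras over $k$, and let $A_1\subseteq D_1$, $A_2\subseteq D_2$ be the ideals generated by all elements $a\dashv b-a\vdash b$. Let $X=\{x_i\mid i\in I\}$ and $Y=\{y_l\mid l\in J\}$ be disjoint well ordered $k$-bases of $D_1$ and $D_2$, and let $I_0\subseteq I$, $J_0\subseteq J$ be such that $X_0=\{x_{i_0}\mid i_0\in I_0\}$ and $Y_0=\{y_{l_0}\mid l_0\in J_0\}$ are $k$-bases of $A_1$ and $A_2$. Order $X\cup Y$ by putting every $x_i$ before every $y_l$. Write $\{d\}$ for the expansion of $d\in D_1$ (or $D_2$) in the basis, viewed as a linear combination of letters, and let $S_1=\{x_i\vdash x_j-\{x_i\vdash x_j\},\ x_i\dashv x_j-\{x_i\dashv x_j\}\mid i,j\in I\}$ and $S_2=\{y_l\vdash y_m-\{y_l\vdash y_m\},\ y_l\dashv y_m-\{y_l\dashv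 y_m\}\mid l,m\in J\}$. Then $D(X\cup Y\mid S_1\cup S_2)$, with the dialgebra homomorphisms from $D_1$ and $D_2$ sending $x_i$ and $y_l$ to the classes of the corresponding letters, is the free product (coproduct) $D_1*D_2$ of dialgebras. Let $$S=S_1\cup S_2\cup\{x_{i_0}\vdash y_l,\ y_l\dashv x_{i_0}\mid i_0\in I_0,\ l\in J\}\cup\{y_{l_0}\vdash x_i,\ x_i\dashv y_{l_0}\mid i\in I,\ l_0\in J_0\}.$$ (i) $S$ is a Gröbner–Shirshov basis in $D(X\cup Y)$, and $\mathrm{Id}(S)=\mathrm{Id}(S_1\cup S_2)$. (ii) $\mathrm{Irr}(S)$ consists of all $z_{-m}\cdots z_{-1}\dot z_0z_1\cdots z_n$ with $m,n\ge 0$, $z_0\in X\cup Y$, $z_i\in(X\setminus X_0)\cup(Y\setminus Y_0)$ for $i\ne 0$, and neither $\{z_j,z_{j+1}\}\subseteq X$ nor $\{z_j,z_{j+1}\}\subseteq Y$ for $-m\le j\le n-1$. The classes of the elements of $\mathrm{Irr}(S)$ are pairwise distinct and form a $k$-linear basis of $D_1*D_2$. -/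

import Mathlib

noncomputable section

/-! ### Dialgebras, homomorphisms, ideals, quotients -/

/-- The two multiplications `⊢` and `⊣` of a dialgebra. -/
class DiMul (D : Type*) where
  vdash : D → D → D
  dashv : D → D → D

infixl:70 " ⊢ᵈ " => DiMul.vdash
infixl:70 " ⊣ᵈ " => DiMul.dashv

/-- A dialgebra over the field `k`: a `k`-space with two bilinear associative multiplications
satisfying the three mixed identities. -/
class Dialgebra (k : Type*) (D : Type*) [Field k] [AddCommGroup D] [Module k D]
    extends DiMul D where
  add_vdash : ∀ a b c : D, (a + b) ⊢ᵈ c = a ⊢ᵈ c + b ⊢ᵈ c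
  vdash_add : ∀ a b c : D, a ⊢ᵈ (b + c) = a ⊢ᵈ b + a ⊢ᵈ c
  smul_vdash : ∀ (r : k) (a b : D), (r • a) ⊢ᵈ b = r • (a ⊢ᵈ b)
  vdash_smul : ∀ (r : k) (a b : D), a ⊢ᵈ (r • b) = r • (a ⊢ᵈ b)
  add_dashv : ∀ a b c : D, (a + b) ⊣ᵈ c = a ⊣ᵈ c + b ⊣ᵈ c
  dashv_add : ∀ a b c : D, a ⊣ᵈ (b + c) = a ⊣ᵈ b + a ⊣ᵈ c
  smul_dashv : ∀ (r : k) (a b : D), (r • a) ⊣ᵈ b = r • (a ⊣ᵈ b)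
  dashv_smul : ∀ (r : k) (a b : D), a ⊣ᵈ (r • b) = r • (a ⊣ᵈ b)
  vdash_assoc : ∀ a b c : D, (a ⊢ᵈ b) ⊢ᵈ c = a ⊢ᵈ (b ⊢ᵈ c)
  dashv_assoc : ∀ a b c : D, (a ⊣ᵈ b) ⊣ᵈ c = a ⊣ᵈ (b ⊣ᵈ c)
  dashv_vdash : ∀ a b c : D, a ⊣ᵈ (b ⊢ᵈ c) = (a ⊣ᵈ b) ⊣ᵈ c
  dashv_vdash' : ∀ a b c : D, (a ⊣ᵈ b) ⊢ᵈ c = a ⊢ᵈ (b ⊢ᵈ c)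
  vdash_dashv : ∀ a b c : D, a ⊢ᵈ (b ⊣ᵈ c) = (a ⊢ᵈ b) ⊣ᵈ c

/-- Homomorphisms of dialgebras. -/
@[ext]
structure DialgebraHom (k : Type*) (D E : Type*) [Field k]
    [AddCommGroup D] [Module k D] [Dialgebra k D]
    [AddCommGroup E] [Module k E] [Dialgebra k E] where
  toLinearMap : D →ₗ[k] E
  map_vdash : ∀ a b : D, toLinearMap (a ⊢ᵈ b) = toLinearMap a ⊢ᵈ toLinearMap b
  map_dashv : ∀ a b : D, toLinearMap (a ⊣ᵈ b) = toLinearMap a ⊣ᵈ toLinearMap b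

/-- A (two-sided) ideal of a dialgebra. -/
structure IsDialgebraIdeal (k : Type*) {D : Type*} [Field k] [AddCommGroup D] [Module k D]
    [Dialgebra k D] (A : Submodule k D) : Prop where
  vdash_left : ∀ a x : D, x ∈ A → a ⊢ᵈ x ∈ A
  vdash_right : ∀ a x : D, x ∈ A → x ⊢ᵈ a ∈ A
  dashv_left : ∀ a x : D, x ∈ A → a ⊣ᵈ x ∈ A
  dashv_right : ∀ a x : D, x ∈ A → x ⊣ᵈ a ∈ A

/-- The ideal `Id(T)` generated by a set `T`. -/
def dialgebraIdeal (k : Type*) {D : Type*} [Field k] [AddCommGroup D] [Module k D]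
    [Dialgebra k D] (T : Set D) : Submodule k D :=
  sInf {A | IsDialgebraIdeal k A ∧ T ⊆ (A : Set D)}

theorem isDialgebraIdeal_dialgebraIdeal (k : Type*) {D : Type*} [Field k] [AddCommGroup D]
    [Module k D] [Dialgebra k D] (T : Set D) : IsDialgebraIdeal k (dialgebraIdeal k T) := by
  constructor <;> intro a x hx <;> rw [dialgebraIdeal, Submodule.mem_sInf] at hx ⊢ <;>
    intro A hA
  · exact hA.1.vdash_left a x (hx A hA)
  · exact hA.1.vdash_right a x (hx A hA)
  · exact hA.1.dashv_left a x (hx A hA)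
  · exact hA.1.dashv_right a x (hx A hA)

section Quotient

variable (k : Type*) {D : Type*} [Field k] [AddCommGroup D] [Module k D] [Dialgebra k D]
  (T : Set D)

theorem dialgebraIdeal_congr_vdash {a a' b b' : D} (ha : a - a' ∈ dialgebraIdeal k T)
    (hb : b - b' ∈ dialgebraIdeal k T) : a ⊢ᵈ b - a' ⊢ᵈ b' ∈ dialgebraIdeal k T := by
  have h := isDialgebraIdeal_dialgebraIdeal k T
  have e₁ : a ⊢ᵈ b = (a - a') ⊢ᵈ b + a' ⊢ᵈ b := by
    rw [← Dialgebra.add_vdash (k := k), sub_add_cancel]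
  have e₂ : a' ⊢ᵈ b = a' ⊢ᵈ (b - b') + a' ⊢ᵈ b' := by
    rw [← Dialgebra.vdash_add (k := k), sub_add_cancel]
  rw [e₁, e₂, ← add_assoc, add_sub_cancel_right]
  exact add_mem (h.vdash_right _ _ ha) (h.vdash_left _ _ hb)

theorem dialgebraIdeal_congr_dashv {a a' b b' : D} (ha : a - a' ∈ dialgebraIdeal k T)
    (hb : b - b' ∈ dialgebraIdeal k T) : a ⊣ᵈ b - a' ⊣ᵈ b' ∈ dialgebraIdeal k T := by
  have h := isDialgebraIdeal_dialgebraIdeal k T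
  have e₁ : a ⊣ᵈ b = (a - a') ⊣ᵈ b + a' ⊣ᵈ b := by
    rw [← Dialgebra.add_dashv (k := k), sub_add_cancel]
  have e₂ : a' ⊣ᵈ b = a' ⊣ᵈ (b - b') + a' ⊣ᵈ b' := by
    rw [← Dialgebra.dashv_add (k := k), sub_add_cancel]
  rw [e₁, e₂, ← add_assoc, add_sub_cancel_right]
  exact add_mem (h.dashv_right _ _ ha) (h.dashv_left _ _ hb)

/-- The quotient of a dialgebra by the ideal generated by `T`, with the induced
multiplications. -/
instance dialgebraQuotient : Dialgebra k (D ⧸ dialgebraIdeal k T) where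
  vdash := Quotient.map₂ (fun a b : D => a ⊢ᵈ b) (fun _ _ ha _ _ hb =>
    (Submodule.quotientRel_def _).2 (dialgebraIdeal_congr_vdash k T
      ((Submodule.quotientRel_def _).1 ha) ((Submodule.quotientRel_def _).1 hb)))
  dashv := Quotient.map₂ (fun a b : D => a ⊣ᵈ b) (fun _ _ ha _ _ hb =>
    (Submodule.quotientRel_def _).2 (dialgebraIdeal_congr_dashv k T
      ((Submodule.quotientRel_def _).1 ha) ((Submodule.quotientRel_def _).1 hb)))
  add_vdash := by
    rintro ⟨a⟩ ⟨b⟩ ⟨c⟩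
    exact congrArg Submodule.Quotient.mk (Dialgebra.add_vdash (k := k) a b c)
  vdash_add := by
    rintro ⟨a⟩ ⟨b⟩ ⟨c⟩
    exact congrArg Submodule.Quotient.mk (Dialgebra.vdash_add (k := k) a b c)
  smul_vdash := by
    rintro r ⟨a⟩ ⟨b⟩
    exact congrArg Submodule.Quotient.mk (Dialgebra.smul_vdash r a b)
  vdash_smul := by
    rintro r ⟨a⟩ ⟨b⟩
    exact congrArg Submodule.Quotient.mk (Dialgebra.vdash_smul r a b)
  add_dashv := by
    rintro ⟨a⟩ ⟨b⟩ ⟨c⟩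
    exact congrArg Submodule.Quotient.mk (Dialgebra.add_dashv (k := k) a b c)
  dashv_add := by
    rintro ⟨a⟩ ⟨b⟩ ⟨c⟩
    exact congrArg Submodule.Quotient.mk (Dialgebra.dashv_add (k := k) a b c)
  smul_dashv := by
    rintro r ⟨a⟩ ⟨b⟩
    exact congrArg Submodule.Quotient.mk (Dialgebra.smul_dashv r a b)
  dashv_smul := by
    rintro r ⟨a⟩ ⟨b⟩
    exact congrArg Submodule.Quotient.mk (Dialgebra.dashv_smul r a b)
  vdash_assoc := by
    rintro ⟨a⟩ ⟨b⟩ ⟨c⟩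
    exact congrArg Submodule.Quotient.mk (Dialgebra.vdash_assoc (k := k) a b c)
  dashv_assoc := by
    rintro ⟨a⟩ ⟨b⟩ ⟨c⟩
    exact congrArg Submodule.Quotient.mk (Dialgebra.dashv_assoc (k := k) a b c)
  dashv_vdash := by
    rintro ⟨a⟩ ⟨b⟩ ⟨c⟩
    exact congrArg Submodule.Quotient.mk (Dialgebra.dashv_vdash (k := k) a b c)
  dashv_vdash' := by
    rintro ⟨a⟩ ⟨b⟩ ⟨c⟩
    exact congrArg Submodule.Quotient.mk (Dialgebra.dashv_vdash' (k := k) a b c)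
  vdash_dashv := by
    rintro ⟨a⟩ ⟨b⟩ ⟨c⟩
    exact congrArg Submodule.Quotient.mk (Dialgebra.vdash_dashv (k := k) a b c)

end Quotient

/-- `(P, ε₁, ε₂)` is a free product (coproduct) of the dialgebras `D₁` and `D₂`; the test
dialgebras range over an arbitrary universe `w`. -/
def IsDialgebraFreeProduct.{w, u, v₁, v₂, v₃} {k : Type u} {D₁ : Type v₁} {D₂ : Type v₂}
    {P : Type v₃} [Field k]
    [AddCommGroup D₁] [Module k D₁] [Dialgebra k D₁]
    [AddCommGroup D₂] [Module k D₂] [Dialgebra k D₂]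
    [AddCommGroup P] [Module k P] [Dialgebra k P]
    (ε₁ : DialgebraHom k D₁ P) (ε₂ : DialgebraHom k D₂ P) : Prop :=
  ∀ (D : Type w) [AddCommGroup D] [Module k D] [Dialgebra k D]
    (δ₁ : DialgebraHom k D₁ D) (δ₂ : DialgebraHom k D₂ D),
    ∃! f : DialgebraHom k P D,
      f.toLinearMap ∘ₗ ε₁.toLinearMap = δ₁.toLinearMap ∧
      f.toLinearMap ∘ₗ ε₂.toLinearMap = δ₂.toLinearMap

/-! ### Normal diwords and the free dialgebra -/

/-- A normal diword `x₋ₘ ⋯ x₋₁ ẋ₀ x₁ ⋯ xₙ` in the alphabet `Z`: a nonempty word with a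
distinguished letter, its center. -/
@[ext]
structure Diword (Z : Type*) where
  left : List Z
  center : Z
  right : List Z

namespace Diword

variable {Z : Type*}

/-- The underlying associative word. -/
def word (u : Diword Z) : List Z := u.left ++ u.center :: u.right

/-- The length `n + m + 1`. -/
def length (u : Diword Z) : ℕ := u.word.length

/-- The diword `ẋ` of length one. -/
def letter (x : Z) : Diword Z := ⟨[], x, []⟩

/-- `[u] ⊢ [v]` is `[uv]` with the center of `[v]`. -/
def vdash (u v : Diword Z) : Diword Z := ⟨u.word ++ v.left, v.center, v.right⟩

/-- `[u] ⊣ [v]` is `[uv]` with the center of `[u]`. -/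
def dashv (u v : Diword Z) : Diword Z := ⟨u.left, u.center, u.right ++ v.word⟩

/-- The weight `(n + m + 1, m, x₋ₘ, …, x₀, …, xₙ)`, in the lexicographic product. -/
def wt (u : Diword Z) : ℕ ×ₗ (ℕ ×ₗ List Z) := toLex (u.length, toLex (u.left.length, u.word))

theorem wt_injective : Function.Injective (wt : Diword Z → ℕ ×ₗ (ℕ ×ₗ List Z)) := by
  intro u v h
  have h' := toLex.injective h
  simp only [Prod.mk.injEq] at h'
  have h'' := toLex.injective h'.2
  simp only [Prod.mk.injEq] at h''
  obtain ⟨h₁, h₂⟩ := List.append_inj h''.2 h''.1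
  simp only [List.cons.injEq] at h₂
  exact Diword.ext h₁ h₂.1 h₂.2

/-- The deg-lex ordering on normal diwords: weights are compared lexicographically. -/
instance [LinearOrder Z] : LinearOrder (Diword Z) := LinearOrder.lift' wt wt_injective

end Diword

/-- The underlying space of the free dialgebra `D(Z)`: it has the normal diwords as basis. -/
abbrev FreeDialgebra (k : Type*) (Z : Type*) [Field k] := Diword Z →₀ k

namespace FreeDialgebra

variable {k : Type*} {Z : Type*} [Field k]

/-- The bilinear extension of an operation on diwords. -/
def bilin (op : Diword Z → Diword Z → Diword Z) :
    FreeDialgebra k Z →ₗ[k] FreeDialgebra k Z →ₗ[k] FreeDialgebra k Z :=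
  Finsupp.linearCombination k (fun u => Finsupp.lmapDomain k k (op u))

theorem bilin_single (op : Diword Z → Diword Z → Diword Z) (u v : Diword Z) (r s : k) :
    bilin op (Finsupp.single u r) (Finsupp.single v s) = Finsupp.single (op u v) (r * s) := by
  simp [bilin, Finsupp.mapDomain_single]

theorem bilin_assoc (op₁ op₂ op₃ op₄ : Diword Z → Diword Z → Diword Z)
    (h : ∀ u v w, op₁ (op₂ u v) w = op₃ u (op₄ v w)) (a b c : FreeDialgebra k Z) :
    bilin op₁ (bilin op₂ a b) c = bilin op₃ a (bilin op₄ b c) := by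
  induction a using Finsupp.induction_linear with
  | zero => simp
  | add a a' ha ha' => simp only [map_add, LinearMap.add_apply, ha, ha']
  | single u r =>
    induction b using Finsupp.induction_linear with
    | zero => simp
    | add b b' hb hb' => simp only [map_add, LinearMap.add_apply, hb, hb']
    | single v s =>
      induction c using Finsupp.induction_linear with
      | zero => simp
      | add c c' hc hc' => simp only [map_add, hc, hc']
      | single w t => simp only [bilin_single, h, mul_assoc]

instance : Dialgebra k (FreeDialgebra k Z) where
  vdash f g := bilin Diword.vdash f g
  dashv f g := bilin Diword.dashv f g
  add_vdash a b c := by simp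
  vdash_add a b c := by simp
  smul_vdash r a b := by simp
  vdash_smul r a b := by simp
  add_dashv a b c := by simp
  dashv_add a b c := by simp
  smul_dashv r a b := by simp
  dashv_smul r a b := by simp
  vdash_assoc := bilin_assoc _ _ _ _ (by intros; simp [Diword.vdash, Diword.word])
  dashv_assoc := bilin_assoc _ _ _ _ (by intros; simp [Diword.dashv, Diword.word])
  dashv_vdash a b c := (bilin_assoc _ _ _ _
    (by intros; simp [Diword.vdash, Diword.dashv, Diword.word]) a b c).symm
  dashv_vdash' := bilin_assoc _ _ _ _
    (by intros; simp [Diword.vdash, Diword.dashv, Diword.word])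
  vdash_dashv a b c := (bilin_assoc _ _ _ _
    (by intros; simp [Diword.vdash, Diword.dashv]) a b c).symm

/-- A normal diword as an element of the free dialgebra. -/
def of (k : Type*) {Z : Type*} [Field k] (u : Diword Z) : FreeDialgebra k Z :=
  Finsupp.single u 1

/-- A letter as an element of the free dialgebra. -/
def gen (k : Type*) {Z : Type*} [Field k] (x : Z) : FreeDialgebra k Z := of k (Diword.letter x)

/-- `f` is left normed: every diword of its support has its center at the right end. -/
def LeftNormed (f : FreeDialgebra k Z) : Prop := ∀ u ∈ f.support, u.right = []

/-- `f` is right normed: every diword of its support has its center at the left end. -/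
def RightNormed (f : FreeDialgebra k Z) : Prop := ∀ u ∈ f.support, u.left = []

/-- The degree: the largest length of a diword of the support. As the ordering compares lengths
first, this is the length of the leading term. -/
def deg (f : FreeDialgebra k Z) : ℕ := f.support.sup Diword.length

/-- `[u]` is the leading term of `f`. -/
def IsLeading [LinearOrder Z] (f : FreeDialgebra k Z) (u : Diword Z) : Prop :=
  u ∈ f.support ∧ ∀ v ∈ f.support, v ≤ u

/-- `f` is monic: the coefficient of its leading term is `1`. -/
def Monic [LinearOrder Z] (f : FreeDialgebra k Z) : Prop := ∃ u, IsLeading f u ∧ f u = 1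

/-- `x₁ ⊢ ⋯ ⊢ xₚ ⊢ f` for a word `a = x₁ ⋯ xₚ`. -/
def vdashWord (a : List Z) (f : FreeDialgebra k Z) : FreeDialgebra k Z :=
  a.foldr (fun x g => gen k x ⊢ᵈ g) f

/-- `f ⊣ x₁ ⊣ ⋯ ⊣ xₚ` for a word `b = x₁ ⋯ xₚ`. -/
def dashvWord (f : FreeDialgebra k Z) (b : List Z) : FreeDialgebra k Z :=
  b.foldl (fun g x => g ⊣ᵈ gen k x) f

end FreeDialgebra

/-! ### `S`-diwords -/

/-- A diword `x₋ₘ ⊢ ⋯ ⊢ x₋₁ ⊢ x₀ ⊣ x₁ ⊣ ⋯ ⊣ xₙ` in which the letter at place `p` is replaced by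
a hole: `center a b` for `p = 0`; `left a b₁ x₀ b₂` for `p < 0` (the hole stands between `a` and
`b₁`, to the left of the center `x₀`); `right a₁ x₀ a₂ b` for `p > 0` (the hole stands between
`a₂` and `b`, to the right of the center `x₀`). -/
inductive DiContext (Z : Type*) where
  | center (a b : List Z)
  | left (a b₁ : List Z) (x₀ : Z) (b₂ : List Z)
  | right (a₁ : List Z) (x₀ : Z) (a₂ b : List Z)

namespace DiContext

open FreeDialgebra

variable {k : Type*} {Z : Type*} [Field k]

/-- The word `a` to the left of the hole in `[asb]`. -/
def pre : DiContext Z → List Z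
  | center a _ => a
  | left a _ _ _ => a
  | right a₁ x₀ a₂ _ => a₁ ++ x₀ :: a₂

/-- The word `b` to the right of the hole in `[asb]`. -/
def post : DiContext Z → List Z
  | center _ b => b
  | left _ b₁ x₀ b₂ => b₁ ++ x₀ :: b₂
  | right _ _ _ b => b

/-- The `s`-diword `[asb]`. -/
def plug (s : FreeDialgebra k Z) : DiContext Z → FreeDialgebra k Z
  | center a b => vdashWord a (dashvWord s b)
  | left a b₁ x₀ b₂ => vdashWord a (s ⊢ᵈ vdashWord b₁ (dashvWord (gen k x₀) b₂))
  | right a₁ x₀ a₂ b => dashvWord (dashvWord (vdashWord a₁ (gen k x₀)) a₂ ⊣ᵈ s) b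

/-- The diword `[a[w]b]`. -/
def plugWord (w : Diword Z) : DiContext Z → Diword Z
  | center a b => ⟨a ++ w.left, w.center, w.right ++ b⟩
  | left a b₁ x₀ b₂ => ⟨a ++ w.word ++ b₁, x₀, b₂⟩
  | right a₁ x₀ a₂ b => ⟨a₁, x₀, a₂ ++ w.word ++ b⟩

/-- `[asb]` is a normal `s`-diword. -/
def Normal (s : FreeDialgebra k Z) : DiContext Z → Prop
  | center _ _ => True
  | left _ _ _ _ => LeftNormed s
  | right _ _ _ _ => RightNormed s

/-- `[asb]` is a left normed `s`-diword. -/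
def LeftNormedDiword (s : FreeDialgebra k Z) (C : DiContext Z) : Prop :=
  C.Normal s ∧ LeftNormed s ∧ LeftNormed (C.plug s)

/-- `[asb]` is a right normed `s`-diword. -/
def RightNormedDiword (s : FreeDialgebra k Z) (C : DiContext Z) : Prop :=
  C.Normal s ∧ RightNormed s ∧ RightNormed (C.plug s)

end DiContext

/-! ### Compositions and Gröbner–Shirshov bases -/

section GroebnerShirshov

open FreeDialgebra DiContext

variable {k : Type*} {Z : Type*} [Field k] [LinearOrder Z]

/-- Triviality modulo `S` of the composition of left multiplication `h = x ⊣ f`: it is a linear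
combination of right normed `S`-diwords `[asb]` with `|[a[s̄]b]| ≤ deg h`. -/
def TrivialLeftMul (S : Set (FreeDialgebra k Z)) (h : FreeDialgebra k Z) : Prop :=
  h ∈ Submodule.span k {g | ∃ s ∈ S, ∃ C : DiContext Z, C.RightNormedDiword s ∧
    (∃ v, IsLeading s v ∧ (C.plugWord v).length ≤ deg h) ∧ g = C.plug s}

/-- Triviality modulo `S` of the composition of right multiplication `h = f ⊢ x`: it is a linear
combination of left normed `S`-diwords `[asb]` with `|[a[s̄]b]| ≤ deg h`. -/
def TrivialRightMul (S : Set (FreeDialgebra k Z)) (h : FreeDialgebra k Z) : Prop :=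
  h ∈ Submodule.span k {g | ∃ s ∈ S, ∃ C : DiContext Z, C.LeftNormedDiword s ∧
    (∃ v, IsLeading s v ∧ (C.plugWord v).length ≤ deg h) ∧ g = C.plug s}

/-- Triviality modulo `(S, [w])` of the composition `[C f] - [E g]` of the normal diwords `[C f]`
and `[E g]`: it is a linear combination of normal `S`-diwords `[asb]` with `[a[s̄]b] < [w]`, all of
them right (left) normed `S`-diwords if both `[C f]` and `[E g]` are. -/
def TrivialComposition (S : Set (FreeDialgebra k Z)) (f : FreeDialgebra k Z) (C : DiContext Z)
    (g : FreeDialgebra k Z) (E : DiContext Z) (w : Diword Z) : Prop :=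
  C.plug f - E.plug g ∈ Submodule.span k {h | ∃ s ∈ S, ∃ F : DiContext Z, F.Normal s ∧
    (∃ v, IsLeading s v ∧ F.plugWord v < w) ∧
    (C.RightNormedDiword f ∧ E.RightNormedDiword g → F.RightNormedDiword s) ∧
    (C.LeftNormedDiword f ∧ E.LeftNormedDiword g → F.LeftNormedDiword s) ∧ h = F.plug s}

/-- `S` is a Gröbner–Shirshov basis in the free dialgebra `D(Z)`. -/
structure IsGroebnerShirshovBasis (S : Set (FreeDialgebra k Z)) : Prop where
  monic : ∀ f ∈ S, Monic f
  left_mul : ∀ f ∈ S, ¬ RightNormed f → ∀ x : Z, TrivialLeftMul S (gen k x ⊣ᵈ f)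
  right_mul : ∀ f ∈ S, ¬ LeftNormed f → ∀ x : Z, TrivialRightMul S (f ⊢ᵈ gen k x)
  /-- Compositions of inclusion, `[w] = [f̄] = [a[ḡ]b]`; here `f` is plugged into the empty
  context. -/
  inclusion : ∀ f ∈ S, ∀ g ∈ S, ∀ (E : DiContext Z) (u v : Diword Z),
    IsLeading f u → IsLeading g v → E.Normal g → u = E.plugWord v →
    TrivialComposition S f (.center [] []) g E u
  /-- Compositions of intersection, `[w] = [[f̄]b] = [a[ḡ]]` with `|f̄| + |ḡ| > |w|`. -/
  intersection : ∀ f ∈ S, ∀ g ∈ S, ∀ (C E : DiContext Z) (u v w : Diword Z),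
    IsLeading f u → IsLeading g v → C.Normal f → E.Normal g → C.pre = [] → E.post = [] →
    w = C.plugWord u → w = E.plugWord v → w.length < u.length + v.length →
    TrivialComposition S f C g E w

/-- `Irr(S)`: the normal diwords that are not of the form `[a[s̄]b]` with `s ∈ S` and `[asb]` a
normal `s`-diword. -/
def Irr (S : Set (FreeDialgebra k Z)) : Set (Diword Z) :=
  {u | ¬ ∃ s ∈ S, ∃ C : DiContext Z, C.Normal s ∧ ∃ v, IsLeading s v ∧ u = C.plugWord v}

end GroebnerShirshov

/-! ### The free product of two dialgebras -/

section FreeProduct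

open FreeDialgebra

variable {k : Type*} [Field k]

/-- The ideal of `D` generated by the elements `a ⊣ b - a ⊢ b`. -/
def barIdeal (k : Type*) (D : Type*) [Field k] [AddCommGroup D] [Module k D] [Dialgebra k D] :
    Submodule k D :=
  dialgebraIdeal k {d | ∃ a b : D, d = a ⊣ᵈ b - a ⊢ᵈ b}

/-- `{d}`: the element `d` of `D`, expanded in the basis `B` and written as a linear combination of
letters, where `φ i` is the letter that stands for the basis vector `B i`. -/
def expand {D ι Z : Type*} [AddCommGroup D] [Module k D] (B : Module.Basis ι k D) (φ : ι → Z) :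
    D →ₗ[k] FreeDialgebra k Z :=
  B.constr k (fun i => gen k (φ i))

/-- The multiplication table of `D` in the basis `B`. -/
def multTable {D ι Z : Type*} [AddCommGroup D] [Module k D] [Dialgebra k D]
    (B : Module.Basis ι k D) (φ : ι → Z) : Set (FreeDialgebra k Z) :=
  {f | ∃ i j, f = gen k (φ i) ⊢ᵈ gen k (φ j) - expand B φ (B i ⊢ᵈ B j)} ∪
  {f | ∃ i j, f = gen k (φ i) ⊣ᵈ gen k (φ j) - expand B φ (B i ⊣ᵈ B j)}

variable {D₁ D₂ I J : Type*}
  [AddCommGroup D₁] [Module k D₁] [Dialgebra k D₁]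
  [AddCommGroup D₂] [Module k D₂] [Dialgebra k D₂]

/-- `S₁ ∪ S₂` in `D(X ∪ Y)`. The alphabet `X ∪ Y` is the lexicographic sum `I ⊕ₗ J`, in which every
`x_i = inlₗ i` precedes every `y_l = inrₗ l`. -/
def freeProductTables (B₁ : Module.Basis I k D₁) (B₂ : Module.Basis J k D₂) :
    Set (FreeDialgebra k (I ⊕ₗ J)) :=
  multTable B₁ Sum.inlₗ ∪ multTable B₂ Sum.inrₗ

/-- The set `S`: the multiplication tables together with `x_{i₀} ⊢ y_l`, `y_l ⊣ x_{i₀}`,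
`y_{l₀} ⊢ x_i` and `x_i ⊣ y_{l₀}`. -/
def freeProductRelations (B₁ : Module.Basis I k D₁) (I₀ : Set I) (B₂ : Module.Basis J k D₂)
    (J₀ : Set J) : Set (FreeDialgebra k (I ⊕ₗ J)) :=
  freeProductTables B₁ B₂ ∪
  {f | ∃ i₀ ∈ I₀, ∃ l : J, f = gen k (Sum.inlₗ i₀) ⊢ᵈ gen k (Sum.inrₗ l)} ∪
  {f | ∃ i₀ ∈ I₀, ∃ l : J, f = gen k (Sum.inrₗ l) ⊣ᵈ gen k (Sum.inlₗ i₀)} ∪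
  {f | ∃ l₀ ∈ J₀, ∃ i : I, f = gen k (Sum.inrₗ l₀) ⊢ᵈ gen k (Sum.inlₗ i)} ∪
  {f | ∃ l₀ ∈ J₀, ∃ i : I, f = gen k (Sum.inlₗ i) ⊣ᵈ gen k (Sum.inrₗ l₀)}

/-- The dialgebra `D(X ∪ Y | S₁ ∪ S₂)`. -/
abbrev DialgebraFreeProduct (B₁ : Module.Basis I k D₁) (B₂ : Module.Basis J k D₂) :=
  FreeDialgebra k (I ⊕ₗ J) ⧸ dialgebraIdeal k (freeProductTables B₁ B₂)

/-- The class of a normal diword in `D(X ∪ Y | S₁ ∪ S₂)`. -/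
def diwordClass (B₁ : Module.Basis I k D₁) (B₂ : Module.Basis J k D₂) (u : Diword (I ⊕ₗ J)) :
    DialgebraFreeProduct B₁ B₂ :=
  (dialgebraIdeal k (freeProductTables B₁ B₂)).mkQ (of k u)

/-- The letter `z` lies in `X`; otherwise it lies in `Y`. -/
def IsLetterX (z : I ⊕ₗ J) : Prop := ∃ i : I, z = Sum.inlₗ i

/-- The diwords `z₋ₘ ⋯ z₋₁ ż₀ z₁ ⋯ zₙ` in which all letters other than the center `z₀` lie in
`(X \ X₀) ∪ (Y \ Y₀)` and no two neighbours lie both in `X` or both in `Y`. -/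
def alternatingDiwords (I₀ : Set I) (J₀ : Set J) : Set (Diword (I ⊕ₗ J)) :=
  {u | (∀ z ∈ u.left ++ u.right,
          (∃ i : I, i ∉ I₀ ∧ z = Sum.inlₗ i) ∨ (∃ l : J, l ∉ J₀ ∧ z = Sum.inrₗ l)) ∧
       u.word.IsChain (fun z z' => ¬ (IsLetterX z ↔ IsLetterX z'))}

end FreeProduct

end

universe w

/-! Both factors are merged into the one dialgebra E = D₁ × D₂ with basis Z = X ∪ Y, where products
of letters from different sides vanish. The letters Z₀ = X₀ ∪ Y₀ span A₁ × A₂, an ideal that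
contains all a ⊣ b - a ⊢ b and, by the mixed identities, satisfies a ⊢ d = 0 = d ⊣ a
(`barIdeal_le_barAnnihilator`). All elements of S then have the same form: they are the defects {v}
⊢ {w} - {v ⊢ w} and {v} ⊣ {w} - {v ⊣ w} of those pairs of letters which lie on one side or whose
non-central letter is in Z₀ (`freeProductRelations_eq_splitRelations`). `IsSplitBasis` collects the
properties of E that the argument needs.

Leading terms have length two, so two different relations can only overlap in a word of three
letters. The defect is bilinear, and associativity in D(Z) and in E turns each such composition into
a difference of two defects, such as D(x, y ⊢ z) - D(x ⊢ y, z). Reducible pairs are stable under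
these products, so both defects are combinations of relations. The compositions of left and right
multiplication are handled by the agreement of ⊢ and ⊣ modulo Z₀.

The irreducible diwords span the quotient, because each relation replaces two letters by a
combination of single letters and so shortens the word. Their independence is proved by a direct
construction and does not pass through the Gröbner–Shirshov property. On the space of all triples
(l, c, r), where r is the right-hand word read backwards, each element of E acts from the left and
from the right: a letter is multiplied into the outermost letter if that lies on its own side, is
put in front of it otherwise, and letters of Z₀ outside of the center are dropped. The left and
right operators commute (`IsSideAction.commute`), so evaluating a diword at its center defines a
normal form map. The elements killed by both actions and by the normal form are an ideal containing
S (`splitRelations_subset_normalFormKer`), while an irreducible diword is sent to its own triple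
(`IsSplitBasis.normalForm_of_mem_splitDiwords`).

Finally, S generates no more than the tables do: the map from D₁ to the quotient carries A₁ into the
bar ideal of the quotient, which annihilates, and likewise for D₂. The coproduct property follows
from that of the free dialgebra. -/

/-! ### Bilinearity of the two multiplications -/

namespace Dialgebra

/-- The multiplication `⊢` as a bilinear map. -/
def vdashₗ (k D : Type*) [Field k] [AddCommGroup D] [Module k D] [Dialgebra k D] :
    D →ₗ[k] D →ₗ[k] D :=
  LinearMap.mk₂ k (fun a b => a ⊢ᵈ b) (add_vdash (k := k)) smul_vdash (vdash_add (k := k))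
    vdash_smul

/-- The multiplication `⊣` as a bilinear map. -/
def dashvₗ (k D : Type*) [Field k] [AddCommGroup D] [Module k D] [Dialgebra k D] :
    D →ₗ[k] D →ₗ[k] D :=
  LinearMap.mk₂ k (fun a b => a ⊣ᵈ b) (add_dashv (k := k)) smul_dashv (dashv_add (k := k))
    dashv_smul

section

variable (k : Type*) {D : Type*} [Field k] [AddCommGroup D] [Module k D] [Dialgebra k D]

@[simp] theorem vdashₗ_apply (a b : D) : vdashₗ k D a b = a ⊢ᵈ b := rfl

@[simp] theorem dashvₗ_apply (a b : D) : dashvₗ k D a b = a ⊣ᵈ b := rfl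

include k

theorem zero_vdash (a : D) : (0 : D) ⊢ᵈ a = 0 := by
  rw [← vdashₗ_apply k, map_zero, LinearMap.zero_apply]

theorem vdash_zero (a : D) : a ⊢ᵈ (0 : D) = 0 := by
  rw [← vdashₗ_apply k, map_zero]

theorem zero_dashv (a : D) : (0 : D) ⊣ᵈ a = 0 := by
  rw [← dashvₗ_apply k, map_zero, LinearMap.zero_apply]

theorem dashv_zero (a : D) : a ⊣ᵈ (0 : D) = 0 := by
  rw [← dashvₗ_apply k, map_zero]

theorem sub_vdash (a b c : D) : (a - b) ⊢ᵈ c = a ⊢ᵈ c - b ⊢ᵈ c := by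
  simp only [← vdashₗ_apply k, map_sub, LinearMap.sub_apply]

theorem vdash_sub (a b c : D) : a ⊢ᵈ (b - c) = a ⊢ᵈ b - a ⊢ᵈ c := by
  simp only [← vdashₗ_apply k, map_sub]

theorem sub_dashv (a b c : D) : (a - b) ⊣ᵈ c = a ⊣ᵈ c - b ⊣ᵈ c := by
  simp only [← dashvₗ_apply k, map_sub, LinearMap.sub_apply]

theorem dashv_sub (a b c : D) : a ⊣ᵈ (b - c) = a ⊣ᵈ b - a ⊣ᵈ c := by
  simp only [← dashvₗ_apply k, map_sub]

end

/-- The direct product of two dialgebras. -/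
instance prod {k D₁ D₂ : Type*} [Field k] [AddCommGroup D₁] [Module k D₁] [Dialgebra k D₁]
    [AddCommGroup D₂] [Module k D₂] [Dialgebra k D₂] : Dialgebra k (D₁ × D₂) where
  vdash a b := (a.1 ⊢ᵈ b.1, a.2 ⊢ᵈ b.2)
  dashv a b := (a.1 ⊣ᵈ b.1, a.2 ⊣ᵈ b.2)
  add_vdash _ _ _ := Prod.ext (add_vdash (k := k) _ _ _) (add_vdash (k := k) _ _ _)
  vdash_add _ _ _ := Prod.ext (vdash_add (k := k) _ _ _) (vdash_add (k := k) _ _ _)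
  smul_vdash _ _ _ := Prod.ext (smul_vdash _ _ _) (smul_vdash _ _ _)
  vdash_smul _ _ _ := Prod.ext (vdash_smul _ _ _) (vdash_smul _ _ _)
  add_dashv _ _ _ := Prod.ext (add_dashv (k := k) _ _ _) (add_dashv (k := k) _ _ _)
  dashv_add _ _ _ := Prod.ext (dashv_add (k := k) _ _ _) (dashv_add (k := k) _ _ _)
  smul_dashv _ _ _ := Prod.ext (smul_dashv _ _ _) (smul_dashv _ _ _)
  dashv_smul _ _ _ := Prod.ext (dashv_smul _ _ _) (dashv_smul _ _ _)
  vdash_assoc _ _ _ := Prod.ext (vdash_assoc (k := k) _ _ _) (vdash_assoc (k := k) _ _ _)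
  dashv_assoc _ _ _ := Prod.ext (dashv_assoc (k := k) _ _ _) (dashv_assoc (k := k) _ _ _)
  dashv_vdash _ _ _ := Prod.ext (dashv_vdash (k := k) _ _ _) (dashv_vdash (k := k) _ _ _)
  dashv_vdash' _ _ _ := Prod.ext (dashv_vdash' (k := k) _ _ _) (dashv_vdash' (k := k) _ _ _)
  vdash_dashv _ _ _ := Prod.ext (vdash_dashv (k := k) _ _ _) (vdash_dashv (k := k) _ _ _)

end Dialgebra

/-! ### The bar ideal annihilates -/

section BarIdeal

variable (k : Type*) {D E : Type*} [Field k] [AddCommGroup D] [Module k D] [Dialgebra k D]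
  [AddCommGroup E] [Module k E] [Dialgebra k E]

theorem subset_dialgebraIdeal (T : Set D) : T ⊆ (dialgebraIdeal k T : Set D) := by
  intro x hx
  rw [SetLike.mem_coe, dialgebraIdeal, Submodule.mem_sInf]
  exact fun A hA => hA.2 hx

theorem dialgebraIdeal_le {T : Set D} {A : Submodule k D} (hA : IsDialgebraIdeal k A)
    (hT : T ⊆ (A : Set D)) : dialgebraIdeal k T ≤ A :=
  sInf_le ⟨hA, hT⟩

theorem dashv_sub_vdash_mem_barIdeal (a b : D) : a ⊣ᵈ b - a ⊢ᵈ b ∈ barIdeal k D :=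
  subset_dialgebraIdeal k _ ⟨a, b, rfl⟩

/-- The elements `a` such that `a ⊢ d = 0` and `d ⊣ a = 0` for all `d`. -/
def barAnnihilator (D : Type*) [AddCommGroup D] [Module k D] [Dialgebra k D] :
    Submodule k D where
  carrier := {a | ∀ d : D, a ⊢ᵈ d = 0 ∧ d ⊣ᵈ a = 0}
  zero_mem' d := ⟨Dialgebra.zero_vdash k d, Dialgebra.dashv_zero k d⟩
  add_mem' ha hb d := by
    rw [Dialgebra.add_vdash (k := k), Dialgebra.dashv_add (k := k), (ha d).1, (hb d).1, (ha d).2,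
      (hb d).2, add_zero]
    exact ⟨rfl, rfl⟩
  smul_mem' r a ha d := by
    rw [Dialgebra.smul_vdash, Dialgebra.dashv_smul, (ha d).1, (ha d).2, smul_zero]
    exact ⟨rfl, rfl⟩

/-- The outer factor can be regrouped until x meets an arbitrary element: (a ⊢ x) ⊢ d = a ⊢ (x ⊢ d)
and d ⊣ (a ⊢ x) = (d ⊣ a) ⊣ x, and dually for x ⊣ a. The products x ⊢ a and a ⊣ x are zero to begin
with. -/
theorem isDialgebraIdeal_barAnnihilator : IsDialgebraIdeal k (barAnnihilator k D) where
  vdash_left a x hx d := by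
    rw [Dialgebra.vdash_assoc (k := k), Dialgebra.dashv_vdash (k := k), (hx d).1, (hx _).2]
    exact ⟨Dialgebra.vdash_zero k a, rfl⟩
  vdash_right a x hx d := by
    rw [(hx a).1]
    exact ⟨Dialgebra.zero_vdash k d, Dialgebra.dashv_zero k d⟩
  dashv_left a x hx d := by
    rw [(hx a).2]
    exact ⟨Dialgebra.zero_vdash k d, Dialgebra.dashv_zero k d⟩
  dashv_right a x hx d := by
    rw [Dialgebra.dashv_vdash' (k := k), ← Dialgebra.dashv_assoc (k := k), (hx _).1, (hx d).2]
    exact ⟨rfl, Dialgebra.zero_dashv k a⟩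

/-- It suffices to look at generators, and (a ⊣ b) ⊢ d = (a ⊢ b) ⊢ d and d ⊣ (a ⊢ b) = d ⊣ (a ⊣ b)
are consequences of the mixed identities. This is where the relations between X₀ and Y, and between
Y₀ and X, come from. -/
theorem barIdeal_le_barAnnihilator : barIdeal k D ≤ barAnnihilator k D := by
  refine dialgebraIdeal_le k (isDialgebraIdeal_barAnnihilator k) ?_
  rintro _ ⟨a, b, rfl⟩ d
  rw [Dialgebra.sub_vdash k, Dialgebra.dashv_sub k, Dialgebra.dashv_vdash' (k := k),
    Dialgebra.vdash_assoc (k := k), Dialgebra.dashv_vdash (k := k), Dialgebra.dashv_assoc (k := k),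
    sub_self, sub_self]
  exact ⟨rfl, rfl⟩

variable {k}

theorem DialgebraHom.isDialgebraIdeal_comap (φ : DialgebraHom k D E) {A : Submodule k E}
    (hA : IsDialgebraIdeal k A) : IsDialgebraIdeal k (A.comap φ.toLinearMap) where
  vdash_left a x hx := by
    rw [Submodule.mem_comap, φ.map_vdash]; exact hA.vdash_left _ _ hx
  vdash_right a x hx := by
    rw [Submodule.mem_comap, φ.map_vdash]; exact hA.vdash_right _ _ hx
  dashv_left a x hx := by
    rw [Submodule.mem_comap, φ.map_dashv]; exact hA.dashv_left _ _ hx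
  dashv_right a x hx := by
    rw [Submodule.mem_comap, φ.map_dashv]; exact hA.dashv_right _ _ hx

/-- Generators go to generators. Together with the annihilation by the bar ideal of the target, the
images of A₁ and A₂ in the free product annihilate all of it. -/
theorem DialgebraHom.barIdeal_le_comap (φ : DialgebraHom k D E) :
    barIdeal k D ≤ (barIdeal k E).comap φ.toLinearMap := by
  refine dialgebraIdeal_le k (φ.isDialgebraIdeal_comap (isDialgebraIdeal_dialgebraIdeal k _)) ?_
  rintro _ ⟨a, b, rfl⟩
  rw [SetLike.mem_coe, Submodule.mem_comap, map_sub, φ.map_dashv, φ.map_vdash]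
  exact dashv_sub_vdash_mem_barIdeal k _ _

/-- The kernel of a homomorphism of dialgebras is an ideal. -/
theorem DialgebraHom.isDialgebraIdeal_ker (φ : DialgebraHom k D E) :
    IsDialgebraIdeal k (LinearMap.ker φ.toLinearMap) where
  vdash_left a x hx := by
    rw [LinearMap.mem_ker] at hx ⊢; rw [φ.map_vdash, hx, Dialgebra.vdash_zero k]
  vdash_right a x hx := by
    rw [LinearMap.mem_ker] at hx ⊢; rw [φ.map_vdash, hx, Dialgebra.zero_vdash k]
  dashv_left a x hx := by
    rw [LinearMap.mem_ker] at hx ⊢; rw [φ.map_dashv, hx, Dialgebra.dashv_zero k]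
  dashv_right a x hx := by
    rw [LinearMap.mem_ker] at hx ⊢; rw [φ.map_dashv, hx, Dialgebra.zero_dashv k]

end BarIdeal

/-! ### Products of diwords in the free dialgebra -/

namespace FreeDialgebra

variable {k Z : Type*} [Field k]

theorem of_vdash_of (u v : Diword Z) : of k u ⊢ᵈ of k v = of k (u.vdash v) :=
  (bilin_single _ _ _ _ _).trans (by rw [mul_one, of])

theorem of_dashv_of (u v : Diword Z) : of k u ⊣ᵈ of k v = of k (u.dashv v) :=
  (bilin_single _ _ _ _ _).trans (by rw [mul_one, of])

theorem gen_vdash_of (z : Z) (u : Diword Z) : gen k z ⊢ᵈ of k u =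
    of k ⟨z :: u.left, u.center, u.right⟩ :=
  of_vdash_of _ _

theorem of_dashv_gen (u : Diword Z) (z : Z) : of k u ⊣ᵈ gen k z =
    of k ⟨u.left, u.center, u.right ++ [z]⟩ :=
  of_dashv_of _ _

theorem gen_vdash_gen (z z' : Z) : gen k z ⊢ᵈ gen k z' = of k ⟨[z], z', []⟩ := of_vdash_of _ _

theorem gen_dashv_gen (z z' : Z) : gen k z ⊣ᵈ gen k z' = of k ⟨[], z, [z']⟩ := of_dashv_of _ _

theorem vdashWord_of (a : List Z) (u : Diword Z) :
    vdashWord a (of k u) = of k ⟨a ++ u.left, u.center, u.right⟩ := by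
  induction a with
  | nil => rfl
  | cons z a ih => exact (congrArg (gen k z ⊢ᵈ ·) ih).trans (gen_vdash_of _ _)

theorem dashvWord_of (u : Diword Z) (a : List Z) :
    dashvWord (of k u) a = of k ⟨u.left, u.center, u.right ++ a⟩ := by
  induction a generalizing u with
  | nil => simp [dashvWord]
  | cons z a ih =>
    have h : dashvWord (of k u) (z :: a) = dashvWord (of k u ⊣ᵈ gen k z) a := rfl
    rw [h, of_dashv_gen, ih]
    simp

theorem span_range_of : Submodule.span k (Set.range (of k : Diword Z → _)) = ⊤ := by
  have h := (Finsupp.basisSingleOne (R := k) (ι := Diword Z)).span_eq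
  rwa [Finsupp.coe_basisSingleOne] at h

theorem dialgebraHom_ext {D : Type*} [AddCommGroup D] [Module k D] [Dialgebra k D]
    {f g : DialgebraHom k (FreeDialgebra k Z) D}
    (h : ∀ z, f.toLinearMap (gen k z) = g.toLinearMap (gen k z)) : f = g := by
  have key : ∀ u, f.toLinearMap (of k u) = g.toLinearMap (of k u) := by
    rintro ⟨l, c, r⟩
    induction l with
    | nil =>
      induction r using List.reverseRecOn with
      | nil => exact h c
      | append_singleton r z ih =>
        rw [← of_dashv_gen ⟨[], c, r⟩, f.map_dashv, g.map_dashv, ih, h]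
    | cons z l ih => rw [← gen_vdash_of z ⟨l, c, r⟩, f.map_vdash, g.map_vdash, ih, h]
  refine DialgebraHom.ext (LinearMap.ext_on_range span_range_of key)

/-! ### The universal property of the free dialgebra -/

section Lift

variable {D : Type*} [AddCommGroup D] [Module k D] [Dialgebra k D]

variable (k) in
/-- The value `g z₋ₘ ⊢ ⋯ ⊢ g z₀ ⊣ ⋯ ⊣ g zₙ` of a diword under a substitution `g`. -/
def evalDiword (g : Z → D) (u : Diword Z) : D :=
  u.left.foldr (fun z d => g z ⊢ᵈ d) (u.right.foldl (fun d z => d ⊣ᵈ g z) (g u.center))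

-- The five fold identities let a product pass through `evalDiword`. A factor on the bar side of a
-- product only contributes its underlying word, so there ⊢ and ⊣ may be exchanged; on the other
-- side the center is preserved.
include k in
theorem foldl_dashv_vdash (g : Z → D) (a : List Z) (d e : D) :
    a.foldl (fun d z => d ⊣ᵈ g z) d ⊢ᵈ e = d ⊢ᵈ a.foldr (fun z d => g z ⊢ᵈ d) e := by
  induction a generalizing d with
  | nil => rfl
  | cons z a ih => rw [List.foldl_cons, ih, List.foldr_cons, Dialgebra.dashv_vdash' (k := k)]

include k in
theorem foldr_vdash_vdash (g : Z → D) (a : List Z) (d e : D) :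
    a.foldr (fun z d => g z ⊢ᵈ d) d ⊢ᵈ e = a.foldr (fun z d => g z ⊢ᵈ d) (d ⊢ᵈ e) := by
  induction a with
  | nil => rfl
  | cons z a ih => rw [List.foldr_cons, Dialgebra.vdash_assoc (k := k), ih, List.foldr_cons]

include k in
theorem foldr_vdash_dashv (g : Z → D) (a : List Z) (d e : D) :
    a.foldr (fun z d => g z ⊢ᵈ d) d ⊣ᵈ e = a.foldr (fun z d => g z ⊢ᵈ d) (d ⊣ᵈ e) := by
  induction a with
  | nil => rfl
  | cons z a ih => rw [List.foldr_cons, ← Dialgebra.vdash_dashv (k := k), ih, List.foldr_cons]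

include k in
theorem dashv_foldr_vdash (g : Z → D) (a : List Z) (d e : D) :
    d ⊣ᵈ a.foldr (fun z d => g z ⊢ᵈ d) e = a.foldl (fun d z => d ⊣ᵈ g z) d ⊣ᵈ e := by
  induction a generalizing d with
  | nil => rfl
  | cons z a ih => rw [List.foldr_cons, Dialgebra.dashv_vdash (k := k), ih, List.foldl_cons]

include k in
theorem dashv_foldl_dashv (g : Z → D) (a : List Z) (d e : D) :
    d ⊣ᵈ a.foldl (fun d z => d ⊣ᵈ g z) e = a.foldl (fun d z => d ⊣ᵈ g z) (d ⊣ᵈ e) := by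
  induction a generalizing e with
  | nil => rfl
  | cons z a ih => rw [List.foldl_cons, ih, List.foldl_cons, Dialgebra.dashv_assoc (k := k)]

theorem evalDiword_vdash (g : Z → D) (u v : Diword Z) :
    evalDiword k g (u.vdash v) = evalDiword k g u ⊢ᵈ evalDiword k g v := by
  simp only [evalDiword, Diword.vdash, Diword.word, foldr_vdash_vdash (k := k),
    foldl_dashv_vdash (k := k), List.foldr_append, List.foldr_cons]

theorem evalDiword_dashv (g : Z → D) (u v : Diword Z) :
    evalDiword k g (u.dashv v) = evalDiword k g u ⊣ᵈ evalDiword k g v := by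
  simp only [evalDiword, Diword.dashv, Diword.word, foldr_vdash_dashv (k := k),
    dashv_foldr_vdash (k := k), dashv_foldl_dashv (k := k), List.foldl_append, List.foldl_cons]

/-- Three different maps are allowed because the normal form of a product combines an action of one
factor with the normal form of the other; `lift` and the two actions are the case of a single map.
-/
theorem bilin_hom {F G H : Type*} [AddCommMonoid F] [Module k F] [AddCommMonoid G] [Module k G]
    [AddCommMonoid H] [Module k H] (op : Diword Z → Diword Z → Diword Z) (m : F →ₗ[k] G →ₗ[k] H)
    (L : FreeDialgebra k Z →ₗ[k] H) (L₁ : FreeDialgebra k Z →ₗ[k] F)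
    (L₂ : FreeDialgebra k Z →ₗ[k] G)
    (h : ∀ u v, L (of k (op u v)) = m (L₁ (of k u)) (L₂ (of k v))) (a b : FreeDialgebra k Z) :
    L (bilin op a b) = m (L₁ a) (L₂ b) := by
  have : (bilin op).compr₂ L = m.compl₁₂ L₁ L₂ := by
    refine LinearMap.ext_on_range span_range_of fun u =>
      LinearMap.ext_on_range span_range_of fun v => ?_
    simp only [LinearMap.compr₂_apply, LinearMap.compl₁₂_apply, ← h]
    rw [of, of, bilin_single, mul_one, of]
  exact LinearMap.congr_fun₂ this a b

/-- The homomorphism from the free dialgebra that extends a substitution of the letters. -/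
noncomputable def lift (g : Z → D) : DialgebraHom k (FreeDialgebra k Z) D where
  toLinearMap := Finsupp.linearCombination k (evalDiword k g)
  map_vdash := bilin_hom Diword.vdash (Dialgebra.vdashₗ k D) _ _ _ fun u v => by
    simp [of, evalDiword_vdash]
  map_dashv := bilin_hom Diword.dashv (Dialgebra.dashvₗ k D) _ _ _ fun u v => by
    simp [of, evalDiword_dashv]

theorem lift_gen (g : Z → D) (z : Z) : (lift g).toLinearMap (gen k z) = g z := by
  simp [lift, gen, of, evalDiword, Diword.letter]

end Lift

end FreeDialgebra

/-! ### Contexts -/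

namespace FreeDialgebra

variable {k Z : Type*} [Field k]

theorem mem_supported_iff_span (s : Set (Diword Z)) :
    Finsupp.supported k k s = Submodule.span k (of k '' s) :=
  Finsupp.supported_eq_span_single k s

theorem of_mem_supported {s : Set (Diword Z)} {u : Diword Z} (hu : u ∈ s) :
    of k u ∈ Finsupp.supported k k s :=
  Finsupp.single_mem_supported k 1 hu

theorem vdash_mem_supported {s t r : Set (Diword Z)}
    (h : ∀ u ∈ s, ∀ v ∈ t, u.vdash v ∈ r) {f g : FreeDialgebra k Z}
    (hf : f ∈ Finsupp.supported k k s) (hg : g ∈ Finsupp.supported k k t) :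
    f ⊢ᵈ g ∈ Finsupp.supported k k r := by
  rw [mem_supported_iff_span] at hf hg
  refine LinearMap.BilinMap.apply_apply_mem_of_mem_span (Finsupp.supported k k r) _ _
    (Dialgebra.vdashₗ k (FreeDialgebra k Z)) ?_ _ _ hf hg
  rintro _ ⟨u, hu, rfl⟩ _ ⟨v, hv, rfl⟩
  rw [Dialgebra.vdashₗ_apply, of_vdash_of]
  exact of_mem_supported (h u hu v hv)

theorem dashv_mem_supported {s t r : Set (Diword Z)}
    (h : ∀ u ∈ s, ∀ v ∈ t, u.dashv v ∈ r) {f g : FreeDialgebra k Z}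
    (hf : f ∈ Finsupp.supported k k s) (hg : g ∈ Finsupp.supported k k t) :
    f ⊣ᵈ g ∈ Finsupp.supported k k r := by
  rw [mem_supported_iff_span] at hf hg
  refine LinearMap.BilinMap.apply_apply_mem_of_mem_span (Finsupp.supported k k r) _ _
    (Dialgebra.dashvₗ k (FreeDialgebra k Z)) ?_ _ _ hf hg
  rintro _ ⟨u, hu, rfl⟩ _ ⟨v, hv, rfl⟩
  rw [Dialgebra.dashvₗ_apply, of_dashv_of]
  exact of_mem_supported (h u hu v hv)

theorem LeftNormed.vdash {g : FreeDialgebra k Z} (hg : LeftNormed g) (f : FreeDialgebra k Z) :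
    LeftNormed (f ⊢ᵈ g) :=
  vdash_mem_supported (s := Set.univ) (t := {u | u.right = []}) (fun _ _ _ hv => hv)
    (by simp) hg

theorem RightNormed.dashv {f : FreeDialgebra k Z} (hf : RightNormed f) (g : FreeDialgebra k Z) :
    RightNormed (f ⊣ᵈ g) :=
  dashv_mem_supported (t := Set.univ) (s := {u | u.left = []}) (fun _ hu _ _ => hu)
    hf (by simp)

theorem leftNormed_gen (z : Z) : LeftNormed (gen k z) :=
  of_mem_supported (s := {u : Diword Z | u.right = []}) rfl

theorem rightNormed_gen (z : Z) : RightNormed (gen k z) :=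
  of_mem_supported (s := {u : Diword Z | u.left = []}) rfl

theorem IsLeading.unique [LinearOrder Z] {f : FreeDialgebra k Z} {u v : Diword Z}
    (hu : IsLeading f u) (hv : IsLeading f v) : u = v :=
  le_antisymm (hv.2 u hu.1) (hu.2 v hv.1)

end FreeDialgebra

namespace Diword

variable {Z : Type*}

theorem lt_of_length_lt [LinearOrder Z] {u v : Diword Z} (h : u.length < v.length) : u < v :=
  Prod.Lex.toLex_lt_toLex.2 (Or.inl h)

end Diword

namespace DiContext

open FreeDialgebra

variable {k Z : Type*} [Field k]

/-- Plugging into a context is linear. -/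
theorem exists_plug_linear (k : Type*) [Field k] (C : DiContext Z) :
    ∃ L : FreeDialgebra k Z →ₗ[k] FreeDialgebra k Z, ∀ s, L s = C.plug s := by
  have h₁ : ∀ a : List Z, ∃ L : FreeDialgebra k Z →ₗ[k] FreeDialgebra k Z,
      ∀ s, L s = vdashWord a s := by
    intro a
    induction a with
    | nil => exact ⟨LinearMap.id, fun _ => rfl⟩
    | cons z a ih =>
      obtain ⟨L, hL⟩ := ih
      exact ⟨Dialgebra.vdashₗ k _ (gen k z) ∘ₗ L, fun s => congrArg (gen k z ⊢ᵈ ·) (hL s)⟩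
  have h₂ : ∀ a : List Z, ∃ L : FreeDialgebra k Z →ₗ[k] FreeDialgebra k Z,
      ∀ s, L s = dashvWord s a := by
    intro a
    induction a with
    | nil => exact ⟨LinearMap.id, fun _ => rfl⟩
    | cons z a ih =>
      obtain ⟨L, hL⟩ := ih
      exact ⟨L ∘ₗ (Dialgebra.dashvₗ k _).flip (gen k z), fun s => hL (s ⊣ᵈ gen k z)⟩
  cases C with
  | center a b =>
    obtain ⟨L, hL⟩ := h₁ a
    obtain ⟨R, hR⟩ := h₂ b
    exact ⟨L ∘ₗ R, fun s => (hL _).trans (congrArg _ (hR s))⟩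
  | left a b₁ x₀ b₂ =>
    obtain ⟨L, hL⟩ := h₁ a
    exact ⟨L ∘ₗ (Dialgebra.vdashₗ k _).flip (vdashWord b₁ (dashvWord (gen k x₀) b₂)),
      fun s => hL _⟩
  | right a₁ x₀ a₂ b =>
    obtain ⟨R, hR⟩ := h₂ b
    exact ⟨R ∘ₗ Dialgebra.dashvₗ k _ (dashvWord (vdashWord a₁ (gen k x₀)) a₂),
      fun s => hR _⟩

theorem plug_of (C : DiContext Z) (u : Diword Z) : C.plug (of k u) = of k (C.plugWord u) := by
  cases C <;>
  simp [plug, plugWord, gen, dashvWord_of, vdashWord_of, of_vdash_of, of_dashv_of, Diword.vdash,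
    Diword.dashv, Diword.letter]

theorem plug_mem {A : Submodule k (FreeDialgebra k Z)} (hA : IsDialgebraIdeal k A)
    (C : DiContext Z) {s : FreeDialgebra k Z} (hs : s ∈ A) : C.plug s ∈ A := by
  have h₁ : ∀ (a : List Z) (s), s ∈ A → vdashWord a s ∈ A := by
    intro a s hs
    induction a with
    | nil => exact hs
    | cons z a ih => exact hA.vdash_left _ _ ih
  have h₂ : ∀ (a : List Z) (s), s ∈ A → dashvWord s a ∈ A := by
    intro a
    induction a with
    | nil => exact fun s hs => hs
    | cons z a ih => exact fun s hs => ih _ (hA.dashv_right _ _ hs)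
  cases C with
  | center a b => exact h₁ _ _ (h₂ _ _ hs)
  | left a b₁ x₀ b₂ => exact h₁ _ _ (hA.vdash_right _ _ hs)
  | right a₁ x₀ a₂ b => exact h₂ _ _ (hA.dashv_left _ _ hs)

theorem length_plugWord (C : DiContext Z) (u : Diword Z) :
    (C.plugWord u).length = C.pre.length + u.length + C.post.length := by
  cases C <;> simp [plugWord, pre, post, Diword.length, Diword.word] <;> omega

theorem eq_center_of_length_le (C : DiContext Z) (u : Diword Z)
    (h : (C.plugWord u).length ≤ u.length) : C = center [] [] := by
  rw [length_plugWord] at h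
  have h₁ : C.pre = [] := List.eq_nil_of_length_eq_zero (by omega)
  have h₂ : C.post = [] := List.eq_nil_of_length_eq_zero (by omega)
  cases C <;> simp_all [pre, post]

end DiContext

/-! ### Bases that split into two sides -/

open FreeDialgebra DiContext

section SplitBasis

variable {k Z E : Type*} [Field k] [AddCommGroup E] [Module k E] [Dialgebra k E]

/-- A basis of a dialgebra that is split by the predicate `σ` into the bases of two ideals which
annihilate each other, together with a subset `Z₀` of it which spans an ideal that contains all
`a ⊣ b - a ⊢ b` and annihilates. -/
structure IsSplitBasis (b : Module.Basis Z k E) (σ : Z → Prop) (Z₀ : Set Z) : Prop where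
  vdash_eq_zero : ∀ z z', ¬ (σ z ↔ σ z') → b z ⊢ᵈ b z' = 0
  dashv_eq_zero : ∀ z z', ¬ (σ z ↔ σ z') → b z ⊣ᵈ b z' = 0
  vdash_mem : ∀ z z', b z ⊢ᵈ b z' ∈ Submodule.span k (b '' {w | σ w ↔ σ z})
  dashv_mem : ∀ z z', b z ⊣ᵈ b z' ∈ Submodule.span k (b '' {w | σ w ↔ σ z})
  isIdeal : IsDialgebraIdeal k (Submodule.span k (b '' Z₀))
  le_annihilator : Submodule.span k (b '' Z₀) ≤ barAnnihilator k E
  bar_mem : ∀ z z', b z ⊣ᵈ b z' - b z ⊢ᵈ b z' ∈ Submodule.span k (b '' Z₀)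

/-- The product `z ⊢ z'` is reducible. -/
def VdashReducible (σ : Z → Prop) (Z₀ : Set Z) (z z' : Z) : Prop := (σ z ↔ σ z') ∨ z ∈ Z₀

/-- The product `z ⊣ z'` is reducible. -/
def DashvReducible (σ : Z → Prop) (Z₀ : Set Z) (z z' : Z) : Prop := (σ z ↔ σ z') ∨ z' ∈ Z₀

/-- `{v} ⊢ {w} - {v ⊢ w}`. -/
noncomputable def vdashDefect (b : Module.Basis Z k E) : E →ₗ[k] E →ₗ[k] FreeDialgebra k Z :=
  let m : E →ₗ[k] E →ₗ[k] FreeDialgebra k Z :=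
    (Dialgebra.vdashₗ k _).compl₁₂ (expand b id) (expand b id)
  let m' : E →ₗ[k] E →ₗ[k] FreeDialgebra k Z := (Dialgebra.vdashₗ k E).compr₂ (expand b id)
  LinearMap.mk₂ k (fun v w => m v w - m' v w)
    (fun _ _ _ => by simp only [map_add, LinearMap.add_apply]; abel)
    (fun _ _ _ => by simp only [map_smul, LinearMap.smul_apply, smul_sub])
    (fun _ _ _ => by simp only [map_add]; abel)
    (fun _ _ _ => by simp only [map_smul, smul_sub])

/-- `{v} ⊣ {w} - {v ⊣ w}`. -/
noncomputable def dashvDefect (b : Module.Basis Z k E) : E →ₗ[k] E →ₗ[k] FreeDialgebra k Z :=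
  let m : E →ₗ[k] E →ₗ[k] FreeDialgebra k Z :=
    (Dialgebra.dashvₗ k _).compl₁₂ (expand b id) (expand b id)
  let m' : E →ₗ[k] E →ₗ[k] FreeDialgebra k Z := (Dialgebra.dashvₗ k E).compr₂ (expand b id)
  LinearMap.mk₂ k (fun v w => m v w - m' v w)
    (fun _ _ _ => by simp only [map_add, LinearMap.add_apply]; abel)
    (fun _ _ _ => by simp only [map_smul, LinearMap.smul_apply, smul_sub])
    (fun _ _ _ => by simp only [map_add]; abel)
    (fun _ _ _ => by simp only [map_smul, smul_sub])

/-- The rewriting rules for the reducible products of two letters. -/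
def splitRelations (b : Module.Basis Z k E) (σ : Z → Prop) (Z₀ : Set Z) :
    Set (FreeDialgebra k Z) :=
  {f | ∃ z z', VdashReducible σ Z₀ z z' ∧ f = vdashDefect b (b z) (b z')} ∪
  {f | ∃ z z', DashvReducible σ Z₀ z z' ∧ f = dashvDefect b (b z) (b z')}

variable (b : Module.Basis Z k E)

omit [Dialgebra k E] in
theorem expand_basis (z : Z) : expand b id (b z) = gen k z := by
  simp [expand]

theorem vdashDefect_apply (v w : E) :
    vdashDefect b v w = expand b id v ⊢ᵈ expand b id w - expand b id (v ⊢ᵈ w) := rfl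

theorem dashvDefect_apply (v w : E) :
    dashvDefect b v w = expand b id v ⊣ᵈ expand b id w - expand b id (v ⊣ᵈ w) := rfl

theorem vdashDefect_basis (z z' : Z) : vdashDefect b (b z) (b z') =
    of k ⟨[z], z', []⟩ - expand b id (b z ⊢ᵈ b z') := by
  rw [vdashDefect_apply, expand_basis, expand_basis, gen_vdash_gen]

theorem dashvDefect_basis (z z' : Z) : dashvDefect b (b z) (b z') =
    of k ⟨[], z, [z']⟩ - expand b id (b z ⊣ᵈ b z') := by
  rw [dashvDefect_apply, expand_basis, expand_basis, gen_dashv_gen]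

omit [Dialgebra k E] in
theorem expand_mem_supported (v : E) :
    expand b id v ∈ Finsupp.supported k k (Set.range (Diword.letter : Z → _)) := by
  have h : ⊤ ≤ (Finsupp.supported k k (Set.range (Diword.letter : Z → _))).comap
      (expand b id) := by
    rw [← b.span_eq, Submodule.span_le]
    rintro _ ⟨z, rfl⟩
    rw [SetLike.mem_coe, Submodule.mem_comap, expand_basis]
    exact of_mem_supported ⟨z, rfl⟩
  exact h (Submodule.mem_top (x := v))

omit [Dialgebra k E] in
theorem of_sub_expand_apply {p : Diword Z} (hp : 1 < p.length) (v : E) :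
    (of k p - expand b id v) p = 1 := by
  have h : expand b id v p = 0 := by
    by_contra h
    obtain ⟨z, rfl⟩ := expand_mem_supported b v (Finsupp.mem_support_iff.2 h)
    simp [Diword.letter, Diword.length, Diword.word] at hp
  rw [Finsupp.sub_apply, h, of, Finsupp.single_eq_same, sub_zero]

omit [Dialgebra k E] in
theorem of_sub_expand_mem_supported (p : Diword Z) (v : E) :
    of k p - expand b id v ∈
      Finsupp.supported k k ({p} ∪ Set.range (Diword.letter : Z → _)) :=
  sub_mem (of_mem_supported (Or.inl rfl))
    (Finsupp.supported_mono Set.subset_union_right (expand_mem_supported b v))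

theorem leftNormed_vdashDefect (z z' : Z) : LeftNormed (vdashDefect b (b z) (b z')) := by
  intro u hu
  rw [vdashDefect_basis] at hu
  obtain rfl | ⟨c, rfl⟩ := of_sub_expand_mem_supported b _ _ hu <;> rfl

theorem rightNormed_dashvDefect (z z' : Z) : RightNormed (dashvDefect b (b z) (b z')) := by
  intro u hu
  rw [dashvDefect_basis] at hu
  obtain rfl | ⟨c, rfl⟩ := of_sub_expand_mem_supported b _ _ hu <;> rfl

theorem not_rightNormed_vdashDefect (z z' : Z) :
    ¬ RightNormed (vdashDefect b (b z) (b z')) := by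
  intro h
  have := h ⟨[z], z', []⟩ (by
    rw [Finsupp.mem_support_iff, vdashDefect_basis, of_sub_expand_apply b one_lt_two]
    exact one_ne_zero)
  simp at this

theorem not_leftNormed_dashvDefect (z z' : Z) :
    ¬ LeftNormed (dashvDefect b (b z) (b z')) := by
  intro h
  have := h ⟨[], z, [z']⟩ (by
    rw [Finsupp.mem_support_iff, dashvDefect_basis, of_sub_expand_apply b one_lt_two]
    exact one_ne_zero)
  simp at this

section Order

variable [LinearOrder Z]

omit [Dialgebra k E] in
theorem isLeading_of_sub_expand {p : Diword Z} (hp : 1 < p.length) (v : E) :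
    IsLeading (of k p - expand b id v) p := by
  refine ⟨?_, fun u hu => ?_⟩
  · rw [Finsupp.mem_support_iff, of_sub_expand_apply b hp]
    exact one_ne_zero
  · obtain rfl | ⟨c, rfl⟩ := of_sub_expand_mem_supported b _ _ hu
    · exact le_rfl
    · exact (Diword.lt_of_length_lt (u := Diword.letter c) hp).le

theorem isLeading_vdashDefect (z z' : Z) :
    IsLeading (vdashDefect b (b z) (b z')) ⟨[z], z', []⟩ := by
  rw [vdashDefect_basis]
  exact isLeading_of_sub_expand b one_lt_two _

theorem isLeading_dashvDefect (z z' : Z) :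
    IsLeading (dashvDefect b (b z) (b z')) ⟨[], z, [z']⟩ := by
  rw [dashvDefect_basis]
  exact isLeading_of_sub_expand b one_lt_two _

end Order

end SplitBasis

section SplitBasisGroebnerShirshov

variable {k Z E : Type*} [Field k] [AddCommGroup E] [Module k E] [Dialgebra k E]
  {b : Module.Basis Z k E} {σ : Z → Prop} {Z₀ : Set Z}

/-! ### Closure properties of reducible products -/

theorem vdashDefect_mem_of_mem_span {G : Submodule k (FreeDialgebra k Z)} {s t : Set Z}
    (h : ∀ z ∈ s, ∀ z' ∈ t, vdashDefect b (b z) (b z') ∈ G) {v w : E}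
    (hv : v ∈ Submodule.span k (b '' s)) (hw : w ∈ Submodule.span k (b '' t)) :
    vdashDefect b v w ∈ G := by
  refine LinearMap.BilinMap.apply_apply_mem_of_mem_span G _ _ (vdashDefect b) ?_ _ _ hv hw
  rintro _ ⟨z, hz, rfl⟩ _ ⟨z', hz', rfl⟩
  exact h z hz z' hz'

theorem dashvDefect_mem_of_mem_span {G : Submodule k (FreeDialgebra k Z)} {s t : Set Z}
    (h : ∀ z ∈ s, ∀ z' ∈ t, dashvDefect b (b z) (b z') ∈ G) {v w : E}
    (hv : v ∈ Submodule.span k (b '' s)) (hw : w ∈ Submodule.span k (b '' t)) :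
    dashvDefect b v w ∈ G := by
  refine LinearMap.BilinMap.apply_apply_mem_of_mem_span G _ _ (dashvDefect b) ?_ _ _ hv hw
  rintro _ ⟨z, hz, rfl⟩ _ ⟨z', hz', rfl⟩
  exact h z hz z' hz'

omit [Dialgebra k E] in
theorem basis_mem_span_singleton (z : Z) : b z ∈ Submodule.span k (b '' {z}) :=
  Submodule.subset_span ⟨z, rfl, rfl⟩

namespace IsSplitBasis

variable (H : IsSplitBasis b σ Z₀)

include H

theorem vdash_eq_zero_of_mem {v : E} (hv : v ∈ Submodule.span k (b '' Z₀)) (w : E) :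
    v ⊢ᵈ w = 0 := (H.le_annihilator hv w).1

theorem dashv_eq_zero_of_mem {v : E} (hv : v ∈ Submodule.span k (b '' Z₀)) (w : E) :
    w ⊣ᵈ v = 0 := (H.le_annihilator hv w).2

theorem vdash_mem' (z z' : Z) : b z ⊢ᵈ b z' ∈ Submodule.span k (b '' {w | σ w ↔ σ z'}) := by
  by_cases h : σ z ↔ σ z'
  · simpa only [h] using H.vdash_mem z z'
  · rw [H.vdash_eq_zero z z' h]; exact zero_mem _

theorem dashv_mem' (z z' : Z) : b z ⊣ᵈ b z' ∈ Submodule.span k (b '' {w | σ w ↔ σ z'}) := by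
  by_cases h : σ z ↔ σ z'
  · simpa only [h] using H.dashv_mem z z'
  · rw [H.dashv_eq_zero z z' h]; exact zero_mem _

omit H in
omit [Dialgebra k E] in
theorem span_mono_of {s t : Set Z} (h : ∀ z ∈ s, z ∈ t) {v : E}
    (hv : v ∈ Submodule.span k (b '' s)) : v ∈ Submodule.span k (b '' t) :=
  Submodule.span_mono (Set.image_mono h) hv

/-- In this and the next five lemmas one letter of a reducible pair is multiplied by a further
letter. If the pair lies on one side, the product stays on that side or is zero. If the pair is
reducible because of a letter in Z₀, then either that letter is untouched, or it is a factor of the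
product and the ideal property keeps the product in the span of Z₀. -/
theorem vdash_mem_span_vdashReducible {x y z : Z} (h : VdashReducible σ Z₀ y z) :
    b x ⊢ᵈ b y ∈ Submodule.span k (b '' {w | VdashReducible σ Z₀ w z}) := by
  rcases h with h | h
  · exact span_mono_of (fun w (hw : σ w ↔ σ y) => Or.inl (hw.trans h)) (H.vdash_mem' x y)
  · exact span_mono_of (fun w hw => Or.inr hw)
      (H.isIdeal.vdash_left _ _ (Submodule.subset_span ⟨y, h, rfl⟩))

theorem vdash_mem_span_vdashReducible' {x y z : Z} (h : VdashReducible σ Z₀ x y) :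
    b y ⊢ᵈ b z ∈ Submodule.span k (b '' {w | VdashReducible σ Z₀ x w}) := by
  rcases h with h | h
  · exact span_mono_of (fun w (hw : σ w ↔ σ y) => Or.inl (h.trans hw.symm)) (H.vdash_mem y z)
  · exact span_mono_of (fun w hw => Or.inr h) (H.vdash_mem y z)

theorem dashv_mem_span_dashvReducible {x y z : Z} (h : DashvReducible σ Z₀ y z) :
    b x ⊣ᵈ b y ∈ Submodule.span k (b '' {w | DashvReducible σ Z₀ w z}) := by
  rcases h with h | h
  · exact span_mono_of (fun w (hw : σ w ↔ σ y) => Or.inl (hw.trans h)) (H.dashv_mem' x y)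
  · exact span_mono_of (fun w hw => Or.inr h) (H.dashv_mem' x y)

theorem dashv_mem_span_dashvReducible' {x y z : Z} (h : DashvReducible σ Z₀ x y) :
    b y ⊣ᵈ b z ∈ Submodule.span k (b '' {w | DashvReducible σ Z₀ x w}) := by
  rcases h with h | h
  · exact span_mono_of (fun w (hw : σ w ↔ σ y) => Or.inl (h.trans hw.symm)) (H.dashv_mem y z)
  · exact span_mono_of (fun w hw => Or.inr hw)
      (H.isIdeal.dashv_right _ _ (Submodule.subset_span ⟨y, h, rfl⟩))

theorem vdash_mem_span_dashvReducible {x y z : Z} (h : DashvReducible σ Z₀ y z) :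
    b x ⊢ᵈ b y ∈ Submodule.span k (b '' {w | DashvReducible σ Z₀ w z}) := by
  rcases h with h | h
  · exact span_mono_of (fun w (hw : σ w ↔ σ y) => Or.inl (hw.trans h)) (H.vdash_mem' x y)
  · exact span_mono_of (fun w hw => Or.inr h) (H.vdash_mem' x y)

theorem dashv_mem_span_vdashReducible {x y z : Z} (h : VdashReducible σ Z₀ x y) :
    b y ⊣ᵈ b z ∈ Submodule.span k (b '' {w | VdashReducible σ Z₀ x w}) := by
  rcases h with h | h
  · exact span_mono_of (fun w (hw : σ w ↔ σ y) => Or.inl (h.trans hw.symm)) (H.dashv_mem y z)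
  · exact span_mono_of (fun w hw => Or.inr h) (H.dashv_mem y z)

/-! ### The composition identities -/

/-- Associativity in D(Z) cancels the words of length three, and associativity in E allows {x ⊢ y ⊢
z} to be inserted twice with opposite signs. What remains is D(x, y ⊢ z) - D(x ⊢ y, z), and each
term is a combination of defects of reducible pairs. The submodule G is arbitrary so that the same
identity serves under any length and normedness conditions. -/
theorem vdash_vdash_composition_mem {G : Submodule k (FreeDialgebra k Z)} {x y z : Z}
    (hG : ∀ z z', VdashReducible σ Z₀ z z' → vdashDefect b (b z) (b z') ∈ G)
    (hxy : VdashReducible σ Z₀ x y) (hyz : VdashReducible σ Z₀ y z) :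
    vdashDefect b (b x) (b y) ⊢ᵈ gen k z - gen k x ⊢ᵈ vdashDefect b (b y) (b z) ∈ G := by
  have e : vdashDefect b (b x) (b y) ⊢ᵈ gen k z - gen k x ⊢ᵈ vdashDefect b (b y) (b z) =
      vdashDefect b (b x) (b y ⊢ᵈ b z) - vdashDefect b (b x ⊢ᵈ b y) (b z) := by
    simp only [vdashDefect_apply, expand_basis, Dialgebra.sub_vdash k, Dialgebra.vdash_sub k,
      Dialgebra.vdash_assoc (k := k)]
    abel
  rw [e]
  refine sub_mem (vdashDefect_mem_of_mem_span ?_ (basis_mem_span_singleton x)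
    (H.vdash_mem_span_vdashReducible' hxy)) (vdashDefect_mem_of_mem_span ?_
    (H.vdash_mem_span_vdashReducible hyz) (basis_mem_span_singleton z))
  · rintro _ rfl w hw
    exact hG _ _ hw
  · rintro w hw _ rfl
    exact hG _ _ hw

theorem dashv_dashv_composition_mem {G : Submodule k (FreeDialgebra k Z)} {x y z : Z}
    (hG : ∀ z z', DashvReducible σ Z₀ z z' → dashvDefect b (b z) (b z') ∈ G)
    (hxy : DashvReducible σ Z₀ x y) (hyz : DashvReducible σ Z₀ y z) :
    dashvDefect b (b x) (b y) ⊣ᵈ gen k z - gen k x ⊣ᵈ dashvDefect b (b y) (b z) ∈ G := by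
  have e : dashvDefect b (b x) (b y) ⊣ᵈ gen k z - gen k x ⊣ᵈ dashvDefect b (b y) (b z) =
      dashvDefect b (b x) (b y ⊣ᵈ b z) - dashvDefect b (b x ⊣ᵈ b y) (b z) := by
    simp only [dashvDefect_apply, expand_basis, Dialgebra.sub_dashv k, Dialgebra.dashv_sub k,
      Dialgebra.dashv_assoc (k := k)]
    abel
  rw [e]
  refine sub_mem (dashvDefect_mem_of_mem_span ?_ (basis_mem_span_singleton x)
    (H.dashv_mem_span_dashvReducible' hxy)) (dashvDefect_mem_of_mem_span ?_
    (H.dashv_mem_span_dashvReducible hyz) (basis_mem_span_singleton z))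
  · rintro _ rfl w hw
    exact hG _ _ hw
  · rintro w hw _ rfl
    exact hG _ _ hw

theorem vdash_dashv_composition_mem {G : Submodule k (FreeDialgebra k Z)} {x y z : Z}
    (hG : ∀ z z', VdashReducible σ Z₀ z z' → vdashDefect b (b z) (b z') ∈ G)
    (hG' : ∀ z z', DashvReducible σ Z₀ z z' → dashvDefect b (b z) (b z') ∈ G)
    (hxy : VdashReducible σ Z₀ x y) (hyz : DashvReducible σ Z₀ y z) :
    vdashDefect b (b x) (b y) ⊣ᵈ gen k z - gen k x ⊢ᵈ dashvDefect b (b y) (b z) ∈ G := by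
  have e : vdashDefect b (b x) (b y) ⊣ᵈ gen k z - gen k x ⊢ᵈ dashvDefect b (b y) (b z) =
      vdashDefect b (b x) (b y ⊣ᵈ b z) - dashvDefect b (b x ⊢ᵈ b y) (b z) := by
    simp only [vdashDefect_apply, dashvDefect_apply, expand_basis, Dialgebra.sub_dashv k,
      Dialgebra.vdash_sub k, Dialgebra.vdash_dashv (k := k)]
    abel
  rw [e]
  refine sub_mem (vdashDefect_mem_of_mem_span ?_ (basis_mem_span_singleton x)
    (H.dashv_mem_span_vdashReducible hxy)) (dashvDefect_mem_of_mem_span ?_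
    (H.vdash_mem_span_dashvReducible hyz) (basis_mem_span_singleton z))
  · rintro _ rfl w hw
    exact hG _ _ hw
  · rintro w hw _ rfl
    exact hG' _ _ hw

/-- To the right of ⊣ the two multiplications of D(Z) coincide, so for letters on one side the
⊢-defect can be traded for the ⊣-defect; the error is a defect whose second argument is x ⊣ y - x ⊢
y, hence lies in the span of Z₀. The three hypotheses on G are the three kinds of right normed terms
that occur. -/
theorem gen_dashv_vdashDefect_mem {G : Submodule k (FreeDialgebra k Z)} {x y z : Z}
    (hG : ∀ z z', DashvReducible σ Z₀ z z' → dashvDefect b (b z) (b z') ∈ G)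
    (hG₁ : DashvReducible σ Z₀ x y → gen k z ⊣ᵈ dashvDefect b (b x) (b y) ∈ G)
    (hG₂ : DashvReducible σ Z₀ z x → dashvDefect b (b z) (b x) ⊣ᵈ gen k y ∈ G)
    (hxy : VdashReducible σ Z₀ x y) :
    gen k z ⊣ᵈ vdashDefect b (b x) (b y) ∈ G := by
  rcases hxy with hxy | hx
  · have e : gen k z ⊣ᵈ vdashDefect b (b x) (b y) = gen k z ⊣ᵈ dashvDefect b (b x) (b y) +
        dashvDefect b (b z) (b x ⊣ᵈ b y - b x ⊢ᵈ b y) := by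
      rw [dashvDefect_apply b (b z), H.dashv_eq_zero_of_mem (H.bar_mem x y), map_zero, sub_zero]
      simp only [vdashDefect_apply, dashvDefect_apply, expand_basis, Dialgebra.dashv_sub k, map_sub,
        Dialgebra.dashv_vdash (k := k), Dialgebra.dashv_assoc (k := k)]
      abel
    rw [e]
    refine add_mem (hG₁ (Or.inl hxy)) (dashvDefect_mem_of_mem_span ?_
      (basis_mem_span_singleton z) (H.bar_mem x y))
    rintro _ rfl w hw
    exact hG _ _ (Or.inr hw)
  · have hx' : b x ∈ Submodule.span k (b '' Z₀) := Submodule.subset_span ⟨x, hx, rfl⟩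
    -- For x in Z₀ both x ⊢ y and z ⊣ x vanish in E, so neither defect has a correction term and
    -- both sides are the single diword z x y with center z.
    have e : gen k z ⊣ᵈ vdashDefect b (b x) (b y) = dashvDefect b (b z) (b x) ⊣ᵈ gen k y := by
      rw [dashvDefect_apply, vdashDefect_apply, H.dashv_eq_zero_of_mem hx',
        H.vdash_eq_zero_of_mem hx']
      simp only [map_zero, sub_zero, expand_basis, Dialgebra.dashv_vdash (k := k)]
    rw [e]
    exact hG₂ (Or.inr hx)

theorem dashvDefect_vdash_gen_mem {G : Submodule k (FreeDialgebra k Z)} {x y z : Z}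
    (hG : ∀ z z', VdashReducible σ Z₀ z z' → vdashDefect b (b z) (b z') ∈ G)
    (hG₁ : VdashReducible σ Z₀ x y → vdashDefect b (b x) (b y) ⊢ᵈ gen k z ∈ G)
    (hG₂ : VdashReducible σ Z₀ y z → gen k x ⊢ᵈ vdashDefect b (b y) (b z) ∈ G)
    (hxy : DashvReducible σ Z₀ x y) :
    dashvDefect b (b x) (b y) ⊢ᵈ gen k z ∈ G := by
  rcases hxy with hxy | hy
  · have e : dashvDefect b (b x) (b y) ⊢ᵈ gen k z = vdashDefect b (b x) (b y) ⊢ᵈ gen k z -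
        vdashDefect b (b x ⊣ᵈ b y - b x ⊢ᵈ b y) (b z) := by
      rw [vdashDefect_apply b (_ - _), H.vdash_eq_zero_of_mem (H.bar_mem x y), map_zero, sub_zero]
      simp only [vdashDefect_apply, dashvDefect_apply, expand_basis, Dialgebra.sub_vdash k, map_sub,
        Dialgebra.dashv_vdash' (k := k), Dialgebra.vdash_assoc (k := k)]
      abel
    rw [e]
    refine sub_mem (hG₁ (Or.inl hxy)) (vdashDefect_mem_of_mem_span ?_
      (H.bar_mem x y) (basis_mem_span_singleton z))
    rintro w hw _ rfl
    exact hG _ _ (Or.inr hw)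
  · have hy' : b y ∈ Submodule.span k (b '' Z₀) := Submodule.subset_span ⟨y, hy, rfl⟩
    have e : dashvDefect b (b x) (b y) ⊢ᵈ gen k z = gen k x ⊢ᵈ vdashDefect b (b y) (b z) := by
      rw [dashvDefect_apply, vdashDefect_apply, H.dashv_eq_zero_of_mem hy',
        H.vdash_eq_zero_of_mem hy']
      simp only [map_zero, sub_zero, expand_basis, Dialgebra.dashv_vdash' (k := k)]
    rw [e]
    exact hG₂ (Or.inr hy)

end IsSplitBasis

/-! ### The Gröbner–Shirshov property -/

theorem vdashDefect_mem_splitRelations {z z' : Z} (h : VdashReducible σ Z₀ z z') :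
    vdashDefect b (b z) (b z') ∈ splitRelations b σ Z₀ := Or.inl ⟨z, z', h, rfl⟩

theorem dashvDefect_mem_splitRelations {z z' : Z} (h : DashvReducible σ Z₀ z z') :
    dashvDefect b (b z) (b z') ∈ splitRelations b σ Z₀ := Or.inr ⟨z, z', h, rfl⟩

/-- The diword z x y with center z cannot cancel, since the correction term only contributes diwords
of length two. Hence the degree bound leaves room for every term of length two or three. -/
theorem le_deg_gen_dashv (z x y : Z) : 3 ≤ deg (gen k z ⊣ᵈ vdashDefect b (b x) (b y)) := by
  refine Finset.le_sup (f := Diword.length) (b := ⟨[], z, [x, y]⟩) ?_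
  have h : (gen k z ⊣ᵈ expand b id (b x ⊢ᵈ b y)) ⟨[], z, [x, y]⟩ = 0 := by
    by_contra h
    have := dashv_mem_supported (r := {u | u.length = 2}) (s := {Diword.letter z})
      (by rintro _ rfl _ ⟨c, rfl⟩; rfl) (of_mem_supported (k := k) rfl)
      (expand_mem_supported b (b x ⊢ᵈ b y)) (Finsupp.mem_support_iff.2 h)
    simp [Diword.length, Diword.word] at this
  rw [Finsupp.mem_support_iff, vdashDefect_basis, Dialgebra.dashv_sub k, Finsupp.sub_apply, h,
    gen, of_dashv_of]
  simp [of, Diword.dashv, Diword.letter, Diword.word]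

theorem le_deg_vdash_gen (z x y : Z) : 3 ≤ deg (dashvDefect b (b x) (b y) ⊢ᵈ gen k z) := by
  refine Finset.le_sup (f := Diword.length) (b := ⟨[x, y], z, []⟩) ?_
  have h : (expand b id (b x ⊣ᵈ b y) ⊢ᵈ gen k z) ⟨[x, y], z, []⟩ = 0 := by
    by_contra h
    have := vdash_mem_supported (r := {u | u.length = 2}) (t := {Diword.letter z})
      (by rintro _ ⟨c, rfl⟩ _ rfl; rfl) (expand_mem_supported b (b x ⊣ᵈ b y))
      (of_mem_supported (k := k) rfl) (Finsupp.mem_support_iff.2 h)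
    simp [Diword.length, Diword.word] at this
  rw [Finsupp.mem_support_iff, dashvDefect_basis, Dialgebra.sub_vdash k, Finsupp.sub_apply, h,
    gen, of_vdash_of]
  simp [of, Diword.vdash, Diword.letter, Diword.word]

variable [LinearOrder Z]

/-- Leading terms determine the elements of the rewriting system. -/
theorem eq_of_isLeading_of_mem_splitRelations {f g : FreeDialgebra k Z}
    (hf : f ∈ splitRelations b σ Z₀) (hg : g ∈ splitRelations b σ Z₀) {u : Diword Z}
    (hu : IsLeading f u) (hv : IsLeading g u) : f = g := by
  rcases hf with ⟨x, y, -, rfl⟩ | ⟨x, y, -, rfl⟩ <;>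
  rcases hg with ⟨x', y', -, rfl⟩ | ⟨x', y', -, rfl⟩
  · have := ((isLeading_vdashDefect b x y).unique hu).trans
      ((isLeading_vdashDefect b x' y').unique hv).symm
    simp only [Diword.mk.injEq, List.cons.injEq, and_true] at this
    rw [this.1, this.2]
  · have := ((isLeading_vdashDefect b x y).unique hu).trans
      ((isLeading_dashvDefect b x' y').unique hv).symm
    simp at this
  · have := ((isLeading_dashvDefect b x y).unique hu).trans
      ((isLeading_vdashDefect b x' y').unique hv).symm
    simp at this
  · have := ((isLeading_dashvDefect b x y).unique hu).trans
      ((isLeading_dashvDefect b x' y').unique hv).symm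
    simp only [Diword.mk.injEq, List.cons.injEq, and_true, true_and] at this
    rw [this.1, this.2]

theorem trivialComposition_self (S : Set (FreeDialgebra k Z)) (f : FreeDialgebra k Z)
    (C : DiContext Z) (w : Diword Z) : TrivialComposition S f C f C w := by
  rw [TrivialComposition, sub_self]
  exact zero_mem _

theorem length_of_isLeading_of_mem_splitRelations {f : FreeDialgebra k Z}
    (hf : f ∈ splitRelations b σ Z₀) {u : Diword Z} (hu : IsLeading f u) : u.length = 2 := by
  rcases hf with ⟨x, y, -, rfl⟩ | ⟨x, y, -, rfl⟩
  · rw [← (isLeading_vdashDefect b x y).unique hu]; rfl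
  · rw [← (isLeading_dashvDefect b x y).unique hu]; rfl

theorem IsSplitBasis.trivialLeftMul (H : IsSplitBasis b σ Z₀) {x y : Z}
    (hxy : VdashReducible σ Z₀ x y) (z : Z) :
    TrivialLeftMul (splitRelations b σ Z₀) (gen k z ⊣ᵈ vdashDefect b (b x) (b y)) := by
  have hd := le_deg_gen_dashv (b := b) z x y
  refine H.gen_dashv_vdashDefect_mem (fun p q h => ?_) (fun h => ?_) (fun h => ?_) hxy
  · exact Submodule.subset_span ⟨_, dashvDefect_mem_splitRelations h, .center [] [],
      ⟨trivial, rightNormed_dashvDefect b p q, rightNormed_dashvDefect b p q⟩,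
      ⟨_, isLeading_dashvDefect b p q, le_trans (Nat.le_succ 2) hd⟩, rfl⟩
  · exact Submodule.subset_span ⟨_, dashvDefect_mem_splitRelations h, .right [] z [] [],
      ⟨rightNormed_dashvDefect b _ _, rightNormed_dashvDefect b _ _, (rightNormed_gen z).dashv _⟩,
      ⟨_, isLeading_dashvDefect b _ _, hd⟩, rfl⟩
  · exact Submodule.subset_span ⟨_, dashvDefect_mem_splitRelations h, .center [] [y],
      ⟨trivial, rightNormed_dashvDefect b _ _, (rightNormed_dashvDefect b _ _).dashv _⟩,
      ⟨_, isLeading_dashvDefect b _ _, hd⟩, rfl⟩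

theorem IsSplitBasis.trivialRightMul (H : IsSplitBasis b σ Z₀) {x y : Z}
    (hxy : DashvReducible σ Z₀ x y) (z : Z) :
    TrivialRightMul (splitRelations b σ Z₀) (dashvDefect b (b x) (b y) ⊢ᵈ gen k z) := by
  have hd := le_deg_vdash_gen (b := b) z x y
  refine H.dashvDefect_vdash_gen_mem (fun p q h => ?_) (fun h => ?_) (fun h => ?_) hxy
  · exact Submodule.subset_span ⟨_, vdashDefect_mem_splitRelations h, .center [] [],
      ⟨trivial, leftNormed_vdashDefect b p q, leftNormed_vdashDefect b p q⟩,
      ⟨_, isLeading_vdashDefect b p q, le_trans (Nat.le_succ 2) hd⟩, rfl⟩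
  · exact Submodule.subset_span ⟨_, vdashDefect_mem_splitRelations h, .left [] [] z [],
      ⟨leftNormed_vdashDefect b _ _, leftNormed_vdashDefect b _ _, (leftNormed_gen z).vdash _⟩,
      ⟨_, isLeading_vdashDefect b _ _, hd⟩, rfl⟩
  · exact Submodule.subset_span ⟨_, vdashDefect_mem_splitRelations h, .center [x] [],
      ⟨trivial, leftNormed_vdashDefect b _ _, (leftNormed_vdashDefect b _ _).vdash _⟩,
      ⟨_, isLeading_vdashDefect b _ _, hd⟩, rfl⟩

/-- The span that occurs in the definition of a trivial composition. -/
noncomputable def compositionSpan (S : Set (FreeDialgebra k Z)) (f : FreeDialgebra k Z) (C : DiContext Z)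
    (g : FreeDialgebra k Z) (E : DiContext Z) (w : Diword Z) : Submodule k (FreeDialgebra k Z) :=
  Submodule.span k {h | ∃ s ∈ S, ∃ F : DiContext Z, F.Normal s ∧
    (∃ v, IsLeading s v ∧ F.plugWord v < w) ∧
    (C.RightNormedDiword f ∧ E.RightNormedDiword g → F.RightNormedDiword s) ∧
    (C.LeftNormedDiword f ∧ E.LeftNormedDiword g → F.LeftNormedDiword s) ∧ h = F.plug s}

/-- A ⊢-defect is left normed but never right normed, so it is admissible as soon as the composition
is not one of two right normed diwords. Its leading term has length two, below any word of three
letters. -/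
theorem vdashDefect_mem_compositionSpan {f g : FreeDialgebra k Z} {C F : DiContext Z}
    {w : Diword Z} (hw : 2 < w.length)
    (hfg : ¬ (RightNormed f ∧ RightNormed g)) (p q : Z) (h : VdashReducible σ Z₀ p q) :
    vdashDefect b (b p) (b q) ∈ compositionSpan (splitRelations b σ Z₀) f C g F w :=
  Submodule.subset_span ⟨_, vdashDefect_mem_splitRelations h, .center [] [], trivial,
    ⟨_, isLeading_vdashDefect b p q, Diword.lt_of_length_lt hw⟩,
    fun h => (hfg ⟨h.1.2.1, h.2.2.1⟩).elim,
    fun _ => ⟨trivial, leftNormed_vdashDefect b p q, leftNormed_vdashDefect b p q⟩, rfl⟩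

theorem dashvDefect_mem_compositionSpan {f g : FreeDialgebra k Z} {C F : DiContext Z}
    {w : Diword Z} (hw : 2 < w.length)
    (hfg : ¬ (LeftNormed f ∧ LeftNormed g)) (p q : Z) (h : DashvReducible σ Z₀ p q) :
    dashvDefect b (b p) (b q) ∈ compositionSpan (splitRelations b σ Z₀) f C g F w :=
  Submodule.subset_span ⟨_, dashvDefect_mem_splitRelations h, .center [] [], trivial,
    ⟨_, isLeading_dashvDefect b p q, Diword.lt_of_length_lt hw⟩,
    fun _ => ⟨trivial, rightNormed_dashvDefect b p q, rightNormed_dashvDefect b p q⟩,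
    fun h => (hfg ⟨h.1.2.1, h.2.2.1⟩).elim, rfl⟩

/-- Two relations overlap either completely, and then they are equal, or in one letter. In the
second case the center of the word of three letters is its last, middle or first letter, which gives
the ⊢⊢, ⊢⊣ and ⊣⊣ identities. The other contexts are excluded by normedness, by the empty outer
words, or by the length of the overlap. -/
theorem IsSplitBasis.intersection (H : IsSplitBasis b σ Z₀) {f g : FreeDialgebra k Z}
    (hf : f ∈ splitRelations b σ Z₀) (hg : g ∈ splitRelations b σ Z₀) {C F : DiContext Z}
    {u v w : Diword Z} (hu : IsLeading f u) (hv : IsLeading g v) (hCf : C.Normal f)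
    (hFg : F.Normal g) (hC : C.pre = []) (hF : F.post = []) (hwu : w = C.plugWord u)
    (hwv : w = F.plugWord v) (hlen : w.length < u.length + v.length) :
    TrivialComposition (splitRelations b σ Z₀) f C g F w := by
  -- Both leading terms have length two, so at most one letter of the word lies outside of the first
  -- of them.
  have hCpost : C.post.length < 2 := by
    have := C.length_plugWord u
    rw [← hwu] at this
    rw [length_of_isLeading_of_mem_splitRelations hg hv] at hlen
    omega
  rcases hf with ⟨x, y, hxy, rfl⟩ | ⟨x, y, hxy, rfl⟩ <;>
  rcases hg with ⟨x', y', hxy', rfl⟩ | ⟨x', y', hxy', rfl⟩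
  · obtain rfl := (isLeading_vdashDefect b x y).unique hu
    obtain rfl := (isLeading_vdashDefect b x' y').unique hv
    rcases C with ⟨c, c'⟩ | ⟨c₁, c₂, z, c₃⟩ | ⟨c₁, z, c₂, c₃⟩
    · rcases F with ⟨e, e'⟩ | ⟨e₁, e₂, z', e₃⟩ | ⟨e₁, z', e₂, e₃⟩
      · obtain rfl : c = [] := hC
        obtain rfl : e' = [] := hF
        rw [hwu] at hwv
        simp only [plugWord, Diword.mk.injEq, List.nil_append, List.append_nil] at hwv
        obtain ⟨h₁, rfl, rfl⟩ := hwv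
        obtain ⟨rfl, h₂⟩ := List.append_inj' (s₁ := []) h₁ rfl
        obtain rfl := List.singleton_injective h₂
        exact trivialComposition_self _ _ _ _
      · simp [post] at hF
      · exact (not_rightNormed_vdashDefect b _ _ hFg).elim
    · rcases F with ⟨e, e'⟩ | ⟨e₁, e₂, z', e₃⟩ | ⟨e₁, z', e₂, e₃⟩
      · obtain rfl : c₁ = [] := hC
        obtain rfl : e' = [] := hF
        obtain ⟨rfl, rfl⟩ : c₂ = [] ∧ c₃ = [] := by
          simp only [post, List.length_append, List.length_cons] at hCpost
          exact ⟨List.eq_nil_of_length_eq_zero (by omega),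
            List.eq_nil_of_length_eq_zero (by omega)⟩
        have hw : 2 < w.length := by rw [hwu]; exact Nat.lt_succ_self 2
        rw [hwu] at hwv
        simp only [plugWord, Diword.word, Diword.mk.injEq, List.nil_append, List.append_nil,
          and_true, List.singleton_append] at hwv
        obtain ⟨h₁, rfl⟩ := hwv
        obtain ⟨rfl, h₂⟩ := List.append_inj' (s₁ := [x]) h₁ rfl
        obtain rfl := List.singleton_injective h₂
        exact H.vdash_vdash_composition_mem (vdashDefect_mem_compositionSpan hw
          fun h => not_rightNormed_vdashDefect b _ _ h.1) hxy hxy'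
      · simp [post] at hF
      · exact (not_rightNormed_vdashDefect b _ _ hFg).elim
    · simp [pre] at hC
  · obtain rfl := (isLeading_vdashDefect b x y).unique hu
    obtain rfl := (isLeading_dashvDefect b x' y').unique hv
    rcases C with ⟨c, c'⟩ | ⟨c₁, c₂, z, c₃⟩ | ⟨c₁, z, c₂, c₃⟩
    · rcases F with ⟨e, e'⟩ | ⟨e₁, e₂, z', e₃⟩ | ⟨e₁, z', e₂, e₃⟩
      · obtain rfl : c = [] := hC
        obtain rfl : e' = [] := hF
        rw [hwu] at hwv
        simp only [plugWord, Diword.mk.injEq, List.nil_append, List.append_nil] at hwv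
        obtain ⟨rfl, rfl, rfl⟩ := hwv
        have hw : 2 < w.length := by rw [hwu]; exact Nat.lt_succ_self 2
        refine H.vdash_dashv_composition_mem (vdashDefect_mem_compositionSpan hw
          fun h => not_rightNormed_vdashDefect b _ _ h.1) (dashvDefect_mem_compositionSpan hw
          fun h => not_leftNormed_dashvDefect b _ _ h.2) hxy hxy'
      · simp [post] at hF
      · rw [hwu] at hwv
        simp only [plugWord, Diword.word, Diword.mk.injEq, List.nil_append] at hwv
        rw [post, hwv.2.2] at hCpost
        simp at hCpost
        omega
    · rcases F with ⟨e, e'⟩ | ⟨e₁, e₂, z', e₃⟩ | ⟨e₁, z', e₂, e₃⟩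
      · rw [hwu] at hwv
        simp only [plugWord, Diword.word, Diword.mk.injEq] at hwv
        rw [post, hwv.2.2] at hCpost
        simp at hCpost
        omega
      · simp [post] at hF
      · rw [hwu] at hwv
        simp only [plugWord, Diword.word, Diword.mk.injEq] at hwv
        rw [post, hwv.2.2] at hCpost
        simp at hCpost
        omega
    · simp [pre] at hC
  -- A ⊣-relation followed by a ⊢-relation would need its center both before and after the common
  -- letter; no placement is possible.
  · obtain rfl := (isLeading_dashvDefect b x y).unique hu
    obtain rfl := (isLeading_vdashDefect b x' y').unique hv
    rcases C with ⟨c, c'⟩ | ⟨c₁, c₂, z, c₃⟩ | ⟨c₁, z, c₂, c₃⟩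
    · rcases F with ⟨e, e'⟩ | ⟨e₁, e₂, z', e₃⟩ | ⟨e₁, z', e₂, e₃⟩
      · obtain rfl : e' = [] := hF
        rw [hwu] at hwv
        simp [plugWord] at hwv
      · simp [post] at hF
      · exact (not_rightNormed_vdashDefect b _ _ hFg).elim
    · exact (not_leftNormed_dashvDefect b _ _ hCf).elim
    · simp [pre] at hC
  · obtain rfl := (isLeading_dashvDefect b x y).unique hu
    obtain rfl := (isLeading_dashvDefect b x' y').unique hv
    rcases C with ⟨c, c'⟩ | ⟨c₁, c₂, z, c₃⟩ | ⟨c₁, z, c₂, c₃⟩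
    · obtain rfl : c = [] := hC
      rcases F with ⟨e, e'⟩ | ⟨e₁, e₂, z', e₃⟩ | ⟨e₁, z', e₂, e₃⟩
      · obtain rfl : e' = [] := hF
        rw [hwu] at hwv
        simp only [plugWord, Diword.mk.injEq, List.append_nil, List.singleton_append,
          List.cons.injEq] at hwv
        obtain ⟨rfl, rfl, rfl, rfl⟩ := hwv
        exact trivialComposition_self _ _ _ _
      · simp [post] at hF
      · obtain rfl : e₃ = [] := hF
        rw [hwu] at hwv
        simp only [plugWord, Diword.word, Diword.mk.injEq, List.nil_append, List.append_nil,
          List.singleton_append] at hwv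
        obtain ⟨rfl, rfl, h₁⟩ := hwv
        obtain rfl : e₂ = [] := by
          have := congrArg List.length h₁
          simp only [post] at hCpost
          simp at this
          exact List.eq_nil_of_length_eq_zero (by omega)
        obtain ⟨rfl, rfl⟩ := List.cons.inj h₁
        have hw : 2 < w.length := by rw [hwu]; exact Nat.lt_succ_self 2
        exact H.dashv_dashv_composition_mem (dashvDefect_mem_compositionSpan hw
          fun h => not_leftNormed_dashvDefect b _ _ h.1) hxy hxy'
    · exact (not_leftNormed_dashvDefect b _ _ hCf).elim
    · simp [pre] at hC

theorem IsSplitBasis.isGroebnerShirshovBasis (H : IsSplitBasis b σ Z₀) :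
    IsGroebnerShirshovBasis (splitRelations b σ Z₀) where
  monic := by
    rintro _ (⟨x, y, -, rfl⟩ | ⟨x, y, -, rfl⟩)
    · exact ⟨_, isLeading_vdashDefect b x y, by
        rw [vdashDefect_basis, of_sub_expand_apply b one_lt_two]⟩
    · exact ⟨_, isLeading_dashvDefect b x y, by
        rw [dashvDefect_basis, of_sub_expand_apply b one_lt_two]⟩
  left_mul := by
    rintro _ (⟨x, y, h, rfl⟩ | ⟨x, y, h, rfl⟩) hn z
    · exact H.trivialLeftMul h z
    · exact (hn (rightNormed_dashvDefect b x y)).elim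
  right_mul := by
    rintro _ (⟨x, y, h, rfl⟩ | ⟨x, y, h, rfl⟩) hn z
    · exact (hn (leftNormed_vdashDefect b x y)).elim
    · exact H.trivialRightMul h z
  inclusion := by
    intro f hf g hg F u v hu hv _ huv
    -- Leading terms of equal length force the context of an inclusion to be empty, and then equal
    -- leading terms force equal relations.
    obtain rfl := F.eq_center_of_length_le v (by
      rw [← huv, length_of_isLeading_of_mem_splitRelations hf hu,
        length_of_isLeading_of_mem_splitRelations hg hv])
    have huv' : u = v := by simpa [plugWord] using huv
    subst huv'
    obtain rfl := eq_of_isLeading_of_mem_splitRelations hf hg hu hv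
    exact trivialComposition_self _ _ _ _
  intersection := fun _ hf _ hg _ _ _ _ _ hu hv hCf hFg hC hF hwu hwv hlen =>
    H.intersection hf hg hu hv hCf hFg hC hF hwu hwv hlen

/-! ### Irreducible diwords -/

/-- The alternating diwords with respect to `σ` whose letters other than the center lie outside
of `Z₀`. -/
def splitDiwords (σ : Z → Prop) (Z₀ : Set Z) : Set (Diword Z) :=
  {u | (∀ z ∈ u.left ++ u.right, z ∉ Z₀) ∧ u.word.IsChain (fun z z' => ¬ (σ z ↔ σ z'))}

theorem isChain_of_forall_append {α : Type*} {R : α → α → Prop} {l : List α}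
    (h : ∀ a x y b, l = a ++ x :: y :: b → R x y) : l.IsChain R := by
  induction l with
  | nil => simp
  | cons x l ih =>
    cases l with
    | nil => simp
    | cons y l =>
      refine List.isChain_cons_cons.2 ⟨h [] x y l rfl, ih fun a p q b e => ?_⟩
      exact h (x :: a) p q b (by rw [e, List.cons_append])

theorem rel_of_isChain_append {α : Type*} {R : α → α → Prop} {a b : List α} {x y : α}
    (h : (a ++ x :: y :: b).IsChain R) : R x y :=
  (List.isChain_append_cons_cons.1 h).2.1

theorem forall_mem_of_isChain_append_singleton {α : Type*} {R : α → α → Prop} {P : α → Prop}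
    (hR : ∀ x y, R x y → P x) {l : List α} {c : α} (h : (l ++ [c]).IsChain R) :
    ∀ x ∈ l, P x := by
  intro x hx
  obtain ⟨s, t, rfl⟩ := List.append_of_mem hx
  cases t with
  | nil => exact hR x c (rel_of_isChain_append (a := s) (b := []) (by simpa using h))
  | cons y t => exact hR x y (rel_of_isChain_append (a := s) (b := t ++ [c]) (by simpa using h))

theorem forall_mem_of_isChain_cons {α : Type*} {R : α → α → Prop} {P : α → Prop}
    (hR : ∀ x y, R x y → P y) {l : List α} {c : α} (h : (c :: l).IsChain R) :
    ∀ x ∈ l, P x := by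
  intro x hx
  obtain ⟨s, t, rfl⟩ := List.append_of_mem hx
  rcases List.eq_nil_or_concat s with rfl | ⟨s, y, rfl⟩
  · exact hR c x (rel_of_isChain_append (a := []) (b := t) h)
  · exact hR y x (rel_of_isChain_append (a := c :: s) (b := t) (by simpa using h))

/-- A ⊢-relation is not right normed, so it fits only at a pair of neighbours that lies to the left
of the center or ends in it; a ⊣-relation fits only at a pair that begins in the center or lies to
its right. In either case the letter tested for membership in Z₀ is the non-central one, which is
why the center alone may belong to Z₀. -/
theorem irr_splitRelations : Irr (splitRelations b σ Z₀) = splitDiwords σ Z₀ := by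
  ext u
  constructor
  · intro hu
    have hl : (u.left ++ [u.center]).IsChain fun z z' => ¬ VdashReducible σ Z₀ z z' := by
      refine isChain_of_forall_append fun a x y c e h => hu
        ⟨_, vdashDefect_mem_splitRelations h, ?_⟩
      -- If nothing follows the pair, then its second letter is the center and the relation replaces
      -- the center; otherwise the pair stands strictly to the left of it.
      rcases List.eq_nil_or_concat c with rfl | ⟨c, y', rfl⟩
      · obtain ⟨h₁, h₂⟩ := List.append_inj' (s₁ := u.left) (s₂ := a ++ [x]) (t₁ := [u.center])
          (t₂ := [y])
          (by simpa using e) rfl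
        refine ⟨.center a u.right, trivial, _, isLeading_vdashDefect b x y, ?_⟩
        exact Diword.ext h₁ (List.singleton_injective h₂) rfl
      · obtain ⟨h₁, h₂⟩ := List.append_inj' (s₁ := u.left) (s₂ := a ++ x :: y :: c) (t₁ := [u.center])
          (t₂ := [y'])
          (by simpa using e) rfl
        refine ⟨.left a c u.center u.right, leftNormed_vdashDefect b x y, _,
          isLeading_vdashDefect b x y, ?_⟩
        exact Diword.ext (by simpa [plugWord, Diword.word] using h₁) rfl rfl
    have hr : (u.center :: u.right).IsChain fun z z' => ¬ DashvReducible σ Z₀ z z' := by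
      refine isChain_of_forall_append fun a x y c e h => hu
        ⟨_, dashvDefect_mem_splitRelations h, ?_⟩
      rcases a with _ | ⟨x', a⟩
      · obtain ⟨h₁, h₂⟩ := List.cons.inj e
        refine ⟨.center u.left c, trivial, _, isLeading_dashvDefect b x y, ?_⟩
        exact Diword.ext (by simp [plugWord]) h₁ h₂
      · obtain ⟨h₁, h₂⟩ := List.cons.inj e
        refine ⟨.right u.left u.center a c, rightNormed_dashvDefect b x y, _,
          isLeading_dashvDefect b x y, ?_⟩
        exact Diword.ext rfl rfl (by simpa [plugWord, Diword.word] using h₂)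
    refine ⟨fun z hz => ?_, ?_⟩
    · rcases List.mem_append.1 hz with hz | hz
      · exact forall_mem_of_isChain_append_singleton (P := (· ∉ Z₀))
          (fun x y h hx => h (Or.inr hx)) hl z hz
      · exact forall_mem_of_isChain_cons (P := (· ∉ Z₀))
          (fun x y h hx => h (Or.inr hx)) hr z hz
    · exact List.isChain_split.2 ⟨hl.imp fun x y h hxy => h (Or.inl hxy),
        hr.imp fun x y h hxy => h (Or.inl hxy)⟩
  · rintro ⟨h₀, hc⟩ ⟨_, ⟨x, y, h, rfl⟩ | ⟨x, y, h, rfl⟩, C, hC, v, hv, rfl⟩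
    · obtain rfl := (isLeading_vdashDefect b x y).unique hv
      rcases C with ⟨c, c'⟩ | ⟨c₁, c₂, z, c₃⟩ | ⟨c₁, z, c₂, c₃⟩
      · refine h.elim (fun h => ?_) (h₀ x (by simp [plugWord]))
        exact rel_of_isChain_append (R := fun z z' => ¬ (σ z ↔ σ z')) (a := c) (b := c')
          (by simpa [plugWord, Diword.word] using hc) h
      · refine h.elim (fun h => ?_) (h₀ x (by simp [plugWord, Diword.word]))
        exact rel_of_isChain_append (R := fun z z' => ¬ (σ z ↔ σ z')) (a := c₁) (b := c₂ ++ z :: c₃)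
          (by simpa [plugWord, Diword.word] using hc) h
      · exact not_rightNormed_vdashDefect b _ _ hC
    · obtain rfl := (isLeading_dashvDefect b x y).unique hv
      rcases C with ⟨c, c'⟩ | ⟨c₁, c₂, z, c₃⟩ | ⟨c₁, z, c₂, c₃⟩
      · refine h.elim (fun h => ?_) (h₀ y (by simp [plugWord]))
        exact rel_of_isChain_append (R := fun z z' => ¬ (σ z ↔ σ z')) (a := c) (b := c')
          (by simpa [plugWord, Diword.word] using hc) h
      · exact not_leftNormed_dashvDefect b _ _ hC
      · refine h.elim (fun h => ?_) (h₀ y (by simp [plugWord, Diword.word]))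
        exact rel_of_isChain_append (R := fun z z' => ¬ (σ z ↔ σ z')) (a := c₁ ++ z :: c₂) (b := c₃)
          (by simpa [plugWord, Diword.word] using hc) h

/-- Every diword is congruent to a linear combination of irreducible ones. -/
theorem of_mem_span_irr_sup (u : Diword Z) :
    of k u ∈ Submodule.span k (of k '' Irr (splitRelations b σ Z₀)) ⊔
      dialgebraIdeal k (splitRelations b σ Z₀) := by
  induction hn : u.length using Nat.strong_induction_on generalizing u with
  | _ n ih =>
    by_cases hu : u ∈ Irr (splitRelations b σ Z₀)
    · exact Submodule.mem_sup_left (Submodule.subset_span ⟨u, hu, rfl⟩)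
    · obtain ⟨s, hs, C, -, v, hv, rfl⟩ := not_not.1 hu
      -- Every relation is its leading diword minus a combination of single letters, so one step of
      -- rewriting shortens the word.
      have hs' : ∃ w : E, s = of k v - expand b id w := by
        rcases hs with ⟨x, y, -, rfl⟩ | ⟨x, y, -, rfl⟩
        · obtain rfl := (isLeading_vdashDefect b x y).unique hv
          exact ⟨_, vdashDefect_basis b x y⟩
        · obtain rfl := (isLeading_dashvDefect b x y).unique hv
          exact ⟨_, dashvDefect_basis b x y⟩
      have hlv := length_of_isLeading_of_mem_splitRelations hs hv
      obtain ⟨w, hw⟩ := hs'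
      obtain ⟨L, hL⟩ := exists_plug_linear k C
      have e : of k (C.plugWord v) = L (expand b id w) + C.plug s := by
        rw [← plug_of, ← hL, ← hL, ← map_add, hw, add_sub_cancel]
      rw [e]
      refine add_mem ?_ (Submodule.mem_sup_right (plug_mem
        (isDialgebraIdeal_dialgebraIdeal k _) C (subset_dialgebraIdeal k _ hs)))
      have hw' := expand_mem_supported b w
      rw [mem_supported_iff_span] at hw'
      refine Submodule.mem_comap.1 ((Submodule.span_le (p := Submodule.comap L _)).2 ?_ hw')
      rintro _ ⟨_, ⟨c, rfl⟩, rfl⟩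
      rw [SetLike.mem_coe, Submodule.mem_comap, hL, plug_of]
      refine ih _ ?_ _ rfl
      rw [← hn, length_plugWord, length_plugWord, hlv]
      have : (Diword.letter c).length = 1 := rfl
      omega

end SplitBasisGroebnerShirshov

/-! ### Operators on triples of a word, a letter and a word -/

section Operators

variable {k Z E : Type*} [Field k] [AddCommGroup E] [Module k E] (b : Module.Basis Z k E)
  (σ : Z → Prop) (Z₀ : Set Z)

open Classical in
/-- The projection onto the span of the basis vectors with the property `P`. -/
noncomputable def basisProj (P : Z → Prop) : E →ₗ[k] E :=
  b.constr k fun z => if P z then b z else 0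

/-- The linear extension of a map from the basis to a type. -/
noncomputable def basisMap {α : Type*} (f : Z → α) : E →ₗ[k] α →₀ k :=
  b.constr k fun z => Finsupp.single (f z) 1

/-- A bilinear operation, written as a left action, that respects the sides of the basis, and for
which `Z₀` spans an ideal that acts as zero. -/
structure IsSideAction (m : E →ₗ[k] E →ₗ[k] E) : Prop where
  eq_zero : ∀ z z', ¬ (σ z ↔ σ z') → m (b z) (b z') = 0
  mem_side : ∀ z z', m (b z) (b z') ∈ Submodule.span k (b '' {w | σ w ↔ σ z})
  mem_of_mem : ∀ v, ∀ w ∈ Submodule.span k (b '' Z₀), m v w ∈ Submodule.span k (b '' Z₀)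
  eq_zero_of_mem : ∀ v ∈ Submodule.span k (b '' Z₀), ∀ w, m v w = 0
  assoc : ∀ u v w, m (m u v) w = m u (m v w)

/-- The value of the operator of `v` on a triple: `v` is multiplied to the first letter of the
first word, or to the letter in the middle if the first word is empty; the part of `v` on the other
side is put in front of the first word. -/
noncomputable def tripleAction (m : E →ₗ[k] E →ₗ[k] E) :
    List Z × Z × List Z → E →ₗ[k] (List Z × Z × List Z) →₀ k
  | (h :: l, c, r) =>
    basisMap b (fun z => (z :: l, c, r)) ∘ₗ basisProj b (fun z => z ∉ Z₀) ∘ₗ m.flip (b h) +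
    basisMap b (fun z => (z :: h :: l, c, r)) ∘ₗ
      basisProj b (fun z => z ∉ Z₀ ∧ ¬ (σ z ↔ σ h))
  | ([], c, r) =>
    basisMap b (fun z => ([], z, r)) ∘ₗ m.flip (b c) +
    basisMap b (fun z => ([z], c, r)) ∘ₗ basisProj b (fun z => z ∉ Z₀ ∧ ¬ (σ z ↔ σ c))

/-- The operators on the space of triples. -/
noncomputable def tripleOp (m : E →ₗ[k] E →ₗ[k] E) :
    E →ₗ[k] Module.End k ((List Z × Z × List Z) →₀ k) :=
  (Finsupp.linearCombination k (tripleAction b σ Z₀ m)).flip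

variable {b σ Z₀}

theorem basisProj_basis_of_pos {P : Z → Prop} {z : Z} (h : P z) : basisProj b P (b z) = b z := by
  simp [basisProj, h]

theorem basisProj_basis_of_neg {P : Z → Prop} {z : Z} (h : ¬ P z) : basisProj b P (b z) = 0 := by
  simp [basisProj, h]

theorem basisProj_eq_zero {P : Z → Prop} {s : Set Z} (h : ∀ z ∈ s, ¬ P z) {v : E}
    (hv : v ∈ Submodule.span k (b '' s)) : basisProj b P v = 0 := by
  refine LinearMap.eqOn_span (f := basisProj b P) (g := 0) ?_ hv
  rintro _ ⟨z, hz, rfl⟩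
  exact basisProj_basis_of_neg (h z hz)

theorem basisProj_congr {P Q : Z → Prop} {s : Set Z} (h : ∀ z ∈ s, (P z ↔ Q z)) {v : E}
    (hv : v ∈ Submodule.span k (b '' s)) : basisProj b P v = basisProj b Q v := by
  refine LinearMap.eqOn_span (f := basisProj b P) (g := basisProj b Q) ?_ hv
  rintro _ ⟨z, hz, rfl⟩
  by_cases hP : P z
  · rw [basisProj_basis_of_pos hP, basisProj_basis_of_pos ((h z hz).1 hP)]
  · rw [basisProj_basis_of_neg hP, basisProj_basis_of_neg fun hQ => hP ((h z hz).2 hQ)]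

theorem basisMap_basis {α : Type*} (f : Z → α) (z : Z) :
    basisMap b f (b z) = Finsupp.single (f z) 1 := by
  simp [basisMap]

theorem mapDomain_basisMap {α β : Type*} (f : Z → α) (g : α → β) (v : E) :
    Finsupp.lmapDomain k k g (basisMap b f v) = basisMap b (fun z => g (f z)) v := by
  have : Finsupp.lmapDomain k k g ∘ₗ basisMap b f = basisMap b (fun z => g (f z)) := by
    refine b.ext fun z => ?_
    rw [LinearMap.comp_apply, basisMap_basis, basisMap_basis, Finsupp.lmapDomain_apply,
      Finsupp.mapDomain_single]
  exact LinearMap.congr_fun this v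

theorem tripleOp_single (m : E →ₗ[k] E →ₗ[k] E) (v : E) (x : List Z × Z × List Z) :
    tripleOp b σ Z₀ m v (Finsupp.single x 1) = tripleAction b σ Z₀ m x v := by
  simp [tripleOp]

theorem tripleAction_cons (m : E →ₗ[k] E →ₗ[k] E) (h : Z) (l : List Z) (c : Z) (r : List Z)
    (v : E) : tripleAction b σ Z₀ m (h :: l, c, r) v =
      basisMap b (fun z => (z :: l, c, r)) (basisProj b (fun z => z ∉ Z₀) (m v (b h))) +
      basisMap b (fun z => (z :: h :: l, c, r))
        (basisProj b (fun z => z ∉ Z₀ ∧ ¬ (σ z ↔ σ h)) v) := rfl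

/-- The product with the center is not projected away from Z₀, in contrast to the products in a
nonempty word, because the center of an irreducible diword may lie in Z₀. -/
theorem tripleAction_nil (m : E →ₗ[k] E →ₗ[k] E) (c : Z) (r : List Z) (v : E) :
    tripleAction b σ Z₀ m ([], c, r) v =
      basisMap b (fun z => ([], z, r)) (m v (b c)) +
      basisMap b (fun z => ([z], c, r))
        (basisProj b (fun z => z ∉ Z₀ ∧ ¬ (σ z ↔ σ c)) v) := rfl

namespace IsSideAction

variable {m : E →ₗ[k] E →ₗ[k] E} (H : IsSideAction b σ Z₀ m)

include H

theorem mem_side_of_mem (z : Z) {w : E} (hw : w ∈ Submodule.span k (b '' {w | σ w ↔ σ z})) :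
    m (b z) w ∈ Submodule.span k (b '' {w | σ w ↔ σ z}) := by
  refine Submodule.mem_comap.1 ((Submodule.span_le (p := Submodule.comap (m (b z)) _)).2 ?_ hw)
  rintro _ ⟨c, -, rfl⟩
  exact H.mem_side z c

omit H in
theorem tripleAction_cons_of_mem_side (h : Z) (l : List Z) (c : Z) (r : List Z) {v : E}
    (hv : v ∈ Submodule.span k (b '' {w | σ w ↔ σ h})) :
    tripleAction b σ Z₀ m (h :: l, c, r) v =
      basisMap b (fun z => (z :: l, c, r)) (basisProj b (fun z => z ∉ Z₀) (m v (b h))) := by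
  rw [tripleAction_cons, basisProj_eq_zero (P := fun z => z ∉ Z₀ ∧ ¬ (σ z ↔ σ h))
    (fun z hz hn => hn.2 hz) hv, map_zero, add_zero]

theorem apply_eq_zero_of_mem {h z : Z} (hz : ¬ (σ z ↔ σ h)) {v : E}
    (hv : v ∈ Submodule.span k (b '' {w | σ w ↔ σ z})) : m v (b h) = 0 := by
  refine LinearMap.eqOn_span (f := m.flip (b h)) (g := 0) ?_ hv
  rintro _ ⟨w, hw, rfl⟩
  exact H.eq_zero w h fun hwh => hz ((show σ w ↔ σ z from hw).symm.trans hwh)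

theorem tripleAction_cons_of_mem_other {h z : Z} (hz : ¬ (σ z ↔ σ h)) (l : List Z) (c : Z)
    (r : List Z) {v : E} (hv : v ∈ Submodule.span k (b '' {w | σ w ↔ σ z})) :
    tripleAction b σ Z₀ m (h :: l, c, r) v =
      basisMap b (fun z => (z :: h :: l, c, r)) (basisProj b (fun z => z ∉ Z₀) v) := by
  rw [tripleAction_cons, H.apply_eq_zero_of_mem hz hv, map_zero, map_zero, zero_add]
  congr 1
  refine basisProj_congr (fun w hw => and_iff_left fun hwh => hz ?_) hv
  exact (show σ w ↔ σ z from hw).symm.trans hwh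

omit H in
theorem tripleAction_nil_of_mem_side (c : Z) (r : List Z) {v : E}
    (hv : v ∈ Submodule.span k (b '' {w | σ w ↔ σ c})) :
    tripleAction b σ Z₀ m ([], c, r) v = basisMap b (fun z => ([], z, r)) (m v (b c)) := by
  rw [tripleAction_nil, basisProj_eq_zero (P := fun z => z ∉ Z₀ ∧ ¬ (σ z ↔ σ c))
    (fun z hz hn => hn.2 hz) hv, map_zero, add_zero]

theorem tripleAction_nil_of_mem_other {c z : Z} (hz : ¬ (σ z ↔ σ c)) (r : List Z) {v : E}
    (hv : v ∈ Submodule.span k (b '' {w | σ w ↔ σ z})) :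
    tripleAction b σ Z₀ m ([], c, r) v =
      basisMap b (fun z => ([z], c, r)) (basisProj b (fun z => z ∉ Z₀) v) := by
  rw [tripleAction_nil, H.apply_eq_zero_of_mem hz hv, map_zero, zero_add]
  congr 1
  refine basisProj_congr (fun w hw => and_iff_left fun hwh => hz ?_) hv
  exact (show σ w ↔ σ z from hw).symm.trans hwh

omit H in
theorem basis_mem_span_side (z : Z) : b z ∈ Submodule.span k (b '' {w | σ w ↔ σ z}) :=
  Submodule.subset_span ⟨z, Iff.rfl, rfl⟩

/-- Dropping the letters of Z₀ before multiplying makes no difference after they are dropped again,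
since multiplication by any element preserves the span of Z₀. -/
theorem tripleOp_basisMap_cons (z : Z) (l : List Z) (c : Z) (r : List Z) {w : E}
    (hw : w ∈ Submodule.span k (b '' {w | σ w ↔ σ z})) :
    tripleOp b σ Z₀ m (b z)
        (basisMap b (fun x => (x :: l, c, r)) (basisProj b (fun z => z ∉ Z₀) w)) =
      basisMap b (fun x => (x :: l, c, r)) (basisProj b (fun z => z ∉ Z₀) (m (b z) w)) := by
  refine LinearMap.eqOn_span (f := tripleOp b σ Z₀ m (b z) ∘ₗ
    basisMap b (fun x => (x :: l, c, r)) ∘ₗ basisProj b (fun z => z ∉ Z₀))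
    (g := basisMap b (fun x => (x :: l, c, r)) ∘ₗ basisProj b (fun z => z ∉ Z₀) ∘ₗ m (b z)) ?_ hw
  rintro _ ⟨h, hh, rfl⟩
  simp only [LinearMap.comp_apply]
  by_cases h₀ : h ∈ Z₀
  · rw [basisProj_basis_of_neg (P := fun z => z ∉ Z₀) (not_not.2 h₀), map_zero, map_zero,
      basisProj_eq_zero (fun _ hz => not_not.2 hz)
        (H.mem_of_mem _ _ (Submodule.subset_span ⟨h, h₀, rfl⟩)), map_zero]
  · rw [basisProj_basis_of_pos (P := fun z => z ∉ Z₀) h₀, basisMap_basis, tripleOp_single,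
      tripleAction_cons_of_mem_side]
    exact Submodule.subset_span ⟨z, (show σ h ↔ σ z from hh).symm, rfl⟩

set_option linter.unusedSectionVars false in
theorem tripleOp_basisMap_nil (z : Z) (r : List Z) {w : E}
    (hw : w ∈ Submodule.span k (b '' {w | σ w ↔ σ z})) :
    tripleOp b σ Z₀ m (b z) (basisMap b (fun x => ([], x, r)) w) =
      basisMap b (fun x => ([], x, r)) (m (b z) w) := by
  refine LinearMap.eqOn_span (f := tripleOp b σ Z₀ m (b z) ∘ₗ basisMap b (fun x => ([], x, r)))
    (g := basisMap b (fun x => ([], x, r)) ∘ₗ m (b z)) ?_ hw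
  rintro _ ⟨c, hc, rfl⟩
  simp only [LinearMap.comp_apply]
  rw [basisMap_basis, tripleOp_single, tripleAction_nil_of_mem_side]
  exact Submodule.subset_span ⟨z, (show σ c ↔ σ z from hc).symm, rfl⟩

theorem tripleOp_basisMap_nil_of_mem_other {z c : Z} (hz : z ∉ Z₀) (hc : ¬ (σ z ↔ σ c))
    (r : List Z) {w : E} (hw : w ∈ Submodule.span k (b '' {w | σ w ↔ σ c})) :
    tripleOp b σ Z₀ m (b z) (basisMap b (fun x => ([], x, r)) w) =
      basisMap b (fun x => ([z], x, r)) w := by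
  refine LinearMap.eqOn_span (f := tripleOp b σ Z₀ m (b z) ∘ₗ basisMap b (fun x => ([], x, r)))
    (g := basisMap b (fun x => ([z], x, r))) ?_ hw
  rintro _ ⟨c', hc', rfl⟩
  simp only [LinearMap.comp_apply]
  rw [basisMap_basis, tripleOp_single, H.tripleAction_nil_of_mem_other
    (fun h => hc (h.trans hc')) _ (basis_mem_span_side z),
    basisProj_basis_of_pos (P := fun z => z ∉ Z₀) hz, basisMap_basis, basisMap_basis]

/-- Both summands of the action vanish: multiplication because the span of Z₀ acts as zero, and
prepending because the projection drops Z₀. -/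
theorem tripleOp_eq_zero_of_mem {v : E} (hv : v ∈ Submodule.span k (b '' Z₀)) :
    tripleOp b σ Z₀ m v = 0 := by
  refine Finsupp.lhom_ext' fun x => LinearMap.ext_ring ?_
  have h (P : Z → Prop) : basisProj b (fun z => z ∉ Z₀ ∧ P z) v = 0 :=
    basisProj_eq_zero (fun z hz hn => hn.1 hz) hv
  rw [LinearMap.comp_apply, Finsupp.lsingle_apply, tripleOp_single]
  obtain ⟨_ | ⟨a, l⟩, c, r⟩ := x
  · rw [tripleAction_nil, h, H.eq_zero_of_mem v hv]
    simp
  · rw [tripleAction_cons, h, H.eq_zero_of_mem v hv]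
    simp

/-- If the outermost letter is on the side of z and z', both operators multiply and the claim is
associativity of m. If it is on the other side, the right-hand operator prepends a letter and the
left-hand one multiplies into that letter, with the same result as prepending the product. -/
theorem tripleOp_mul {z z' : Z} (hz : σ z ↔ σ z') :
    tripleOp b σ Z₀ m (b z) * tripleOp b σ Z₀ m (b z') = tripleOp b σ Z₀ m (m (b z) (b z')) := by
  refine Finsupp.lhom_ext' fun x => LinearMap.ext_ring ?_
  rw [LinearMap.comp_apply, LinearMap.comp_apply, Finsupp.lsingle_apply, tripleOp_single,
    Module.End.mul_apply, tripleOp_single]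
  have hs := H.mem_side z z'
  have hs' : b z' ∈ Submodule.span k (b '' {w | σ w ↔ σ z}) :=
    Submodule.subset_span ⟨z', hz.symm, rfl⟩
  obtain ⟨_ | ⟨h, l⟩, c, r⟩ := x
  · by_cases hh : σ z ↔ σ c
    · have hm := H.mem_side_of_mem z' (w := b c)
        (Submodule.subset_span ⟨c, hh.symm.trans hz, rfl⟩)
      rw [show {w | σ w ↔ σ z'} = {w | σ w ↔ σ z} by simp only [hz]] at hm
      have e := H.tripleOp_basisMap_nil z r hm
      rw [show {w | σ w ↔ σ z} = {w | σ w ↔ σ c} by simp only [hh]] at hs hs'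
      rw [tripleAction_nil_of_mem_side c r hs, tripleAction_nil_of_mem_side c r hs', e,
        H.assoc]
    · rw [H.tripleAction_nil_of_mem_other hh r hs, H.tripleAction_nil_of_mem_other hh r hs',
        H.tripleOp_basisMap_cons z [] c r hs']
  · by_cases hh : σ z ↔ σ h
    · have hm := H.mem_side_of_mem z' (w := b h)
        (Submodule.subset_span ⟨h, hh.symm.trans hz, rfl⟩)
      rw [show {w | σ w ↔ σ z'} = {w | σ w ↔ σ z} by simp only [hz]] at hm
      have e := H.tripleOp_basisMap_cons z l c r hm
      rw [show {w | σ w ↔ σ z} = {w | σ w ↔ σ h} by simp only [hh]] at hs hs'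
      rw [tripleAction_cons_of_mem_side h l c r hs, tripleAction_cons_of_mem_side h l c r hs',
        e, H.assoc]
    · rw [H.tripleAction_cons_of_mem_other hh l c r hs,
        H.tripleAction_cons_of_mem_other hh l c r hs', H.tripleOp_basisMap_cons z _ c r hs']

/-- On alternating words the operators build up the word letter by letter. -/
theorem prod_tripleOp_apply {c : Z} {r l : List Z} (h₀ : ∀ z ∈ l, z ∉ Z₀)
    (hl : (l ++ [c]).IsChain fun z z' => ¬ (σ z ↔ σ z')) :
    (l.map fun z => tripleOp b σ Z₀ m (b z)).prod (Finsupp.single ([], c, r) 1) =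
      Finsupp.single (l, c, r) 1 := by
  induction l with
  | nil => rfl
  | cons z l ih =>
    rw [List.map_cons, List.prod_cons, Module.End.mul_apply,
      ih (fun z hz => h₀ z (List.mem_cons_of_mem _ hz)) hl.tail, tripleOp_single]
    have hz : z ∉ Z₀ := h₀ z List.mem_cons_self
    cases l with
    | nil =>
      rw [H.tripleAction_nil_of_mem_other (List.isChain_cons_cons.1 hl).1 r
        (basis_mem_span_side z), basisProj_basis_of_pos (P := fun z => z ∉ Z₀) hz, basisMap_basis]
    | cons h l =>
      rw [H.tripleAction_cons_of_mem_other (List.isChain_cons_cons.1 hl).1 l c r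
        (basis_mem_span_side z), basisProj_basis_of_pos (P := fun z => z ∉ Z₀) hz, basisMap_basis]

end IsSideAction

/-! ### The operators on the two sides commute -/

/-- The reversal of triples. -/
noncomputable def tripleSwap (k Z : Type*) [Field k] :
    Module.End k ((List Z × Z × List Z) →₀ k) :=
  Finsupp.lmapDomain k k fun x => (x.2.2, x.2.1, x.1)

theorem tripleSwap_single (x : List Z × Z × List Z) :
    tripleSwap k Z (Finsupp.single x 1) = Finsupp.single (x.2.2, x.2.1, x.1) 1 := by
  simp [tripleSwap, Finsupp.mapDomain_single]

theorem tripleSwap_mul_self : tripleSwap k Z * tripleSwap k Z = 1 := by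
  refine Finsupp.lhom_ext' fun x => LinearMap.ext_ring ?_
  simp [tripleSwap_single]

theorem tripleSwap_tripleSwap (x : (List Z × Z × List Z) →₀ k) :
    tripleSwap k Z (tripleSwap k Z x) = x :=
  LinearMap.congr_fun tripleSwap_mul_self x

theorem tripleSwap_basisMap (l r : List Z) (v : E) :
    tripleSwap k Z (basisMap b (fun c => (l, c, r)) v) = basisMap b (fun c => (r, c, l)) v :=
  mapDomain_basisMap _ _ v

/-- The replacement of the first word of a triple by `l`. -/
noncomputable def replaceFst (k : Type*) {Z : Type*} [Field k] (l : List Z) :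
    Module.End k ((List Z × Z × List Z) →₀ k) :=
  Finsupp.lmapDomain k k fun x => (l, x.2)

theorem replaceFst_single (l : List Z) (x : List Z × Z × List Z) :
    replaceFst k l (Finsupp.single x 1) = Finsupp.single (l, x.2) 1 := by
  simp [replaceFst, Finsupp.mapDomain_single]

/-- The operators on the other side do not depend on the first word. -/
theorem replaceFst_commute (m : E →ₗ[k] E →ₗ[k] E) (v : E) (l : List Z) :
    Commute (tripleSwap k Z * tripleOp b σ Z₀ m v * tripleSwap k Z) (replaceFst k l) := by
  refine Finsupp.lhom_ext' fun x => LinearMap.ext_ring ?_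
  simp only [LinearMap.comp_apply, Finsupp.lsingle_apply, Module.End.mul_apply, replaceFst_single,
    tripleSwap_single, tripleOp_single]
  obtain ⟨l', c, _ | ⟨h, r⟩⟩ := x
  · simp only [tripleAction_nil, map_add, tripleSwap, replaceFst, mapDomain_basisMap]
  · simp only [tripleAction_cons, map_add, tripleSwap, replaceFst, mapDomain_basisMap]

/-- A combination of triples that differ only in the first word becomes a combination of replacement
operators applied to one triple. In this form commutation can be checked between operators. -/
theorem basisMap_eq_constr_replaceFst (g : Z → List Z) (x : List Z × Z × List Z) (v : E) :
    basisMap b (fun z => (g z, x.2)) v =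
      b.constr k (fun z => replaceFst k (g z)) v (Finsupp.single x 1) := by
  have : basisMap b (fun z => (g z, x.2)) =
      (b.constr k fun z => replaceFst k (g z)).flip (Finsupp.single x 1) := by
    refine b.ext fun z => ?_
    rw [LinearMap.flip_apply, b.constr_basis, replaceFst_single, basisMap_basis]
  rw [this, LinearMap.flip_apply]

/-- On triples with a nonempty first word the operators only replace this word. -/
theorem exists_tripleOp_comp_replaceFst (m : E →ₗ[k] E →ₗ[k] E) (v : E) (h : Z) (l : List Z) :
    ∃ Y : Module.End k ((List Z × Z × List Z) →₀ k),
      tripleOp b σ Z₀ m v * replaceFst k (h :: l) = Y ∧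
      ∀ R : Module.End k ((List Z × Z × List Z) →₀ k),
        (∀ l', Commute R (replaceFst k l')) → Commute R Y := by
  -- Commutation with each replacement operator extends by linearity to all their combinations.
  have hc (R : Module.End k ((List Z × Z × List Z) →₀ k))
      (hR : ∀ l', Commute R (replaceFst k l')) (g : Z → List Z) (w : E) :
      Commute R (b.constr k (fun z => replaceFst k (g z)) w) := by
    have : LinearMap.mulLeft k R ∘ₗ b.constr k (fun z => replaceFst k (g z)) =
        LinearMap.mulRight k R ∘ₗ b.constr k (fun z => replaceFst k (g z)) := by
      refine b.ext fun z => ?_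
      simp only [LinearMap.comp_apply, b.constr_basis, LinearMap.mulLeft_apply,
        LinearMap.mulRight_apply]
      exact hR _
    exact LinearMap.congr_fun this w
  refine ⟨b.constr k (fun z => replaceFst k (z :: l)) (basisProj b (fun z => z ∉ Z₀) (m v (b h))) +
    b.constr k (fun z => replaceFst k (z :: h :: l))
      (basisProj b (fun z => z ∉ Z₀ ∧ ¬ (σ z ↔ σ h)) v), ?_, fun R hR =>
    (hc R hR _ _).add_right (hc R hR _ _)⟩
  refine Finsupp.lhom_ext' fun x => LinearMap.ext_ring ?_
  rw [LinearMap.comp_apply, LinearMap.comp_apply, Finsupp.lsingle_apply, Module.End.mul_apply,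
    replaceFst_single, tripleOp_single, LinearMap.add_apply, ← basisMap_eq_constr_replaceFst,
    ← basisMap_eq_constr_replaceFst]
  exact tripleAction_cons _ _ _ _ _ _

/-- With a nonempty first word the left operator changes this word only, whereas the right operator
neither sees nor changes it. -/
theorem tripleOp_comm_of_cons (m m' : E →ₗ[k] E →ₗ[k] E) (v v' : E) (h : Z) (l : List Z)
    (x : Z × List Z) :
    tripleOp b σ Z₀ m v ((tripleSwap k Z * tripleOp b σ Z₀ m' v' * tripleSwap k Z)
        (Finsupp.single (h :: l, x) 1)) =
      (tripleSwap k Z * tripleOp b σ Z₀ m' v' * tripleSwap k Z)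
        (tripleOp b σ Z₀ m v (Finsupp.single (h :: l, x) 1)) := by
  obtain ⟨Y, hY, hYR⟩ := exists_tripleOp_comp_replaceFst (b := b) (σ := σ) (Z₀ := Z₀) m v h l
  have hR := replaceFst_commute (b := b) (σ := σ) (Z₀ := Z₀) m' v'
  generalize tripleSwap k Z * tripleOp b σ Z₀ m' v' * tripleSwap k Z = R at *
  -- A triple is unchanged when its first word is replaced by itself; this produces the composite
  -- with `replaceFst` to which the description of the left operator applies.
  have e : (Finsupp.single (h :: l, x) 1 : (List Z × Z × List Z) →₀ k) =
      replaceFst k (h :: l) (Finsupp.single (h :: l, x) 1) := (replaceFst_single (h :: l) (h :: l, x)).symm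
  have h₁ := LinearMap.congr_fun (hR (h :: l)).eq (Finsupp.single (h :: l, x) 1)
  have h₂ := LinearMap.congr_fun (hYR R hR).eq (Finsupp.single (h :: l, x) 1)
  rw [← hY] at h₂
  simp only [Module.End.mul_apply] at h₁ h₂
  rw [e, h₁, h₂]

/-- Here both operators may reach the center. If both letters lie on its side, both multiply into it
and `hm` is needed; in the other three cases at least one letter is put beside the center,
independently of what the other operator does to it. -/
theorem IsSideAction.tripleOp_comm_nil {m m' : E →ₗ[k] E →ₗ[k] E} (H : IsSideAction b σ Z₀ m)
    (H' : IsSideAction b σ Z₀ m') (hm : ∀ u v w, m u (m' v w) = m' v (m u w)) {z z' : Z}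
    (hz : z ∉ Z₀) (hz' : z' ∉ Z₀) (c : Z) :
    tripleOp b σ Z₀ m (b z) (tripleSwap k Z (tripleOp b σ Z₀ m' (b z')
        (basisMap b (fun c => ([], c, [])) (b c)))) =
      tripleSwap k Z (tripleOp b σ Z₀ m' (b z') (tripleSwap k Z (tripleOp b σ Z₀ m (b z)
        (basisMap b (fun c => ([], c, [])) (b c))))) := by
  have hc := basis_mem_span_side (b := b) (σ := σ) c
  by_cases h : σ z ↔ σ c <;> by_cases h' : σ z' ↔ σ c
  · have s₁ : {w | σ w ↔ σ z} = {w | σ w ↔ σ c} := by simp only [h]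
    have s₂ : {w | σ w ↔ σ z'} = {w | σ w ↔ σ c} := by simp only [h']
    have h₁ := H.mem_side z c
    have h₂ := H'.mem_side z' c
    rw [s₁, ← s₂] at h₁
    rw [s₂, ← s₁] at h₂
    have e₁ := H.tripleOp_basisMap_nil z [] (w := b c) (by rwa [s₁])
    have e₂ := H'.tripleOp_basisMap_nil z' [] (w := b c) (by rwa [s₂])
    rw [e₁, e₂, tripleSwap_basisMap, tripleSwap_basisMap, H.tripleOp_basisMap_nil z [] h₂,
      H'.tripleOp_basisMap_nil z' [] h₁, tripleSwap_basisMap, hm]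
  · have s₁ : {w | σ w ↔ σ z} = {w | σ w ↔ σ c} := by simp only [h]
    have h₁ := H.mem_side z c
    have hc' := hc
    rw [s₁] at h₁
    rw [← s₁] at hc'
    rw [H.tripleOp_basisMap_nil z [] hc', H'.tripleOp_basisMap_nil_of_mem_other hz' h' [] hc,
      tripleSwap_basisMap, tripleSwap_basisMap, H.tripleOp_basisMap_nil z [z'] hc',
      H'.tripleOp_basisMap_nil_of_mem_other hz' h' [] h₁, tripleSwap_basisMap]
  · have s₂ : {w | σ w ↔ σ z'} = {w | σ w ↔ σ c} := by simp only [h']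
    have h₂ := H'.mem_side z' c
    have hc' := hc
    rw [s₂] at h₂
    rw [← s₂] at hc'
    rw [H.tripleOp_basisMap_nil_of_mem_other hz h [] hc, H'.tripleOp_basisMap_nil z' [] hc',
      tripleSwap_basisMap, tripleSwap_basisMap, H'.tripleOp_basisMap_nil z' [z] hc',
      H.tripleOp_basisMap_nil_of_mem_other hz h [] h₂, tripleSwap_basisMap]
  · rw [H.tripleOp_basisMap_nil_of_mem_other hz h [] hc,
      H'.tripleOp_basisMap_nil_of_mem_other hz' h' [] hc, tripleSwap_basisMap,
      tripleSwap_basisMap, H.tripleOp_basisMap_nil_of_mem_other hz h [z'] hc,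
      H'.tripleOp_basisMap_nil_of_mem_other hz' h' [z] hc, tripleSwap_basisMap]

theorem IsSideAction.commute {m m' : E →ₗ[k] E →ₗ[k] E} (H : IsSideAction b σ Z₀ m)
    (H' : IsSideAction b σ Z₀ m') (hm : ∀ u v w, m u (m' v w) = m' v (m u w)) (z z' : Z) :
    Commute (tripleOp b σ Z₀ m (b z))
      (tripleSwap k Z * tripleOp b σ Z₀ m' (b z') * tripleSwap k Z) := by
  by_cases hz : z ∈ Z₀
  · rw [H.tripleOp_eq_zero_of_mem (Submodule.subset_span ⟨z, hz, rfl⟩)]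
    exact Commute.zero_left _
  by_cases hz' : z' ∈ Z₀
  · rw [H'.tripleOp_eq_zero_of_mem (Submodule.subset_span ⟨z', hz', rfl⟩), mul_zero, zero_mul]
    exact Commute.zero_right _
  refine Finsupp.lhom_ext' fun x => LinearMap.ext_ring ?_
  simp only [LinearMap.comp_apply, Finsupp.lsingle_apply, Module.End.mul_apply]
  obtain ⟨_ | ⟨h, l⟩, c, r⟩ := x
  · rcases r with _ | ⟨h, r⟩
    · rw [tripleSwap_single, ← basisMap_basis (b := b) (fun c => (([] : List Z), c, ([] : List Z)))]
      exact H.tripleOp_comm_nil H' hm hz hz' c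
    -- If only the right-hand word is nonempty, reversal of triples exchanges the roles of the two
    -- operators.
    · have := tripleOp_comm_of_cons (b := b) (σ := σ) (Z₀ := Z₀) m' m (b z') (b z) h r (c, [])
      simp only [Module.End.mul_apply, tripleSwap_single] at this
      rw [tripleSwap_single, this, tripleSwap_tripleSwap]
  · exact tripleOp_comm_of_cons m m' (b z) (b z') h l (c, r)

end Operators

/-! ### The two actions of the free dialgebra and the normal form map -/

section NormalForm

variable {k Z E : Type*} [Field k] [AddCommGroup E] [Module k E] [Dialgebra k E]
  {b : Module.Basis Z k E} {σ : Z → Prop} {Z₀ : Set Z}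

theorem IsSplitBasis.isSideAction_vdash (H : IsSplitBasis b σ Z₀) :
    IsSideAction b σ Z₀ (Dialgebra.vdashₗ k E) where
  eq_zero := H.vdash_eq_zero
  mem_side := H.vdash_mem
  mem_of_mem v w hw := H.isIdeal.vdash_left v w hw
  eq_zero_of_mem _ hv w := H.vdash_eq_zero_of_mem hv w
  assoc := Dialgebra.vdash_assoc (k := k)

/-- Right multiplication w ↦ w ⊣ v is a left action of the opposite multiplication, so the
right-hand operators are the left-hand ones conjugated by the reversal of triples. -/
theorem IsSplitBasis.isSideAction_dashv (H : IsSplitBasis b σ Z₀) :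
    IsSideAction b σ Z₀ (Dialgebra.dashvₗ k E).flip where
  eq_zero z z' h := H.dashv_eq_zero z' z fun h' => h h'.symm
  mem_side z z' := H.dashv_mem' z' z
  mem_of_mem v w hw := H.isIdeal.dashv_right v w hw
  eq_zero_of_mem _ hv w := H.dashv_eq_zero_of_mem hv w
  assoc u v w := (Dialgebra.dashv_assoc (k := k) w v u).symm

variable (b σ Z₀)

/-- The action of a word from the left on triples. -/
noncomputable def wordOpLeft (l : List Z) : Module.End k ((List Z × Z × List Z) →₀ k) :=
  (l.map fun z => tripleOp b σ Z₀ (Dialgebra.vdashₗ k E) (b z)).prod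

/-- The action of an element from the right on triples. -/
noncomputable def tripleOpRight (v : E) : Module.End k ((List Z × Z × List Z) →₀ k) :=
  tripleSwap k Z * tripleOp b σ Z₀ (Dialgebra.dashvₗ k E).flip v * tripleSwap k Z

/-- The action of a word from the right on triples. -/
noncomputable def wordOpRight (l : List Z) : Module.End k ((List Z × Z × List Z) →₀ k) :=
  (l.reverse.map fun z => tripleOpRight b σ Z₀ (b z)).prod

/-- The action of the free dialgebra from the left on triples. -/
noncomputable def leftRep :
    FreeDialgebra k Z →ₗ[k] Module.End k ((List Z × Z × List Z) →₀ k) :=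
  Finsupp.linearCombination k fun u => wordOpLeft b σ Z₀ u.word

/-- The action of the free dialgebra from the right on triples. -/
noncomputable def rightRep :
    FreeDialgebra k Z →ₗ[k] Module.End k ((List Z × Z × List Z) →₀ k) :=
  Finsupp.linearCombination k fun u => wordOpRight b σ Z₀ u.word

/-- The normal form of an element of the free dialgebra. -/
noncomputable def normalForm : FreeDialgebra k Z →ₗ[k] (List Z × Z × List Z) →₀ k :=
  Finsupp.linearCombination k fun u => wordOpLeft b σ Z₀ u.left
    (wordOpRight b σ Z₀ u.right (Finsupp.single ([], u.center, []) 1))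

variable {b σ Z₀}

theorem wordOpLeft_append (l l' : List Z) :
    wordOpLeft b σ Z₀ (l ++ l') = wordOpLeft b σ Z₀ l * wordOpLeft b σ Z₀ l' := by
  simp [wordOpLeft]

theorem wordOpRight_append (l l' : List Z) :
    wordOpRight b σ Z₀ (l ++ l') = wordOpRight b σ Z₀ l' * wordOpRight b σ Z₀ l := by
  simp [wordOpRight]

theorem wordOpLeft_singleton (z : Z) :
    wordOpLeft b σ Z₀ [z] = tripleOp b σ Z₀ (Dialgebra.vdashₗ k E) (b z) := by
  simp [wordOpLeft]

theorem wordOpRight_singleton (z : Z) :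
    wordOpRight b σ Z₀ [z] = tripleOpRight b σ Z₀ (b z) := by
  simp [wordOpRight]

/-- The reversals between neighbouring factors cancel in pairs, leaving one conjugation of the whole
product. -/
theorem wordOpRight_eq (l : List Z) : wordOpRight b σ Z₀ l = tripleSwap k Z *
    (l.reverse.map fun z => tripleOp b σ Z₀ (Dialgebra.dashvₗ k E).flip (b z)).prod *
    tripleSwap k Z := by
  rw [wordOpRight]
  induction l.reverse with
  | nil => simp [tripleSwap_mul_self]
  | cons z l ih =>
    rw [List.map_cons, List.map_cons, List.prod_cons, List.prod_cons, ih, tripleOpRight]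
    simp only [mul_assoc]
    rw [← mul_assoc (tripleSwap k Z) (tripleSwap k Z), tripleSwap_mul_self, one_mul]

@[simp] theorem leftRep_of (u : Diword Z) :
    leftRep b σ Z₀ (of k u) = wordOpLeft b σ Z₀ u.word := by
  simp [leftRep, of]

@[simp] theorem rightRep_of (u : Diword Z) :
    rightRep b σ Z₀ (of k u) = wordOpRight b σ Z₀ u.word := by
  simp [rightRep, of]

@[simp] theorem normalForm_of (u : Diword Z) :
    normalForm b σ Z₀ (of k u) = wordOpLeft b σ Z₀ u.left
      (wordOpRight b σ Z₀ u.right (Finsupp.single ([], u.center, []) 1)) := by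
  simp [normalForm, of]

/-- Both actions depend only on the underlying word, so ⊢ and ⊣ alike become composition of
operators, in reversed order for the right action. -/
theorem leftRep_vdash (f g : FreeDialgebra k Z) :
    leftRep b σ Z₀ (f ⊢ᵈ g) = leftRep b σ Z₀ f * leftRep b σ Z₀ g := by
  have h := bilin_hom Diword.vdash (LinearMap.mul k (Module.End k ((List Z × Z × List Z) →₀ k)))
    (leftRep b σ Z₀) (leftRep b σ Z₀) (leftRep b σ Z₀) fun u v => by
      rw [leftRep_of, leftRep_of, leftRep_of, LinearMap.mul_apply', ← wordOpLeft_append]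
      simp [Diword.vdash, Diword.word]
  exact h f g

theorem leftRep_dashv (f g : FreeDialgebra k Z) :
    leftRep b σ Z₀ (f ⊣ᵈ g) = leftRep b σ Z₀ f * leftRep b σ Z₀ g := by
  have h := bilin_hom Diword.dashv (LinearMap.mul k (Module.End k ((List Z × Z × List Z) →₀ k)))
    (leftRep b σ Z₀) (leftRep b σ Z₀) (leftRep b σ Z₀) fun u v => by
      rw [leftRep_of, leftRep_of, leftRep_of, LinearMap.mul_apply', ← wordOpLeft_append]
      simp [Diword.dashv, Diword.word]
  exact h f g

theorem rightRep_vdash (f g : FreeDialgebra k Z) :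
    rightRep b σ Z₀ (f ⊢ᵈ g) = rightRep b σ Z₀ g * rightRep b σ Z₀ f := by
  have h := bilin_hom Diword.vdash (LinearMap.mul k (Module.End k ((List Z × Z × List Z) →₀ k))).flip
    (rightRep b σ Z₀) (rightRep b σ Z₀) (rightRep b σ Z₀) fun u v => by
      rw [rightRep_of, rightRep_of, rightRep_of, LinearMap.flip_apply, LinearMap.mul_apply', ← wordOpRight_append]
      simp [Diword.vdash, Diword.word]
  exact h f g

theorem rightRep_dashv (f g : FreeDialgebra k Z) :
    rightRep b σ Z₀ (f ⊣ᵈ g) = rightRep b σ Z₀ g * rightRep b σ Z₀ f := by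
  have h := bilin_hom Diword.dashv (LinearMap.mul k (Module.End k ((List Z × Z × List Z) →₀ k))).flip
    (rightRep b σ Z₀) (rightRep b σ Z₀) (rightRep b σ Z₀) fun u v => by
      rw [rightRep_of, rightRep_of, rightRep_of, LinearMap.flip_apply, LinearMap.mul_apply', ← wordOpRight_append]
      simp [Diword.dashv, Diword.word]
  exact h f g

theorem normalForm_vdash (f g : FreeDialgebra k Z) :
    normalForm b σ Z₀ (f ⊢ᵈ g) = leftRep b σ Z₀ f (normalForm b σ Z₀ g) :=
  bilin_hom Diword.vdash (LinearMap.applyₗ (R := k)).flip _ _ _ (fun u v => by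
    rw [LinearMap.flip_apply, LinearMap.applyₗ_apply_apply, leftRep_of, normalForm_of,
      normalForm_of, ← Module.End.mul_apply (wordOpLeft b σ Z₀ u.word), ← wordOpLeft_append]
    rfl) f g

theorem IsSplitBasis.commute_wordOp (H : IsSplitBasis b σ Z₀) (l r : List Z) :
    Commute (wordOpLeft b σ Z₀ l) (wordOpRight b σ Z₀ r) := by
  refine Commute.list_prod_left _ _ fun x hx => Commute.list_prod_right _ _ fun y hy => ?_
  obtain ⟨z, -, rfl⟩ := List.mem_map.1 hx
  obtain ⟨z', -, rfl⟩ := List.mem_map.1 hy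
  exact H.isSideAction_vdash.commute H.isSideAction_dashv
    (fun u v w => Dialgebra.vdash_dashv (k := k) u w v) z z'

/-- The word of the second factor acts from the right after the left-hand word of the first one has
acted, whereas the normal form applies all right operators first. Commutation of the two actions
repairs the order; for ⊢ no such exchange is needed. -/
theorem IsSplitBasis.normalForm_dashv (H : IsSplitBasis b σ Z₀) (f g : FreeDialgebra k Z) :
    normalForm b σ Z₀ (f ⊣ᵈ g) = rightRep b σ Z₀ g (normalForm b σ Z₀ f) :=
  bilin_hom Diword.dashv (LinearMap.applyₗ (R := k)) _ _ _ (fun u v => by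
    rw [LinearMap.applyₗ_apply_apply, rightRep_of, normalForm_of, normalForm_of,
      ← Module.End.mul_apply (wordOpRight _ _ _ _), ← (H.commute_wordOp _ _).eq,
      Module.End.mul_apply, ← Module.End.mul_apply (wordOpRight _ _ _ _), ← wordOpRight_append]
    rfl) f g

theorem leftRep_expand (v : E) :
    leftRep b σ Z₀ (expand b id v) = tripleOp b σ Z₀ (Dialgebra.vdashₗ k E) v := by
  have : leftRep b σ Z₀ ∘ₗ expand b id = tripleOp b σ Z₀ (Dialgebra.vdashₗ k E) :=
    b.ext fun z => by
      rw [LinearMap.comp_apply, expand_basis, gen, leftRep_of]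
      exact wordOpLeft_singleton z
  exact LinearMap.congr_fun this v

theorem rightRep_expand (v : E) :
    rightRep b σ Z₀ (expand b id v) = tripleOpRight b σ Z₀ v := by
  have : rightRep b σ Z₀ ∘ₗ expand b id =
      LinearMap.mulLeft k (tripleSwap k Z) ∘ₗ LinearMap.mulRight k (tripleSwap k Z) ∘ₗ
        tripleOp b σ Z₀ (Dialgebra.dashvₗ k E).flip :=
    b.ext fun z => by
      rw [LinearMap.comp_apply, expand_basis, gen, rightRep_of]
      exact (wordOpRight_singleton z).trans (mul_assoc _ _ _)
  exact (LinearMap.congr_fun this v).trans (mul_assoc _ _ _).symm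

theorem normalForm_expand (v : E) :
    normalForm b σ Z₀ (expand b id v) = basisMap b (fun c => ([], c, [])) v := by
  have : normalForm b σ Z₀ ∘ₗ expand b id = basisMap b (fun c => ([], c, [])) :=
    b.ext fun z => by
      rw [LinearMap.comp_apply, expand_basis, gen, normalForm_of, basisMap_basis]
      rfl
  exact LinearMap.congr_fun this v

variable (b σ Z₀) in
/-- The common kernel of the two actions and of the normal form. -/
noncomputable def normalFormKer : Submodule k (FreeDialgebra k Z) :=
  LinearMap.ker (leftRep b σ Z₀) ⊓ LinearMap.ker (rightRep b σ Z₀) ⊓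
    LinearMap.ker (normalForm b σ Z₀)

theorem mem_normalFormKer {f : FreeDialgebra k Z} : f ∈ normalFormKer b σ Z₀ ↔
    (leftRep b σ Z₀ f = 0 ∧ rightRep b σ Z₀ f = 0) ∧ normalForm b σ Z₀ f = 0 := Iff.rfl

/-! ### The kernel of the normal form and the independence of irreducible diwords -/

namespace IsSplitBasis

variable (H : IsSplitBasis b σ Z₀)

include H

/-- The normal form of x ⊢ a is the left action of x on the normal form of a, so its vanishing for
all a uses that x acts as zero; the same holds for a ⊣ x and the right action. Hence all three
kernels enter. -/
theorem isDialgebraIdeal_normalFormKer : IsDialgebraIdeal k (normalFormKer b σ Z₀) where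
  vdash_left a x hx := by
    rw [mem_normalFormKer] at hx ⊢
    rw [leftRep_vdash, rightRep_vdash, normalForm_vdash, hx.1.1, hx.1.2, hx.2, map_zero, mul_zero,
      zero_mul]
    exact ⟨⟨rfl, rfl⟩, rfl⟩
  vdash_right a x hx := by
    rw [mem_normalFormKer] at hx ⊢
    rw [leftRep_vdash, rightRep_vdash, normalForm_vdash, hx.1.1, hx.1.2, LinearMap.zero_apply,
      mul_zero, zero_mul]
    exact ⟨⟨rfl, rfl⟩, rfl⟩
  dashv_left a x hx := by
    rw [mem_normalFormKer] at hx ⊢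
    rw [leftRep_dashv, rightRep_dashv, H.normalForm_dashv, hx.1.1, hx.1.2, LinearMap.zero_apply,
      mul_zero, zero_mul]
    exact ⟨⟨rfl, rfl⟩, rfl⟩
  dashv_right a x hx := by
    rw [mem_normalFormKer] at hx ⊢
    rw [leftRep_dashv, rightRep_dashv, H.normalForm_dashv, hx.1.1, hx.1.2, hx.2, map_zero,
      mul_zero, zero_mul]
    exact ⟨⟨rfl, rfl⟩, rfl⟩

theorem tripleOp_vdash_eq (z z' : Z) (h : VdashReducible σ Z₀ z z') :
    tripleOp b σ Z₀ (Dialgebra.vdashₗ k E) (b z) * tripleOp b σ Z₀ (Dialgebra.vdashₗ k E) (b z') =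
      tripleOp b σ Z₀ (Dialgebra.vdashₗ k E) (b z ⊢ᵈ b z') := by
  rcases h with h | h
  · exact H.isSideAction_vdash.tripleOp_mul h
  · have hz : b z ∈ Submodule.span k (b '' Z₀) := Submodule.subset_span ⟨z, h, rfl⟩
    rw [H.isSideAction_vdash.tripleOp_eq_zero_of_mem hz, H.vdash_eq_zero_of_mem hz, map_zero,
      zero_mul]

theorem tripleOp_dashv_eq (z z' : Z) (h : DashvReducible σ Z₀ z z') :
    tripleOp b σ Z₀ (Dialgebra.dashvₗ k E).flip (b z') *
        tripleOp b σ Z₀ (Dialgebra.dashvₗ k E).flip (b z) =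
      tripleOp b σ Z₀ (Dialgebra.dashvₗ k E).flip (b z ⊣ᵈ b z') := by
  rcases h with h | h
  · exact H.isSideAction_dashv.tripleOp_mul h.symm
  · have hz : b z' ∈ Submodule.span k (b '' Z₀) := Submodule.subset_span ⟨z', h, rfl⟩
    rw [H.isSideAction_dashv.tripleOp_eq_zero_of_mem hz, H.dashv_eq_zero_of_mem hz, map_zero,
      zero_mul]

/-- The two products differ by an element of the span of Z₀, which acts as zero. -/
theorem tripleOp_vdash_eq_dashv (z z' : Z) {m : E →ₗ[k] E →ₗ[k] E}
    (hm : IsSideAction b σ Z₀ m) :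
    tripleOp b σ Z₀ m (b z ⊢ᵈ b z') = tripleOp b σ Z₀ m (b z ⊣ᵈ b z') := by
  have := hm.tripleOp_eq_zero_of_mem (H.bar_mem z z')
  rw [map_sub, sub_eq_zero] at this
  exact this.symm

/-- The left action has to respect relations of both kinds. The new case is z' in Z₀, where z' acts
as zero and so does z ⊢ z', which lies in the ideal spanned by Z₀. -/
theorem tripleOp_mul_eq_vdash (z z' : Z)
    (h : VdashReducible σ Z₀ z z' ∨ DashvReducible σ Z₀ z z') :
    tripleOp b σ Z₀ (Dialgebra.vdashₗ k E) (b z) * tripleOp b σ Z₀ (Dialgebra.vdashₗ k E) (b z') =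
      tripleOp b σ Z₀ (Dialgebra.vdashₗ k E) (b z ⊢ᵈ b z') := by
  rcases h with h | h | h
  · exact H.tripleOp_vdash_eq z z' h
  · exact H.tripleOp_vdash_eq z z' (Or.inl h)
  · have hz : b z' ∈ Submodule.span k (b '' Z₀) := Submodule.subset_span ⟨z', h, rfl⟩
    rw [H.isSideAction_vdash.tripleOp_eq_zero_of_mem hz,
      H.isSideAction_vdash.tripleOp_eq_zero_of_mem (H.isIdeal.vdash_left _ _ hz), mul_zero]

theorem tripleOp_mul_eq_dashv (z z' : Z)
    (h : VdashReducible σ Z₀ z z' ∨ DashvReducible σ Z₀ z z') :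
    tripleOp b σ Z₀ (Dialgebra.dashvₗ k E).flip (b z') *
        tripleOp b σ Z₀ (Dialgebra.dashvₗ k E).flip (b z) =
      tripleOp b σ Z₀ (Dialgebra.dashvₗ k E).flip (b z ⊣ᵈ b z') := by
  rcases h with (h | h) | h
  · exact H.tripleOp_dashv_eq z z' (Or.inl h)
  · have hz : b z ∈ Submodule.span k (b '' Z₀) := Submodule.subset_span ⟨z, h, rfl⟩
    rw [H.isSideAction_dashv.tripleOp_eq_zero_of_mem hz,
      H.isSideAction_dashv.tripleOp_eq_zero_of_mem (H.isIdeal.dashv_right _ _ hz), mul_zero]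
  · exact H.tripleOp_dashv_eq z z' h

omit H in
theorem tripleOpRight_mul (v w : E) : tripleOpRight b σ Z₀ v * tripleOpRight b σ Z₀ w =
    tripleSwap k Z * (tripleOp b σ Z₀ (Dialgebra.dashvₗ k E).flip v *
      tripleOp b σ Z₀ (Dialgebra.dashvₗ k E).flip w) * tripleSwap k Z := by
  simp only [tripleOpRight, mul_assoc]
  rw [← mul_assoc (tripleSwap k Z) (tripleSwap k Z), tripleSwap_mul_self, one_mul]

theorem splitRelations_subset_normalFormKer :
    splitRelations b σ Z₀ ⊆ (normalFormKer b σ Z₀ : Set (FreeDialgebra k Z)) := by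
  rintro _ (⟨z, z', h, rfl⟩ | ⟨z, z', h, rfl⟩)
  · refine mem_normalFormKer.2 ⟨⟨?_, ?_⟩, ?_⟩
    · rw [vdashDefect_apply, map_sub, leftRep_vdash, leftRep_expand, leftRep_expand,
        leftRep_expand, H.tripleOp_mul_eq_vdash z z' (Or.inl h), sub_self]
    · rw [vdashDefect_apply, map_sub, rightRep_vdash, rightRep_expand, rightRep_expand,
        rightRep_expand, tripleOpRight_mul, H.tripleOp_mul_eq_dashv z z' (Or.inl h), tripleOpRight,
        H.tripleOp_vdash_eq_dashv z z' H.isSideAction_dashv, sub_self]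
    · rw [vdashDefect_apply, map_sub, normalForm_vdash, leftRep_expand, normalForm_expand,
        normalForm_expand]
      rcases h with h | h
      · rw [H.isSideAction_vdash.tripleOp_basisMap_nil z []
          (Submodule.subset_span ⟨z', h.symm, rfl⟩)]
        exact sub_self _
      · have hz : b z ∈ Submodule.span k (b '' Z₀) := Submodule.subset_span ⟨z, h, rfl⟩
        rw [H.isSideAction_vdash.tripleOp_eq_zero_of_mem hz, H.vdash_eq_zero_of_mem hz, map_zero,
          LinearMap.zero_apply, sub_zero]
  · refine mem_normalFormKer.2 ⟨⟨?_, ?_⟩, ?_⟩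
    · rw [dashvDefect_apply, map_sub, leftRep_dashv, leftRep_expand, leftRep_expand,
        leftRep_expand, H.tripleOp_mul_eq_vdash z z' (Or.inr h),
        H.tripleOp_vdash_eq_dashv z z' H.isSideAction_vdash, sub_self]
    · rw [dashvDefect_apply, map_sub, rightRep_dashv, rightRep_expand, rightRep_expand,
        rightRep_expand, tripleOpRight_mul, H.tripleOp_mul_eq_dashv z z' (Or.inr h), tripleOpRight,
        sub_self]
    · rw [dashvDefect_apply, map_sub, H.normalForm_dashv, rightRep_expand, normalForm_expand,
        normalForm_expand, tripleOpRight, Module.End.mul_apply, Module.End.mul_apply,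
        tripleSwap_basisMap]
      rcases h with h | h
      · rw [H.isSideAction_dashv.tripleOp_basisMap_nil z' []
          (Submodule.subset_span ⟨z, h, rfl⟩), tripleSwap_basisMap]
        exact sub_self _
      · have hz : b z' ∈ Submodule.span k (b '' Z₀) := Submodule.subset_span ⟨z', h, rfl⟩
        rw [H.isSideAction_dashv.tripleOp_eq_zero_of_mem hz, H.dashv_eq_zero_of_mem hz, map_zero,
          LinearMap.zero_apply, sub_zero, map_zero]

theorem dialgebraIdeal_le_ker_normalForm :
    dialgebraIdeal k (splitRelations b σ Z₀) ≤ LinearMap.ker (normalForm b σ Z₀) :=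
  (dialgebraIdeal_le k H.isDialgebraIdeal_normalFormKer
    H.splitRelations_subset_normalFormKer).trans inf_le_right

/-- In an alternating diword each operator finds a letter of the other side on top and simply
prepends its own. On the right the letters are attached from the center outwards, so the outermost
one comes first and the word appears reversed. -/
theorem normalForm_of_mem_splitDiwords {u : Diword Z} (hu : u ∈ splitDiwords σ Z₀) :
    normalForm b σ Z₀ (of k u) = Finsupp.single (u.left, u.center, u.right.reverse) 1 := by
  obtain ⟨h₀, hc⟩ := hu
  obtain ⟨hl, hr⟩ := List.isChain_split.1 hc
  rw [normalForm_of, wordOpRight_eq, Module.End.mul_apply, Module.End.mul_apply,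
    tripleSwap_single, H.isSideAction_dashv.prod_tripleOp_apply, tripleSwap_single,
    wordOpLeft, H.isSideAction_vdash.prod_tripleOp_apply _ hl]
  · exact fun z hz => h₀ z (List.mem_append_left _ hz)
  · exact fun z hz => h₀ z (List.mem_append_right _ (List.mem_reverse.1 hz))
  · rw [← List.reverse_cons, List.isChain_reverse]
    exact hr.imp fun x y h h' => h h'.symm

/-- The classes of the irreducible diwords form a basis of the quotient. -/
theorem exists_basis_irr [LinearOrder Z] {S : Set (FreeDialgebra k Z)}
    (hS : S = splitRelations b σ Z₀) {A : Submodule k (FreeDialgebra k Z)}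
    (hA : dialgebraIdeal k S = A) :
    ∃ B : Module.Basis (Irr S) k (FreeDialgebra k Z ⧸ A), ∀ u, B u = A.mkQ (of k u) := by
  subst hS hA
  have hli : LinearIndependent k fun u : Irr (splitRelations b σ Z₀) =>
      (dialgebraIdeal k (splitRelations b σ Z₀)).mkQ (of k u) := by
    -- The normal form descends to the quotient and sends the classes to distinct basis vectors of
    -- the space of triples, so independence there suffices.
    refine LinearIndependent.of_comp
      (Submodule.liftQ _ (normalForm b σ Z₀) H.dialgebraIdeal_le_ker_normalForm) ?_
    have e : (Submodule.liftQ _ (normalForm b σ Z₀) H.dialgebraIdeal_le_ker_normalForm) ∘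
        (fun u : Irr (splitRelations b σ Z₀) =>
          (dialgebraIdeal k (splitRelations b σ Z₀)).mkQ (of k u)) =
        (fun x => Finsupp.single x (1 : k)) ∘ fun u : Irr (splitRelations b σ Z₀) =>
          (u.1.left, u.1.center, u.1.right.reverse) := by
      funext u
      refine (Submodule.liftQ_apply _ _ _).trans (H.normalForm_of_mem_splitDiwords ?_)
      rw [← irr_splitRelations (b := b)]
      exact u.2
    rw [e]
    refine (Finsupp.basisSingleOne (R := k)).linearIndependent.comp _ fun u v h => ?_
    simp only [Prod.mk.injEq, List.reverse_inj] at h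
    exact Subtype.ext (Diword.ext h.1 h.2.1 h.2.2)
  refine ⟨Module.Basis.mk hli ?_, fun u => Module.Basis.mk_apply _ _ u⟩
  have h : (⊤ : Submodule k (FreeDialgebra k Z)) ≤
      Submodule.span k (of k '' Irr (splitRelations b σ Z₀)) ⊔
        dialgebraIdeal k (splitRelations b σ Z₀) := by
    rw [← span_range_of, Submodule.span_le]
    rintro _ ⟨u, rfl⟩
    exact of_mem_span_irr_sup u
  -- Applying the quotient map to the spanning statement kills the ideal and leaves the classes of
  -- irreducible diwords.
  have h' := Submodule.map_mono (f := (dialgebraIdeal k (splitRelations b σ Z₀)).mkQ) h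
  rw [Submodule.map_sup, Submodule.mkQ_map_self, sup_bot_eq, Submodule.map_top,
    Submodule.range_mkQ, Submodule.map_span] at h'
  refine h'.trans (Submodule.span_mono ?_)
  rintro _ ⟨_, ⟨u, hu, rfl⟩, rfl⟩
  exact ⟨⟨u, hu⟩, rfl⟩

end IsSplitBasis

end NormalForm

/-! ### The presentation by multiplication tables -/

section Tables

variable {k D ι Z : Type*} [Field k] [AddCommGroup D] [Module k D] [Dialgebra k D]

omit [Dialgebra k D] in
theorem expand_apply_basis (B : Module.Basis ι k D) (φ : ι → Z) (i : ι) :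
    expand B φ (B i) = gen k (φ i) := by
  simp [expand]

/-- The homomorphism from a dialgebra to a quotient of the free dialgebra in which its
multiplication table holds. -/
noncomputable def tableHom (B : Module.Basis ι k D) (φ : ι → Z) {T : Set (FreeDialgebra k Z)}
    (hT : multTable B φ ⊆ T) : DialgebraHom k D (FreeDialgebra k Z ⧸ dialgebraIdeal k T) where
  toLinearMap := (dialgebraIdeal k T).mkQ ∘ₗ expand B φ
  map_vdash := by
    have h : (Dialgebra.vdashₗ k D).compr₂ ((dialgebraIdeal k T).mkQ ∘ₗ expand B φ) =
        (Dialgebra.vdashₗ k _).compl₁₂ ((dialgebraIdeal k T).mkQ ∘ₗ expand B φ)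
          ((dialgebraIdeal k T).mkQ ∘ₗ expand B φ) := by
      refine B.ext fun i => B.ext fun j => ?_
      simp only [LinearMap.compr₂_apply, LinearMap.compl₁₂_apply, Dialgebra.vdashₗ_apply,
        LinearMap.comp_apply, expand_apply_basis]
      refine ((Submodule.Quotient.eq _).2 ?_).symm
      exact subset_dialgebraIdeal k T (hT (Or.inl ⟨i, j, rfl⟩))
    exact LinearMap.congr_fun₂ h
  map_dashv := by
    have h : (Dialgebra.dashvₗ k D).compr₂ ((dialgebraIdeal k T).mkQ ∘ₗ expand B φ) =
        (Dialgebra.dashvₗ k _).compl₁₂ ((dialgebraIdeal k T).mkQ ∘ₗ expand B φ)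
          ((dialgebraIdeal k T).mkQ ∘ₗ expand B φ) := by
      refine B.ext fun i => B.ext fun j => ?_
      simp only [LinearMap.compr₂_apply, LinearMap.compl₁₂_apply, Dialgebra.dashvₗ_apply,
        LinearMap.comp_apply, expand_apply_basis]
      refine ((Submodule.Quotient.eq _).2 ?_).symm
      exact subset_dialgebraIdeal k T (hT (Or.inr ⟨i, j, rfl⟩))
    exact LinearMap.congr_fun₂ h

theorem tableHom_basis (B : Module.Basis ι k D) (φ : ι → Z) {T : Set (FreeDialgebra k Z)}
    (hT : multTable B φ ⊆ T) (i : ι) :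
    (tableHom B φ hT).toLinearMap (B i) = (dialgebraIdeal k T).mkQ (gen k (φ i)) :=
  congrArg _ (expand_apply_basis B φ i)

theorem DialgebraHom.map_multTable {E : Type*} [AddCommGroup E] [Module k E] [Dialgebra k E]
    (B : Module.Basis ι k D) (φ : ι → Z) (F : DialgebraHom k (FreeDialgebra k Z) E)
    (δ : DialgebraHom k D E) (h : ∀ i, F.toLinearMap (gen k (φ i)) = δ.toLinearMap (B i)) :
    multTable B φ ⊆ (LinearMap.ker F.toLinearMap : Set (FreeDialgebra k Z)) := by
  have h' (d : D) : F.toLinearMap (expand B φ d) = δ.toLinearMap d := by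
    have : F.toLinearMap ∘ₗ expand B φ = δ.toLinearMap :=
      B.ext fun i => by rw [LinearMap.comp_apply, expand_apply_basis, h]
    exact LinearMap.congr_fun this d
  rintro _ (⟨i, j, rfl⟩ | ⟨i, j, rfl⟩)
  · rw [SetLike.mem_coe, LinearMap.mem_ker, map_sub, F.map_vdash, h, h, h', δ.map_vdash, sub_self]
  · rw [SetLike.mem_coe, LinearMap.mem_ker, map_sub, F.map_dashv, h, h, h', δ.map_dashv, sub_self]

/-- A homomorphism that vanishes on `T` factors through the quotient by `Id(T)`. -/
def DialgebraHom.liftQuotient {E : Type*} [AddCommGroup E] [Module k E] [Dialgebra k E]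
    (F : DialgebraHom k D E) (T : Set D) (hT : T ⊆ (LinearMap.ker F.toLinearMap : Set D)) :
    DialgebraHom k (D ⧸ dialgebraIdeal k T) E where
  toLinearMap := Submodule.liftQ _ F.toLinearMap (dialgebraIdeal_le k F.isDialgebraIdeal_ker hT)
  map_vdash := by
    rintro ⟨a⟩ ⟨b⟩
    exact F.map_vdash a b
  map_dashv := by
    rintro ⟨a⟩ ⟨b⟩
    exact F.map_dashv a b

end Tables

/-! ### The universal property of the presentation by tables -/

section FreeProductPresentation

variable {k D₁ D₂ I J : Type*} [Field k]
  [AddCommGroup D₁] [Module k D₁] [Dialgebra k D₁]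
  [AddCommGroup D₂] [Module k D₂] [Dialgebra k D₂]

/-- A pair of homomorphisms from D₁ and D₂ amounts to a substitution for the letters under which
both multiplication tables hold. Its extension to the free dialgebra kills the tables and therefore
factors through the quotient. -/
theorem isDialgebraFreeProduct_tableHom.{t} (B₁ : Module.Basis I k D₁) (B₂ : Module.Basis J k D₂) :
    IsDialgebraFreeProduct.{t}
      (tableHom B₁ Sum.inlₗ (Set.subset_union_left :
        _ ⊆ freeProductTables B₁ B₂))
      (tableHom B₂ Sum.inrₗ (Set.subset_union_right :
        _ ⊆ freeProductTables B₁ B₂)) := by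
  intro D _ _ _ δ₁ δ₂
  let g : I ⊕ₗ J → D :=
    fun z => Sum.elim (fun i => δ₁.toLinearMap (B₁ i)) (fun l => δ₂.toLinearMap (B₂ l)) (ofLex z)
  let F : DialgebraHom k (FreeDialgebra k (I ⊕ₗ J)) D := lift g
  have hT : freeProductTables B₁ B₂ ⊆ (LinearMap.ker F.toLinearMap :
      Set (FreeDialgebra k (I ⊕ₗ J))) := by
    refine Set.union_subset ?_ ?_
    · exact F.map_multTable B₁ Sum.inlₗ δ₁ fun i => lift_gen g (Sum.inlₗ i)
    · exact F.map_multTable B₂ Sum.inrₗ δ₂ fun l => lift_gen g (Sum.inrₗ l)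
  refine ⟨F.liftQuotient _ hT, ⟨B₁.ext fun i => ?_, B₂.ext fun l => ?_⟩, ?_⟩
  · rw [LinearMap.comp_apply, tableHom_basis]
    exact lift_gen g _
  · rw [LinearMap.comp_apply, tableHom_basis]
    exact lift_gen g _
  · rintro f ⟨h₁, h₂⟩
    -- For uniqueness the competing map is pulled back to the free dialgebra, where it is determined
    -- by its values on letters.
    let f' : DialgebraHom k (FreeDialgebra k (I ⊕ₗ J)) D :=
      ⟨f.toLinearMap ∘ₗ (dialgebraIdeal k (freeProductTables B₁ B₂)).mkQ,
        fun a b => f.map_vdash (Submodule.mkQ _ a) (Submodule.mkQ _ b),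
        fun a b => f.map_dashv (Submodule.mkQ _ a) (Submodule.mkQ _ b)⟩
    have hf : f' = lift g := by
      refine dialgebraHom_ext fun z => ?_
      rw [lift_gen]
      rcases z with i | l
      · have := LinearMap.congr_fun h₁ (B₁ i)
        rw [LinearMap.comp_apply, tableHom_basis] at this
        exact this
      · have := LinearMap.congr_fun h₂ (B₂ l)
        rw [LinearMap.comp_apply, tableHom_basis] at this
        exact this
    refine DialgebraHom.ext (Submodule.linearMap_qext _ ?_)
    have := congrArg DialgebraHom.toLinearMap hf
    exact this

/-! ### The direct product as a dialgebra with a split basis -/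

/-- The basis of `D₁ × D₂` indexed by the alphabet `X ∪ Y`. -/
noncomputable def prodBasis (B₁ : Module.Basis I k D₁) (B₂ : Module.Basis J k D₂) :
    Module.Basis (I ⊕ₗ J) k (D₁ × D₂) :=
  (B₁.prod B₂).reindex toLex

/-- The letters in `X₀ ∪ Y₀`. -/
def barLetters (I₀ : Set I) (J₀ : Set J) : Set (I ⊕ₗ J) :=
  Sum.inlₗ '' I₀ ∪ Sum.inrₗ '' J₀

variable (B₁ : Module.Basis I k D₁) (B₂ : Module.Basis J k D₂)

omit [Dialgebra k D₁] [Dialgebra k D₂] in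
theorem prodBasis_inl (i : I) : prodBasis B₁ B₂ (Sum.inlₗ i) = (B₁ i, 0) := by
  rw [prodBasis, Module.Basis.reindex_apply]
  exact Module.Basis.prod_apply B₁ B₂ (Sum.inl i)

omit [Dialgebra k D₁] [Dialgebra k D₂] in
theorem prodBasis_inr (l : J) : prodBasis B₁ B₂ (Sum.inrₗ l) = (0, B₂ l) := by
  rw [prodBasis, Module.Basis.reindex_apply]
  exact Module.Basis.prod_apply B₁ B₂ (Sum.inr l)

theorem isLetterX_inl (i : I) : IsLetterX (Sum.inlₗ i : I ⊕ₗ J) := ⟨i, rfl⟩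

theorem not_isLetterX_inr (l : J) : ¬ IsLetterX (Sum.inrₗ l : I ⊕ₗ J) := by
  rintro ⟨i, h⟩
  exact Sum.inr_ne_inl (toLex.injective h)

theorem inl_mem_barLetters {I₀ : Set I} {J₀ : Set J} {i : I} :
    (Sum.inlₗ i : I ⊕ₗ J) ∈ barLetters I₀ J₀ ↔ i ∈ I₀ := by
  constructor
  · rintro (⟨i', h, e⟩ | ⟨l, -, e⟩)
    · rwa [← Sum.inl_injective (toLex.injective e)]
    · exact (Sum.inr_ne_inl (toLex.injective e)).elim
  · exact fun h => Or.inl ⟨i, h, rfl⟩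

theorem inr_mem_barLetters {I₀ : Set I} {J₀ : Set J} {l : J} :
    (Sum.inrₗ l : I ⊕ₗ J) ∈ barLetters I₀ J₀ ↔ l ∈ J₀ := by
  constructor
  · rintro (⟨i, -, e⟩ | ⟨l', h, e⟩)
    · exact (Sum.inl_ne_inr (toLex.injective e)).elim
    · rwa [← Sum.inr_injective (toLex.injective e)]
  · exact fun h => Or.inr ⟨l, h, rfl⟩

theorem letter_cases {P : I ⊕ₗ J → Prop} (hl : ∀ i, P (Sum.inlₗ i)) (hr : ∀ l, P (Sum.inrₗ l))
    (z : I ⊕ₗ J) : P z :=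
  match z with
  | Sum.inl i => hl i
  | Sum.inr l => hr l

omit [Dialgebra k D₁] [Dialgebra k D₂] in
theorem expand_prodBasis_inl (d : D₁) :
    expand (prodBasis B₁ B₂) id (d, 0) = expand B₁ Sum.inlₗ d := by
  have : expand (prodBasis B₁ B₂) id ∘ₗ LinearMap.inl k D₁ D₂ = expand B₁ Sum.inlₗ :=
    B₁.ext fun i => by
      rw [LinearMap.comp_apply, LinearMap.inl_apply, ← prodBasis_inl B₁ B₂, expand_apply_basis,
        expand_apply_basis, id]
  exact LinearMap.congr_fun this d

omit [Dialgebra k D₁] [Dialgebra k D₂] in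
theorem expand_prodBasis_inr (d : D₂) :
    expand (prodBasis B₁ B₂) id (0, d) = expand B₂ Sum.inrₗ d := by
  have : expand (prodBasis B₁ B₂) id ∘ₗ LinearMap.inr k D₁ D₂ = expand B₂ Sum.inrₗ :=
    B₂.ext fun i => by
      rw [LinearMap.comp_apply, LinearMap.inr_apply, ← prodBasis_inr B₁ B₂, expand_apply_basis,
        expand_apply_basis, id]
  exact LinearMap.congr_fun this d

omit [Dialgebra k D₁] [Dialgebra k D₂] in
theorem span_prodBasis_image (s : Set I) (t : Set J) :
    Submodule.span k (prodBasis B₁ B₂ '' barLetters s t) =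
      (Submodule.span k (B₁ '' s)).prod (Submodule.span k (B₂ '' t)) := by
  rw [← LinearMap.span_inl_union_inr, barLetters, Set.image_union, Set.image_image,
    Set.image_image, Set.image_image, Set.image_image]
  simp only [prodBasis_inl, prodBasis_inr, LinearMap.inl_apply, LinearMap.inr_apply]

omit [Dialgebra k D₁] [Dialgebra k D₂] in
theorem inl_mem_span_prodBasis (d : D₁) :
    (d, 0) ∈ Submodule.span k (prodBasis B₁ B₂ '' {w | IsLetterX w}) := by
  have h : (d, (0 : D₂)) ∈ Submodule.span k (prodBasis B₁ B₂ '' barLetters Set.univ ∅) := by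
    rw [span_prodBasis_image, Set.image_univ, B₁.span_eq]
    exact ⟨trivial, zero_mem _⟩
  refine Submodule.span_mono (Set.image_mono ?_) h
  rintro _ (⟨i, -, rfl⟩ | ⟨l, h, -⟩)
  · exact isLetterX_inl i
  · exact h.elim

omit [Dialgebra k D₁] [Dialgebra k D₂] in
theorem inr_mem_span_prodBasis (d : D₂) :
    (0, d) ∈ Submodule.span k (prodBasis B₁ B₂ '' {w | ¬ IsLetterX w}) := by
  have h : ((0 : D₁), d) ∈ Submodule.span k (prodBasis B₁ B₂ '' barLetters ∅ Set.univ) := by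
    rw [span_prodBasis_image, Set.image_univ, B₂.span_eq]
    exact ⟨zero_mem _, trivial⟩
  refine Submodule.span_mono (Set.image_mono ?_) h
  rintro _ (⟨i, h, -⟩ | ⟨l, -, rfl⟩)
  · exact h.elim
  · exact not_isLetterX_inr l

theorem vdash_inl_inl (a b : D₁) : ((a, 0) : D₁ × D₂) ⊢ᵈ (b, 0) = (a ⊢ᵈ b, 0) :=
  Prod.ext rfl (Dialgebra.zero_vdash k 0)

theorem dashv_inl_inl (a b : D₁) : ((a, 0) : D₁ × D₂) ⊣ᵈ (b, 0) = (a ⊣ᵈ b, 0) :=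
  Prod.ext rfl (Dialgebra.zero_dashv k 0)

theorem vdash_inr_inr (a b : D₂) : ((0, a) : D₁ × D₂) ⊢ᵈ (0, b) = (0, a ⊢ᵈ b) :=
  Prod.ext (Dialgebra.zero_vdash k 0) rfl

theorem dashv_inr_inr (a b : D₂) : ((0, a) : D₁ × D₂) ⊣ᵈ (0, b) = (0, a ⊣ᵈ b) :=
  Prod.ext (Dialgebra.zero_dashv k 0) rfl

theorem vdash_inl_inr (a : D₁) (b : D₂) : ((a, 0) : D₁ × D₂) ⊢ᵈ (0, b) = 0 :=
  Prod.ext (Dialgebra.vdash_zero k a) (Dialgebra.zero_vdash k b)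

theorem dashv_inl_inr (a : D₁) (b : D₂) : ((a, 0) : D₁ × D₂) ⊣ᵈ (0, b) = 0 :=
  Prod.ext (Dialgebra.dashv_zero k a) (Dialgebra.zero_dashv k b)

theorem vdash_inr_inl (a : D₁) (b : D₂) : ((0, b) : D₁ × D₂) ⊢ᵈ (a, 0) = 0 :=
  Prod.ext (Dialgebra.zero_vdash k a) (Dialgebra.vdash_zero k b)

theorem dashv_inr_inl (a : D₁) (b : D₂) : ((0, b) : D₁ × D₂) ⊣ᵈ (a, 0) = 0 :=
  Prod.ext (Dialgebra.zero_dashv k a) (Dialgebra.dashv_zero k b)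

variable {B₁ B₂} {I₀ : Set I} {J₀ : Set J}

/-- The direct product serves as an auxiliary dialgebra only: its vanishing cross products make the
correction terms of mixed pairs zero, and its bar ideals are taken factor by factor. -/
theorem isSplitBasis_prodBasis (hI₀ : Submodule.span k (B₁ '' I₀) = barIdeal k D₁)
    (hJ₀ : Submodule.span k (B₂ '' J₀) = barIdeal k D₂) :
    IsSplitBasis (prodBasis B₁ B₂) IsLetterX (barLetters I₀ J₀) where
  vdash_eq_zero := by
    refine letter_cases (fun i => letter_cases (fun j h => ?_) fun l _ => ?_)
      (fun l => letter_cases (fun i _ => ?_) fun l' h => ?_)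
    · exact (h (iff_of_true (isLetterX_inl i) (isLetterX_inl j))).elim
    · rw [prodBasis_inl, prodBasis_inr]; exact vdash_inl_inr (k := k) _ _
    · rw [prodBasis_inl, prodBasis_inr]; exact vdash_inr_inl (k := k) _ _
    · exact (h (iff_of_false (not_isLetterX_inr l) (not_isLetterX_inr l'))).elim
  dashv_eq_zero := by
    refine letter_cases (fun i => letter_cases (fun j h => ?_) fun l _ => ?_)
      (fun l => letter_cases (fun i _ => ?_) fun l' h => ?_)
    · exact (h (iff_of_true (isLetterX_inl i) (isLetterX_inl j))).elim
    · rw [prodBasis_inl, prodBasis_inr]; exact dashv_inl_inr (k := k) _ _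
    · rw [prodBasis_inl, prodBasis_inr]; exact dashv_inr_inl (k := k) _ _
    · exact (h (iff_of_false (not_isLetterX_inr l) (not_isLetterX_inr l'))).elim
  vdash_mem := by
    refine letter_cases (fun i => letter_cases (fun j => ?_) fun l => ?_)
      (fun l => letter_cases (fun i => ?_) fun l' => ?_)
    · rw [prodBasis_inl, prodBasis_inl, vdash_inl_inl (k := k)]
      simpa only [iff_true_right (isLetterX_inl i)] using inl_mem_span_prodBasis B₁ B₂ _
    · rw [prodBasis_inl, prodBasis_inr, vdash_inl_inr (k := k)]; exact zero_mem _
    · rw [prodBasis_inl, prodBasis_inr, vdash_inr_inl (k := k)]; exact zero_mem _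
    · rw [prodBasis_inr, prodBasis_inr, vdash_inr_inr (k := k)]
      simpa only [iff_false_right (not_isLetterX_inr l)] using inr_mem_span_prodBasis B₁ B₂ _
  dashv_mem := by
    refine letter_cases (fun i => letter_cases (fun j => ?_) fun l => ?_)
      (fun l => letter_cases (fun i => ?_) fun l' => ?_)
    · rw [prodBasis_inl, prodBasis_inl, dashv_inl_inl (k := k)]
      simpa only [iff_true_right (isLetterX_inl i)] using inl_mem_span_prodBasis B₁ B₂ _
    · rw [prodBasis_inl, prodBasis_inr, dashv_inl_inr (k := k)]; exact zero_mem _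
    · rw [prodBasis_inl, prodBasis_inr, dashv_inr_inl (k := k)]; exact zero_mem _
    · rw [prodBasis_inr, prodBasis_inr, dashv_inr_inr (k := k)]
      simpa only [iff_false_right (not_isLetterX_inr l)] using inr_mem_span_prodBasis B₁ B₂ _
  isIdeal := by
    rw [span_prodBasis_image, hI₀, hJ₀]
    have h₁ : IsDialgebraIdeal k (barIdeal k D₁) := isDialgebraIdeal_dialgebraIdeal k _
    have h₂ : IsDialgebraIdeal k (barIdeal k D₂) := isDialgebraIdeal_dialgebraIdeal k _
    exact ⟨fun a x hx => ⟨h₁.vdash_left _ _ hx.1, h₂.vdash_left _ _ hx.2⟩,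
      fun a x hx => ⟨h₁.vdash_right _ _ hx.1, h₂.vdash_right _ _ hx.2⟩,
      fun a x hx => ⟨h₁.dashv_left _ _ hx.1, h₂.dashv_left _ _ hx.2⟩,
      fun a x hx => ⟨h₁.dashv_right _ _ hx.1, h₂.dashv_right _ _ hx.2⟩⟩
  le_annihilator := by
    rw [span_prodBasis_image, hI₀, hJ₀]
    intro a ha d
    have h₁ := barIdeal_le_barAnnihilator k ha.1 d.1
    have h₂ := barIdeal_le_barAnnihilator k ha.2 d.2
    exact ⟨Prod.ext h₁.1 h₂.1, Prod.ext h₁.2 h₂.2⟩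
  bar_mem z z' := by
    rw [span_prodBasis_image, hI₀, hJ₀]
    exact ⟨dashv_sub_vdash_mem_barIdeal k _ _, dashv_sub_vdash_mem_barIdeal k _ _⟩

/-! ### The set S as a set of defects in the direct product -/

variable (B₁ B₂ I₀ J₀)

theorem splitDiwords_eq_alternatingDiwords :
    splitDiwords IsLetterX (barLetters I₀ J₀) = alternatingDiwords I₀ J₀ := by
  have h (z : I ⊕ₗ J) : z ∉ barLetters I₀ J₀ ↔
      (∃ i : I, i ∉ I₀ ∧ z = Sum.inlₗ i) ∨ (∃ l : J, l ∉ J₀ ∧ z = Sum.inrₗ l) := by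
    revert z
    refine letter_cases (fun i => ?_) fun l => ?_
    · rw [inl_mem_barLetters]
      refine ⟨fun h => Or.inl ⟨i, h, rfl⟩, ?_⟩
      rintro (⟨i', h, e⟩ | ⟨l, h, e⟩)
      · rwa [Sum.inl_injective (toLex.injective e)]
      · exact (Sum.inl_ne_inr (toLex.injective e)).elim
    · rw [inr_mem_barLetters]
      refine ⟨fun h => Or.inr ⟨l, h, rfl⟩, ?_⟩
      rintro (⟨i', h, e⟩ | ⟨l, h, e⟩)
      · exact (Sum.inr_ne_inl (toLex.injective e)).elim
      · rwa [Sum.inr_injective (toLex.injective e)]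
  simp only [splitDiwords, alternatingDiwords, h]

theorem vdashDefect_inl_inl (i j : I) :
    vdashDefect (prodBasis B₁ B₂) (prodBasis B₁ B₂ (Sum.inlₗ i)) (prodBasis B₁ B₂ (Sum.inlₗ j)) =
      gen k (Sum.inlₗ i) ⊢ᵈ gen k (Sum.inlₗ j) - expand B₁ Sum.inlₗ (B₁ i ⊢ᵈ B₁ j) := by
  rw [vdashDefect_apply, expand_basis, expand_basis, prodBasis_inl, prodBasis_inl,
    vdash_inl_inl (k := k), expand_prodBasis_inl]

theorem dashvDefect_inl_inl (i j : I) :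
    dashvDefect (prodBasis B₁ B₂) (prodBasis B₁ B₂ (Sum.inlₗ i)) (prodBasis B₁ B₂ (Sum.inlₗ j)) =
      gen k (Sum.inlₗ i) ⊣ᵈ gen k (Sum.inlₗ j) - expand B₁ Sum.inlₗ (B₁ i ⊣ᵈ B₁ j) := by
  rw [dashvDefect_apply, expand_basis, expand_basis, prodBasis_inl, prodBasis_inl,
    dashv_inl_inl (k := k), expand_prodBasis_inl]

theorem vdashDefect_inr_inr (l l' : J) :
    vdashDefect (prodBasis B₁ B₂) (prodBasis B₁ B₂ (Sum.inrₗ l)) (prodBasis B₁ B₂ (Sum.inrₗ l')) =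
      gen k (Sum.inrₗ l) ⊢ᵈ gen k (Sum.inrₗ l') - expand B₂ Sum.inrₗ (B₂ l ⊢ᵈ B₂ l') := by
  rw [vdashDefect_apply, expand_basis, expand_basis, prodBasis_inr, prodBasis_inr,
    vdash_inr_inr (k := k), expand_prodBasis_inr]

theorem dashvDefect_inr_inr (l l' : J) :
    dashvDefect (prodBasis B₁ B₂) (prodBasis B₁ B₂ (Sum.inrₗ l)) (prodBasis B₁ B₂ (Sum.inrₗ l')) =
      gen k (Sum.inrₗ l) ⊣ᵈ gen k (Sum.inrₗ l') - expand B₂ Sum.inrₗ (B₂ l ⊣ᵈ B₂ l') := by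
  rw [dashvDefect_apply, expand_basis, expand_basis, prodBasis_inr, prodBasis_inr,
    dashv_inr_inr (k := k), expand_prodBasis_inr]

theorem vdashDefect_inl_inr (i : I) (l : J) :
    vdashDefect (prodBasis B₁ B₂) (prodBasis B₁ B₂ (Sum.inlₗ i)) (prodBasis B₁ B₂ (Sum.inrₗ l)) =
      gen k (Sum.inlₗ i) ⊢ᵈ gen k (Sum.inrₗ l) := by
  rw [vdashDefect_apply, expand_basis, expand_basis, prodBasis_inl, prodBasis_inr,
    vdash_inl_inr (k := k), map_zero, sub_zero]

theorem dashvDefect_inl_inr (i : I) (l : J) :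
    dashvDefect (prodBasis B₁ B₂) (prodBasis B₁ B₂ (Sum.inlₗ i)) (prodBasis B₁ B₂ (Sum.inrₗ l)) =
      gen k (Sum.inlₗ i) ⊣ᵈ gen k (Sum.inrₗ l) := by
  rw [dashvDefect_apply, expand_basis, expand_basis, prodBasis_inl, prodBasis_inr,
    dashv_inl_inr (k := k), map_zero, sub_zero]

theorem vdashDefect_inr_inl (i : I) (l : J) :
    vdashDefect (prodBasis B₁ B₂) (prodBasis B₁ B₂ (Sum.inrₗ l)) (prodBasis B₁ B₂ (Sum.inlₗ i)) =
      gen k (Sum.inrₗ l) ⊢ᵈ gen k (Sum.inlₗ i) := by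
  rw [vdashDefect_apply, expand_basis, expand_basis, prodBasis_inl, prodBasis_inr,
    vdash_inr_inl (k := k), map_zero, sub_zero]

theorem dashvDefect_inr_inl (i : I) (l : J) :
    dashvDefect (prodBasis B₁ B₂) (prodBasis B₁ B₂ (Sum.inrₗ l)) (prodBasis B₁ B₂ (Sum.inlₗ i)) =
      gen k (Sum.inrₗ l) ⊣ᵈ gen k (Sum.inlₗ i) := by
  rw [dashvDefect_apply, expand_basis, expand_basis, prodBasis_inl, prodBasis_inr,
    dashv_inr_inl (k := k), map_zero, sub_zero]

/-- A pair on one side gives an entry of a multiplication table. A mixed pair has product zero in D₁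
× D₂, so its defect is the bare product of the two letters, and it is reducible exactly when its
non-central letter lies in X₀ ∪ Y₀. -/
theorem freeProductRelations_eq_splitRelations :
    freeProductRelations B₁ I₀ B₂ J₀ =
      splitRelations (prodBasis B₁ B₂) IsLetterX (barLetters I₀ J₀) := by
  apply Set.Subset.antisymm
  · rintro _ ((((((⟨i, j, rfl⟩ | ⟨i, j, rfl⟩) | (⟨l, l', rfl⟩ | ⟨l, l', rfl⟩)) |
      ⟨i, hi, l, rfl⟩) | ⟨i, hi, l, rfl⟩) | ⟨l, hl, i, rfl⟩) | ⟨l, hl, i, rfl⟩)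
    · exact Or.inl ⟨_, _, Or.inl (iff_of_true (isLetterX_inl i) (isLetterX_inl j)),
        (vdashDefect_inl_inl B₁ B₂ i j).symm⟩
    · exact Or.inr ⟨_, _, Or.inl (iff_of_true (isLetterX_inl i) (isLetterX_inl j)),
        (dashvDefect_inl_inl B₁ B₂ i j).symm⟩
    · exact Or.inl ⟨_, _, Or.inl (iff_of_false (not_isLetterX_inr l) (not_isLetterX_inr l')),
        (vdashDefect_inr_inr B₁ B₂ l l').symm⟩
    · exact Or.inr ⟨_, _, Or.inl (iff_of_false (not_isLetterX_inr l) (not_isLetterX_inr l')),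
        (dashvDefect_inr_inr B₁ B₂ l l').symm⟩
    · exact Or.inl ⟨_, _, Or.inr (inl_mem_barLetters.2 hi), (vdashDefect_inl_inr B₁ B₂ i l).symm⟩
    · exact Or.inr ⟨_, _, Or.inr (inl_mem_barLetters.2 hi), (dashvDefect_inr_inl B₁ B₂ i l).symm⟩
    · exact Or.inl ⟨_, _, Or.inr (inr_mem_barLetters.2 hl), (vdashDefect_inr_inl B₁ B₂ i l).symm⟩
    · exact Or.inr ⟨_, _, Or.inr (inr_mem_barLetters.2 hl), (dashvDefect_inl_inr B₁ B₂ i l).symm⟩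
  · rintro _ (⟨z, z', h, rfl⟩ | ⟨z, z', h, rfl⟩)
    · revert z z'
      refine letter_cases (fun i => letter_cases (fun j _ => ?_) fun l h => ?_)
        (fun l => letter_cases (fun i h => ?_) fun l' _ => ?_)
      · rw [vdashDefect_inl_inl]
        exact Or.inl (Or.inl (Or.inl (Or.inl (Or.inl (Or.inl ⟨i, j, rfl⟩)))))
      · rw [vdashDefect_inl_inr]
        have hi := h.resolve_left fun h' => not_isLetterX_inr l (h'.1 (isLetterX_inl i))
        exact Or.inl (Or.inl (Or.inl (Or.inr ⟨i, inl_mem_barLetters.1 hi, l, rfl⟩)))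
      · rw [vdashDefect_inr_inl]
        have hl := h.resolve_left fun h' => not_isLetterX_inr l (h'.2 (isLetterX_inl i))
        exact Or.inl (Or.inr ⟨l, inr_mem_barLetters.1 hl, i, rfl⟩)
      · rw [vdashDefect_inr_inr]
        exact Or.inl (Or.inl (Or.inl (Or.inl (Or.inr (Or.inl ⟨l, l', rfl⟩)))))
    · revert z z'
      refine letter_cases (fun i => letter_cases (fun j _ => ?_) fun l h => ?_)
        (fun l => letter_cases (fun i h => ?_) fun l' _ => ?_)
      · rw [dashvDefect_inl_inl]
        exact Or.inl (Or.inl (Or.inl (Or.inl (Or.inl (Or.inr ⟨i, j, rfl⟩)))))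
      · rw [dashvDefect_inl_inr]
        have hl := h.resolve_left fun h' => not_isLetterX_inr l (h'.1 (isLetterX_inl i))
        exact Or.inr ⟨l, inr_mem_barLetters.1 hl, i, rfl⟩
      · rw [dashvDefect_inr_inl]
        have hi := h.resolve_left fun h' => not_isLetterX_inr l (h'.2 (isLetterX_inl i))
        exact Or.inl (Or.inl (Or.inr ⟨i, inl_mem_barLetters.1 hi, l, rfl⟩))
      · rw [dashvDefect_inr_inr]
        exact Or.inl (Or.inl (Or.inl (Or.inl (Or.inr (Or.inr ⟨l, l', rfl⟩)))))

variable {B₁ B₂ I₀ J₀}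

/-- The mixed relations follow from the multiplication tables. -/
theorem dialgebraIdeal_freeProductRelations
    (hI₀ : Submodule.span k (B₁ '' I₀) = barIdeal k D₁)
    (hJ₀ : Submodule.span k (B₂ '' J₀) = barIdeal k D₂) :
    dialgebraIdeal k (freeProductRelations B₁ I₀ B₂ J₀) =
      dialgebraIdeal k (freeProductTables B₁ B₂) := by
  -- The class of a letter in X₀ is the image of an element of A₁, hence lies in the bar ideal of
  -- the quotient and annihilates all of it.
  have hx {i : I} (hi : i ∈ I₀) (q : DialgebraFreeProduct B₁ B₂) :=
    barIdeal_le_barAnnihilator k ((tableHom B₁ Sum.inlₗ (Set.subset_union_left :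
      _ ⊆ freeProductTables B₁ B₂)).barIdeal_le_comap
        (hI₀ ▸ Submodule.subset_span ⟨i, hi, rfl⟩ : B₁ i ∈ barIdeal k D₁)) q
  have hy {l : J} (hl : l ∈ J₀) (q : DialgebraFreeProduct B₁ B₂) :=
    barIdeal_le_barAnnihilator k ((tableHom B₂ Sum.inrₗ (Set.subset_union_right :
      _ ⊆ freeProductTables B₁ B₂)).barIdeal_le_comap
        (hJ₀ ▸ Submodule.subset_span ⟨l, hl, rfl⟩ : B₂ l ∈ barIdeal k D₂)) q
  simp only [tableHom_basis] at hx hy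
  refine le_antisymm (dialgebraIdeal_le k (isDialgebraIdeal_dialgebraIdeal k _) ?_)
    (dialgebraIdeal_le k (isDialgebraIdeal_dialgebraIdeal k _)
      (fun f hf => subset_dialgebraIdeal k _ (Or.inl (Or.inl (Or.inl (Or.inl hf))))))
  rintro _ ((((h | ⟨i, hi, l, rfl⟩) | ⟨i, hi, l, rfl⟩) | ⟨l, hl, i, rfl⟩) | ⟨l, hl, i, rfl⟩)
  · exact subset_dialgebraIdeal k _ h
  · exact (Submodule.Quotient.mk_eq_zero _).1 (hx hi (Submodule.mkQ _ (gen k (Sum.inrₗ l)))).1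
  · exact (Submodule.Quotient.mk_eq_zero _).1 (hx hi (Submodule.mkQ _ (gen k (Sum.inrₗ l)))).2
  · exact (Submodule.Quotient.mk_eq_zero _).1 (hy hl (Submodule.mkQ _ (gen k (Sum.inlₗ i)))).1
  · exact (Submodule.Quotient.mk_eq_zero _).1 (hy hl (Submodule.mkQ _ (gen k (Sum.inlₗ i)))).2

end FreeProductPresentation

theorem mainTheorem5 {k : Type*} [Field k]
    {D₁ : Type*} [AddCommGroup D₁] [Module k D₁] [Dialgebra k D₁]
    {D₂ : Type*} [AddCommGroup D₂] [Module k D₂] [Dialgebra k D₂]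
    {I : Type*} [LinearOrder I] [WellFoundedLT I]
    {J : Type*} [LinearOrder J] [WellFoundedLT J]
    (B₁ : Module.Basis I k D₁) (I₀ : Set I)
    (hI₀ : Submodule.span k (B₁ '' I₀) = barIdeal k D₁)
    (B₂ : Module.Basis J k D₂) (J₀ : Set J)
    (hJ₀ : Submodule.span k (B₂ '' J₀) = barIdeal k D₂) :
    -- the dialgebra presented by the two multiplication tables is the free product
    (∃ (ε₁ : DialgebraHom k D₁ (DialgebraFreeProduct B₁ B₂))
       (ε₂ : DialgebraHom k D₂ (DialgebraFreeProduct B₁ B₂)),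
      (∀ i, ε₁.toLinearMap (B₁ i) = diwordClass B₁ B₂ (Diword.letter (Sum.inlₗ i))) ∧
      (∀ l, ε₂.toLinearMap (B₂ l) = diwordClass B₁ B₂ (Diword.letter (Sum.inrₗ l))) ∧
      IsDialgebraFreeProduct.{w} ε₁ ε₂) ∧
    -- `S` is a Gröbner–Shirshov basis and generates the same ideal as the tables
    IsGroebnerShirshovBasis (freeProductRelations B₁ I₀ B₂ J₀) ∧
    dialgebraIdeal k (freeProductRelations B₁ I₀ B₂ J₀) =
      dialgebraIdeal k (freeProductTables B₁ B₂) ∧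
    -- `Irr(S)` consists of the alternating diwords and is a linear basis of the free product
    Irr (freeProductRelations B₁ I₀ B₂ J₀) = alternatingDiwords I₀ J₀ ∧
    ∃ B : Module.Basis (Irr (freeProductRelations B₁ I₀ B₂ J₀)) k (DialgebraFreeProduct B₁ B₂),
      ∀ u, B u = diwordClass B₁ B₂ u := by
  have hS := freeProductRelations_eq_splitRelations B₁ B₂ I₀ J₀
  have H := isSplitBasis_prodBasis hI₀ hJ₀
  have hId := dialgebraIdeal_freeProductRelations hI₀ hJ₀
  -- The basis is obtained in the quotient by Id(S); equality of the two ideals places it in the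
  -- quotient by the tables.
  refine ⟨⟨tableHom B₁ Sum.inlₗ Set.subset_union_left, tableHom B₂ Sum.inrₗ Set.subset_union_right,
    tableHom_basis _ _ _, tableHom_basis _ _ _, isDialgebraFreeProduct_tableHom B₁ B₂⟩, ?_, hId,
    ?_, H.exists_basis_irr hS hId⟩
  · rw [hS]
    exact H.isGroebnerShirshovBasis
  · rw [hS, irr_splitRelations, splitDiwords_eq_alternatingDiwords]
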